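/- Let $M$ be a smooth 3-manifold and let $\xi,\tilde\xi$ be a pair of transverse smooth contact distributions on $M$. Write $(M,\xi,\tilde\xi)_+$ if they induce the same orientation of $M$ (the orientation induced by $\xi$ is given locally by $\alpha\wedge d\alpha$, for $\alpha$ a contact form with $\ker\alpha=\xi$), and $(M,\xi,\tilde\xi)_-$ if they induce opposite orientations. Suppose that the axis $A=\xi\cap\tilde\xi$ is oriented. Around every point there are local contact forms $\alpha,\tilde\alpha$ with $\ker\alpha=\xi$, $\ker\tilde\alpha=\tilde\xi$ which are balanced, $\alpha\wedge d\alpha=\pm\,\tilde\alpha\wedge d\tilde\alpha$, and such that the vector field $X$ along $A$ defined by $i_X(\alpha\wedge d\alpha)=\alpha\wedge\tilde\alpha$ is positive for the orientation of $A$. The generating invariant of $(M,\xi,\tilde\xi)_\pm$ is the function $I:M\to\mathbb{R}$ given, independently of the choice of such forms, by \[ I=\frac{\alpha\wedge d\tilde\alpha+\tilde\alpha\wedge d\alpha}{\alpha\wedge d\alpha}. \] Proposition. Suppose that the generating invariant $I$ of $(M,\xi,\tilde\xi)_\pm$ is constant. Then around every point of $M$ there are smooth local coordinates $(x,y,p)$,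 with $p+I\neq 0$, in which \[ \xi=\{dy=p\,dx\},\qquad \tilde\xi=\Big\{dy\pm\frac{dx}{p+I}=0\Big\}, \] where the sign $\pm$ is that of the pair. -/

import Mathlib

open scoped Manifold ContDiff Topology

noncomputable section

/-- The model space `ℝ³`; its coordinates `0, 1, 2` play the roles of `x, y, p`. -/
abbrev E3 : Type := EuclideanSpace ℝ (Fin 3)

section

variable {M : Type*} [TopologicalSpace M] [ChartedSpace E3 M]

/-- The coordinate expression of a 1-form `α` on `M` in the preferred chart at `m`,
i.e. the pullback of `α` by the inverse of the chart. -/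
def formInChart (α : ∀ m : M, TangentSpace 𝓘(ℝ, E3) m →L[ℝ] ℝ) (m : M) (z : E3) : E3 →L[ℝ] ℝ :=
  (α ((extChartAt 𝓘(ℝ, E3) m).symm z)).comp
    (mfderiv 𝓘(ℝ, E3) 𝓘(ℝ, E3) (extChartAt 𝓘(ℝ, E3) m).symm z)

/-- A 1-form is smooth on the open set `U` if its coordinate expressions are smooth. -/
def IsSmoothForm (α : ∀ m : M, TangentSpace 𝓘(ℝ, E3) m →L[ℝ] ℝ) (U : Set M) : Prop :=
  ∀ m ∈ U, ContDiffAt ℝ ∞ (formInChart α m) (extChartAt 𝓘(ℝ, E3) m m)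

/-- The exterior derivative `dα` of a 1-form `α` on `M`, at `m`, as a function of two tangent
vectors: the exterior derivative of the coordinate expression of `α`, pulled back by the chart. -/
def dForm (α : ∀ m : M, TangentSpace 𝓘(ℝ, E3) m →L[ℝ] ℝ) (m : M)
    (v w : TangentSpace 𝓘(ℝ, E3) m) : ℝ :=
  let D : TangentSpace 𝓘(ℝ, E3) m → E3 :=
    fun u => mfderiv 𝓘(ℝ, E3) 𝓘(ℝ, E3) (extChartAt 𝓘(ℝ, E3) m) m u
  extDeriv (fun z => ContinuousAlternatingMap.ofSubsingleton ℝ E3 ℝ (0 : Fin 1) (formInChart α m z))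
    (extChartAt 𝓘(ℝ, E3) m m) ![D v, D w]

/-- The 2-form `(α ∧ γ)ₘ` for 1-forms `α, γ`, as a function of two tangent vectors. -/
def wedge₁₁ (α γ : ∀ m : M, TangentSpace 𝓘(ℝ, E3) m →L[ℝ] ℝ) (m : M) :
    TangentSpace 𝓘(ℝ, E3) m → TangentSpace 𝓘(ℝ, E3) m → ℝ :=
  fun u v => α m u * γ m v - α m v * γ m u

/-- The 3-form `(α ∧ dγ)ₘ` for 1-forms `α, γ`, as a function of three tangent vectors. -/
def wedgeD (α γ : ∀ m : M, TangentSpace 𝓘(ℝ, E3) m →L[ℝ] ℝ) (m : M) :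
    TangentSpace 𝓘(ℝ, E3) m → TangentSpace 𝓘(ℝ, E3) m → TangentSpace 𝓘(ℝ, E3) m → ℝ :=
  fun u v w => α m u * dForm γ m v w + α m v * dForm γ m w u + α m w * dForm γ m u v

/-- `α` is a (smooth) contact form on the open set `U` for the distribution `ξ`:
`ξ = ker α` and `α ∧ dα` vanishes nowhere on `U`. -/
structure IsContactForm (ξ : ∀ m : M, Submodule ℝ (TangentSpace 𝓘(ℝ, E3) m))
    (α : ∀ m : M, TangentSpace 𝓘(ℝ, E3) m →L[ℝ] ℝ) (U : Set M) : Prop where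
  smooth : IsSmoothForm α U
  ker_eq : ∀ m ∈ U, ∀ v : TangentSpace 𝓘(ℝ, E3) m, v ∈ ξ m ↔ α m v = 0
  nondeg : ∀ m ∈ U, wedgeD α α m ≠ 0

/-- `ξ` is a contact distribution: around each point it is the kernel of a contact form. -/
def IsContactDistribution (ξ : ∀ m : M, Submodule ℝ (TangentSpace 𝓘(ℝ, E3) m)) : Prop :=
  ∀ m : M, ∃ U : Set M, IsOpen U ∧ m ∈ U ∧
    ∃ α : ∀ m : M, TangentSpace 𝓘(ℝ, E3) m →L[ℝ] ℝ, IsContactForm ξ α U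

/-- `(M, ξ, ξ')_ε` is a pair of transverse contact distributions on `M`, commonly oriented when
`ε = 1` and oppositely oriented when `ε = -1`; the orientation of `M` induced by a contact
distribution is the one given locally by `α ∧ dα`, for `α` a local contact form. -/
structure IsTransverseContactPair (ε : ℝ)
    (ξ ξ' : ∀ m : M, Submodule ℝ (TangentSpace 𝓘(ℝ, E3) m)) : Prop where
  contact : IsContactDistribution ξ
  contact' : IsContactDistribution ξ'
  transverse : ∀ m : M, ξ m ⊔ ξ' m = ⊤
  orientation : ∀ (U : Set M) (α α' : ∀ m : M, TangentSpace 𝓘(ℝ, E3) m →L[ℝ] ℝ), IsOpen U →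
    IsContactForm ξ α U → IsContactForm ξ' α' U →
    ∀ m ∈ U, ∃ r : ℝ, 0 < r ∧ wedgeD α α m = (ε * r) • wedgeD α' α' m

/-- The continuous vector field `X` orients the axis: `ξ ∩ ξ' = span {X}`.
(Only the ray spanned by `X m` matters below.) -/
structure OrientsAxis [IsManifold 𝓘(ℝ, E3) ∞ M]
    (ξ ξ' : ∀ m : M, Submodule ℝ (TangentSpace 𝓘(ℝ, E3) m))
    (X : ∀ m : M, TangentSpace 𝓘(ℝ, E3) m) : Prop where
  continuous : Continuous (fun m : M => (⟨m, X m⟩ : TangentBundle 𝓘(ℝ, E3) M))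
  span_eq : ∀ m : M, Submodule.span ℝ {X m} = ξ m ⊓ ξ' m

/-- `(α, α')` are balanced contact forms on `U` for `(M, ξ, ξ')_ε`, i.e. `α ∧ dα = ε α' ∧ dα'`,
such that the vector field `Z` along the axis with `i_Z (α ∧ dα) = α ∧ α'` is a positive multiple
of `X`. -/
structure IsBalanced (ε : ℝ) (ξ ξ' : ∀ m : M, Submodule ℝ (TangentSpace 𝓘(ℝ, E3) m))
    (X : ∀ m : M, TangentSpace 𝓘(ℝ, E3) m)
    (α α' : ∀ m : M, TangentSpace 𝓘(ℝ, E3) m →L[ℝ] ℝ) (U : Set M) : Prop where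
  contact : IsContactForm ξ α U
  contact' : IsContactForm ξ' α' U
  balanced : ∀ m ∈ U, wedgeD α α m = ε • wedgeD α' α' m
  normalized : ∀ m ∈ U, ∃ r : ℝ, 0 < r ∧ wedgeD α α m (r • X m) = wedge₁₁ α α' m

/-- `I` is the generating invariant of `(M, ξ, ξ')_ε`, with axis oriented by `X`:
`I = (α ∧ dα' + α' ∧ dα) / (α ∧ dα)` for balanced contact forms `(α, α')` adapted to the
orientation. Such forms exist around every point, and the quotient does not depend on them, so
this determines `I`. -/
def IsGeneratingInvariant (ε : ℝ) (ξ ξ' : ∀ m : M, Submodule ℝ (TangentSpace 𝓘(ℝ, E3) m))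
    (X : ∀ m : M, TangentSpace 𝓘(ℝ, E3) m) (I : M → ℝ) : Prop :=
  ∀ (U : Set M) (α α' : ∀ m : M, TangentSpace 𝓘(ℝ, E3) m →L[ℝ] ℝ), IsOpen U →
    IsBalanced ε ξ ξ' X α α' U →
    ∀ m ∈ U, wedgeD α α' m + wedgeD α' α m = I m • wedgeD α α m

/-- The differential at `m` of the `i`-th coordinate function of the chart `e`. -/
def coordDiff (e : OpenPartialHomeomorph M E3) (i : Fin 3) (m : M)
    (v : TangentSpace 𝓘(ℝ, E3) m) : ℝ :=
  (show E3 from mfderiv 𝓘(ℝ, E3) 𝓘(ℝ, E3) e m v) i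

end

end

/-! Let α, α' be balanced forms near a point, with constant invariant c. For a scalar κ, expanding
and using α' ∧ dα' = ε α ∧ dα gives (α' - κα) ∧ d(α' - κα) = (κ² - cκ + ε) α ∧ dα. So for a root κ
of κ² - cκ + ε, real or complex, the form α' - κα is integrable. In flow-box coordinates (u, v, w)
whose w-direction is the axis, both forms have no dw component, and integrability says that the
direction of the coefficient vector of α' - κα does not depend on w. It should therefore be h dF
with F a function of (u, v) only.

The form sought is α = m dy + l dx, α' = (cm - l) dy + εm dx. If κ' = c - κ is the other root, this
gives α' - κα = (κ'm - l) d(y + κx), so F must be y + κx. The sign of c² - 4ε decides how x and y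
are recovered. Two real roots give two functions F₁, F₂
(`IsBalancedPlanar.exists_isNormalizing_of_ne`). A double root gives one F, and x then solves a
first-order equation whose right-hand side descends to the plane
(`IsBalancedPlanar.exists_isNormalizing_of_double`). Conjugate roots lead to a complex F solving a
Beltrami equation F_v = σ F_u with Im σ ≠ 0, and x, y come from its real and imaginary parts
(`IsBalancedPlanar.exists_isNormalizing_of_lt`).

Now put p = -l/m. Then α = m (dy - p dx) and α' = m ((p + c) dy + ε dx), which is the claim. The
contact condition forces ∂p/∂w ≠ 0, so (x, y, p) are coordinates. A linear change of (x, y) first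
ensures that m and cm - l do not vanish at the point.

Two analytic tools are proved along the way. Smooth flows come from the inverse function theorem
applied to the integral equation in C([-1, 1], E). The Beltrami equation is solved by rescaling
until σ is close to a constant, expanding the perturbation in a Fourier series, and inverting an
order-zero perturbation of a constant-coefficient elliptic operator by a Neumann series. -/

/-! ### Local inverses, smooth near a point -/

section LocalInverse

variable {E F : Type*} [NormedAddCommGroup E] [NormedSpace ℝ E] [CompleteSpace E]
  [NormedAddCommGroup F] [NormedSpace ℝ F]

/-- The inverse function theorem for a map that is smooth near a point: a local inverse that is
smooth on the whole target, with invertible derivative on the whole source. -/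
theorem exists_smooth_local_inverse {f : E → F} {a : E} (hf : ∀ᶠ x in 𝓝 a, ContDiffAt ℝ ∞ f x)
    (f' : E ≃L[ℝ] F) (hf' : HasFDerivAt f (f' : E →L[ℝ] F) a) :
    ∃ e : OpenPartialHomeomorph E F, a ∈ e.source ∧ (∀ x, e x = f x) ∧
      (∀ x ∈ e.source, ContDiffAt ℝ ∞ f x) ∧
      (∀ x ∈ e.source, ∃ g : E ≃L[ℝ] F, HasFDerivAt f (g : E →L[ℝ] F) x) ∧
      ∀ y ∈ e.target, ContDiffAt ℝ ∞ e.symm y := by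
  have ha : ContDiffAt ℝ ∞ f a := hf.self_of_nhds
  let e₀ := ha.toOpenPartialHomeomorph f hf' (by simp)
  have hcont : ContinuousAt (fderiv ℝ f) a :=
    (ha.fderiv_right (m := 0) (by simp)).continuousAt
  have hinv : ∀ᶠ x in 𝓝 a, ∃ g : E ≃L[ℝ] F, (g : E →L[ℝ] F) = fderiv ℝ f x := by
    have := f'.nhds
    rw [← hf'.fderiv] at this
    filter_upwards [hcont this] with x hx using hx
  -- Invertible maps form an open set and the derivative is continuous, so shrinking the source to s
  -- makes the derivative invertible at every point, which is what smoothness of the inverse on the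
  -- whole target needs.
  obtain ⟨s, hs, hso, has⟩ := eventually_nhds_iff.1 (hf.and hinv)
  have hmem : a ∈ e₀.source := ha.mem_toOpenPartialHomeomorph_source hf' (by simp)
  have hd : ∀ x ∈ (e₀.restrOpen s hso).source,
      ∃ g : E ≃L[ℝ] F, HasFDerivAt f (g : E →L[ℝ] F) x := by
    intro x hx
    obtain ⟨g, hg⟩ := (hs x hx.2).2
    exact ⟨g, hg ▸ ((hs x hx.2).1.differentiableAt (by simp)).hasFDerivAt⟩
  refine ⟨e₀.restrOpen s hso, ⟨hmem, has⟩, fun x => rfl, fun x hx => (hs x hx.2).1, hd, ?_⟩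
  intro y hy
  have hx := (e₀.restrOpen s hso).map_target hy
  obtain ⟨g, hg⟩ := hd _ hx
  exact (e₀.restrOpen s hso).contDiffAt_symm hy hg (hs _ hx.2).1

/-- A function that is smooth near a point agrees near it with a globally smooth function. -/
theorem exists_contDiff_eventuallyEq {E F : Type*} [NormedAddCommGroup E] [NormedSpace ℝ E]
    [FiniteDimensional ℝ E] [NormedAddCommGroup F] [NormedSpace ℝ F]
    {f : E → F} {a : E} (hf : ∀ᶠ x in 𝓝 a, ContDiffAt ℝ ∞ f x) :
    ∃ g : E → F, ContDiff ℝ ∞ g ∧ g =ᶠ[𝓝 a] f := by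
  obtain ⟨r, hr, h⟩ := Metric.eventually_nhds_iff.1 hf
  let χ : ContDiffBump a := ⟨r / 4, r / 2, by positivity, by linarith⟩
  refine ⟨fun x => χ x • f x, ?_, ?_⟩
  · rw [contDiff_iff_contDiffAt]
    intro x
    by_cases hx : dist x a < r
    · exact χ.contDiffAt.smul (h hx)
    · have hx' : x ∉ tsupport χ := by
        rw [χ.tsupport_eq, Metric.mem_closedBall]
        change ¬ dist x a ≤ r / 2
        linarith
      have h0 : (fun y => χ y • f y) =ᶠ[𝓝 x] fun _ => 0 := by
        filter_upwards [notMem_tsupport_iff_eventuallyEq.1 hx'] with y hy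
        simp [hy]
      exact contDiffAt_const.congr_of_eventuallyEq h0
  · filter_upwards [χ.eventuallyEq_one] with x hx
    simp [hx]

end LocalInverse

/-! ### Smoothness of composition operators on spaces of continuous functions -/

section Postcomp

/-- Pointwise application of a continuous family of linear maps to a continuous function. -/
noncomputable def ContinuousMap.applyCLM (K E F : Type*) [TopologicalSpace K] [CompactSpace K]
    [NormedAddCommGroup E] [NormedSpace ℝ E] [NormedAddCommGroup F] [NormedSpace ℝ F] :
    C(K, E →L[ℝ] F) →L[ℝ] C(K, E) →L[ℝ] C(K, F) :=
  LinearMap.mkContinuous₂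
    (LinearMap.mk₂ ℝ (fun (A : C(K, E →L[ℝ] F)) (h : C(K, E)) =>
      (⟨fun k => A k (h k), by fun_prop⟩ : C(K, F)))
      (by intros; ext; simp) (by intros; ext; simp) (by intros; ext; simp) (by intros; ext; simp))
    1 (by
      intro A h
      rw [one_mul, ContinuousMap.norm_le _ (by positivity)]
      intro k
      exact (A k).le_of_opNorm_le_of_le (A.norm_coe_le_norm k) (h.norm_coe_le_norm k))

/-- Compactness of K makes postcomposition with v' continuous for the sup norm, so v' varies by at
most ε, uniformly in K, on a small ball about γ. The mean value inequality on each segment from γ k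
to η k then bounds the remainder. -/
theorem ContinuousMap.hasFDerivAt_postcomp {K E F : Type*} [TopologicalSpace K] [CompactSpace K]
    [NormedAddCommGroup E] [NormedSpace ℝ E] [NormedAddCommGroup F] [NormedSpace ℝ F]
    (v : C(E, F)) (v' : C(E, E →L[ℝ] F)) (hv : ∀ x, HasFDerivAt v (v' x) x) (γ : C(K, E)) :
    HasFDerivAt (fun η : C(K, E) => v.comp η)
      (ContinuousMap.applyCLM K E F (v'.comp γ)) γ := by
  rw [hasFDerivAt_iff_isLittleO, Asymptotics.isLittleO_iff]
  intro ε hε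
  obtain ⟨δ, hδ, h⟩ := Metric.mem_nhds_iff.1
    ((ContinuousMap.continuous_postcomp (X := K) v').continuousAt.preimage_mem_nhds
      (Metric.ball_mem_nhds (v'.comp γ) hε))
  filter_upwards [Metric.ball_mem_nhds γ hδ] with η hη
  rw [ContinuousMap.norm_le _ (by positivity)]
  intro k
  have key : ‖v (η k) - v (γ k) - v' (γ k) (η k - γ k)‖ ≤ ε * ‖η k - γ k‖ := by
    refine (convex_segment (γ k) (η k)).norm_image_sub_le_of_norm_hasFDerivWithin_le'
      (fun x _ => (hv x).hasFDerivWithinAt) ?_ (left_mem_segment ℝ _ _) (right_mem_segment ℝ _ _)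
    intro x hx
    obtain ⟨s, hs, rfl⟩ := (segment_eq_image' ℝ (γ k) (η k) ▸ hx)
    -- The point of the segment over k is the value at k of a function in the same ball, so the
    -- uniform estimate applies to it.
    have hd : dist (γ + s • (η - γ)) γ < δ := by
      rw [dist_eq_norm, add_sub_cancel_left, norm_smul, Real.norm_of_nonneg hs.1]
      rw [Metric.mem_ball, dist_eq_norm] at hη
      nlinarith [norm_nonneg (η - γ), hs.2]
    have h1 := (ContinuousMap.dist_apply_le_dist k).trans (le_of_lt (h (Metric.mem_ball.2 hd)))
    rw [dist_eq_norm] at h1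
    exact h1
  exact key.trans (mul_le_mul_of_nonneg_left ((η - γ).norm_coe_le_norm k) hε.le)

/-- The derivative is again postcomposition, with v', followed by a bounded linear map. Induction on
the order of smoothness works once the target space is quantified, since it changes from F to E
→L[ℝ] F; a single universe makes this possible. -/
theorem ContinuousMap.contDiff_postcomp {K E F : Type} [TopologicalSpace K] [CompactSpace K]
    [NormedAddCommGroup E] [NormedSpace ℝ E]
    [NormedAddCommGroup F] [NormedSpace ℝ F] (v : C(E, F)) (hv : ContDiff ℝ ∞ v) :
    ContDiff ℝ ∞ (fun η : C(K, E) => v.comp η) := by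
  have main : ∀ (n : ℕ) (F : Type) [NormedAddCommGroup F] [NormedSpace ℝ F] (v : C(E, F)),
      ContDiff ℝ ∞ v → ContDiff ℝ n (fun η : C(K, E) => v.comp η) := by
    intro n
    induction n with
    | zero =>
      intro F _ _ v _
      exact contDiff_zero.2 (ContinuousMap.continuous_postcomp v)
    | succ n ih =>
      intro F _ _ v hv
      have h' : ContDiff ℝ ∞ (fderiv ℝ v) := hv.fderiv_right (by simp)
      let v' : C(E, E →L[ℝ] F) := ⟨fderiv ℝ v, h'.continuous⟩
      push_cast
      refine (contDiff_succ_iff_hasFDerivAt).2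
        ⟨fun γ => ContinuousMap.applyCLM K E F (v'.comp γ), ?_, ?_⟩
      · exact (ContinuousMap.applyCLM K E F).contDiff.comp (ih _ v' h')
      · exact ContinuousMap.hasFDerivAt_postcomp v v'
          (fun x => (hv.differentiable (by simp) x).hasFDerivAt)
  exact contDiff_infty.2 fun n => main n F v hv

end Postcomp

/-! ### Smooth flows and flow boxes -/

section Flow

open intervalIntegral

/-- Integration from `0` of continuous functions on `[-1, 1]`. -/
noncomputable def ContinuousMap.primitiveCLM (E : Type*) [NormedAddCommGroup E] [NormedSpace ℝ E] :
    C(Set.Icc (-1 : ℝ) 1, E) →L[ℝ] C(Set.Icc (-1 : ℝ) 1, E) :=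
  LinearMap.mkContinuous
    { toFun := fun γ =>
        ⟨fun s => ∫ τ in (0 : ℝ)..s, γ.IccExtend (by norm_num : (-1 : ℝ) ≤ 1) τ,
          (continuous_primitive (fun a b => (ContinuousMap.continuous _).intervalIntegrable a b)
            0).comp continuous_subtype_val⟩
      map_add' := fun γ η => by
        ext s
        exact integral_add
          ((γ.IccExtend (by norm_num : (-1 : ℝ) ≤ 1)).continuous.intervalIntegrable _ _)
          ((η.IccExtend (by norm_num : (-1 : ℝ) ≤ 1)).continuous.intervalIntegrable _ _)
      map_smul' := fun c γ => by
        ext s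
        exact integral_smul c _ }
    1 (fun γ => by
      rw [one_mul, ContinuousMap.norm_le _ (norm_nonneg _)]
      intro s
      have h := norm_integral_le_of_norm_le_const (a := (0 : ℝ)) (b := s) (C := ‖γ‖)
        (f := γ.IccExtend (by norm_num : (-1 : ℝ) ≤ 1)) (fun τ _ => γ.norm_coe_le_norm _)
      refine h.trans (mul_le_of_le_one_right (norm_nonneg _) ?_)
      rw [sub_zero]
      exact abs_le.2 s.2)

variable {E : Type} [NormedAddCommGroup E] [NormedSpace ℝ E]

theorem ContinuousMap.primitiveCLM_apply (γ : C(Set.Icc (-1 : ℝ) 1, E)) (s : Set.Icc (-1 : ℝ) 1) :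
    ContinuousMap.primitiveCLM E γ s =
      ∫ τ in (0 : ℝ)..s, γ.IccExtend (by norm_num : (-1 : ℝ) ≤ 1) τ := rfl

/-- Multiplication by `s` as a self-map of `[-1, 1]`. -/
def scaleIcc (s : Set.Icc (-1 : ℝ) 1) : C(Set.Icc (-1 : ℝ) 1, Set.Icc (-1 : ℝ) 1) :=
  ⟨fun τ => ⟨s * τ, abs_le.1 (by
    rw [abs_mul]; exact mul_le_one₀ (abs_le.2 s.2) (abs_nonneg _) (abs_le.2 τ.2))⟩, by fun_prop⟩

/-- Linear change of variable. It shows that rescaling time in a solution of γ = x + t ∫ v(γ) gives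
a solution for the parameter s t. -/
theorem ContinuousMap.primitiveCLM_comp_scaleIcc (γ : C(Set.Icc (-1 : ℝ) 1, E))
    (s : Set.Icc (-1 : ℝ) 1) :
    (s : ℝ) • ContinuousMap.primitiveCLM E (γ.comp (scaleIcc s)) =
      (ContinuousMap.primitiveCLM E γ).comp (scaleIcc s) := by
  ext τ
  have h1 : (scaleIcc s τ : ℝ) = s * τ := rfl
  rw [ContinuousMap.smul_apply, ContinuousMap.comp_apply, ContinuousMap.primitiveCLM_apply,
    ContinuousMap.primitiveCLM_apply, h1]
  have h2 := smul_integral_comp_mul_left (a := 0) (b := τ)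
    (γ.IccExtend (by norm_num : (-1 : ℝ) ≤ 1)) (s : ℝ)
  rw [mul_zero] at h2
  rw [← h2]
  congr 1
  refine integral_congr fun x hx => ?_
  have hx' : x ∈ Set.Icc (-1 : ℝ) 1 := by
    have h0 : (0 : ℝ) ∈ Set.Icc (-1 : ℝ) 1 := by constructor <;> norm_num
    exact Set.uIcc_subset_Icc h0 τ.2 hx
  change γ.comp (scaleIcc s) (Set.projIcc _ _ _ x) = γ (Set.projIcc _ _ _ _)
  rw [Set.projIcc_of_mem _ hx']
  exact congrArg γ (Set.projIcc_of_mem _ (scaleIcc s ⟨x, hx'⟩).2).symm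

/-- A smooth vector field has a smooth local flow. -/
theorem exists_smooth_flow [CompleteSpace E] {v : E → E} (hv : ContDiff ℝ ∞ v) (p : E) :
    ∃ φ : E × ℝ → E, (∀ᶠ q in 𝓝 (p, (0 : ℝ)), ContDiffAt ℝ ∞ φ q) ∧
      (∀ᶠ x in 𝓝 p, φ (x, 0) = x) ∧
      ∀ᶠ q in 𝓝 (p, (0 : ℝ)), HasDerivAt (fun t => φ (q.1, t)) (v (φ q)) q.2 := by
  let I := Set.Icc (-1 : ℝ) 1
  let C := C(I, E)
  let vc : C(E, E) := ⟨v, hv.continuous⟩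
  let c : E →L[ℝ] C := ContinuousLinearMap.const ℝ I
  let N : C → C := fun γ => vc.comp γ
  have hN : ContDiff ℝ ∞ N := ContinuousMap.contDiff_postcomp vc hv
  let P : C →L[ℝ] C := ContinuousMap.primitiveCLM E
  -- The zeros of the second component are the curves with γ(s) = x + t ∫₀ˢ v(γ), the integral
  -- curves run at speed t. At t = 0 the derivative in γ is the identity, so γ is a smooth function
  -- of (x, t) near (p, 0), and the flow is its value at s = 1.
  let Ψ : (E × ℝ) × C → (E × ℝ) × C := fun z => (z.1, z.2 - c z.1.1 - z.1.2 • P (N z.2))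
  have hΨ : ContDiff ℝ ∞ Ψ := by
    have h1 : ContDiff ℝ ∞ (fun z : (E × ℝ) × C => P (N z.2)) :=
      P.contDiff.comp (hN.comp contDiff_snd)
    have h2 : ContDiff ℝ ∞ (fun z : (E × ℝ) × C => c z.1.1) :=
      c.contDiff.comp (contDiff_fst.comp contDiff_fst)
    exact contDiff_fst.prodMk ((contDiff_snd.sub h2).sub
      ((contDiff_snd.comp contDiff_fst).smul h1))
  let T : E × ℝ →L[ℝ] C := c.comp (ContinuousLinearMap.fst ℝ E ℝ) +
    (ContinuousLinearMap.snd ℝ E ℝ).smulRight (P (N (c p)))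
  let π₁ := ContinuousLinearMap.fst ℝ (E × ℝ) C
  let π₂ := ContinuousLinearMap.snd ℝ (E × ℝ) C
  let Ψ' : ((E × ℝ) × C) ≃L[ℝ] ((E × ℝ) × C) :=
    ContinuousLinearEquiv.equivOfInverse (π₁.prod (π₂ - T.comp π₁)) (π₁.prod (π₂ + T.comp π₁))
      (fun z => by simp [π₁, π₂]) (fun z => by simp [π₁, π₂])
  let a : (E × ℝ) × C := ((p, 0), c p)
  have hd : HasFDerivAt Ψ (Ψ' : (E × ℝ) × C →L[ℝ] (E × ℝ) × C) a := by
    have h1 : HasFDerivAt (fun z : (E × ℝ) × C => P (N z.2))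
        (fderiv ℝ (fun z : (E × ℝ) × C => P (N z.2)) a) a :=
      (((P.contDiff.comp (hN.comp contDiff_snd)) : ContDiff ℝ ∞ _).differentiable
        (by simp) a).hasFDerivAt
    have h2 : HasFDerivAt (fun z : (E × ℝ) × C => c z.1.1)
        (c.comp ((ContinuousLinearMap.fst ℝ E ℝ).comp π₁)) a :=
      (c.comp ((ContinuousLinearMap.fst ℝ E ℝ).comp π₁)).hasFDerivAt
    have h3 : HasFDerivAt (fun z : (E × ℝ) × C => z.1.2)
        ((ContinuousLinearMap.snd ℝ E ℝ).comp π₁) a :=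
      ((ContinuousLinearMap.snd ℝ E ℝ).comp π₁).hasFDerivAt
    refine (π₁.hasFDerivAt.prodMk ((π₂.hasFDerivAt.sub h2).sub (h3.smul h1))).congr_fderiv ?_
    ext z <;> simp [Ψ', T, π₁, π₂, a]
  obtain ⟨e, hae, he, -, -, hes⟩ := exists_smooth_local_inverse
    (Filter.Eventually.of_forall fun x => hΨ.contDiffAt) Ψ' hd
  have hΨa : Ψ a = ((p, 0), 0) := by simp [Ψ, a]
  let G : E × ℝ → (E × ℝ) × C := fun q => e.symm (q, 0)
  have hGa : G (p, 0) = a := by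
    change e.symm ((p, 0), 0) = a
    rw [← hΨa, ← he, e.left_inv hae]
  have htarget : ∀ᶠ q in 𝓝 (p, (0 : ℝ)), (q, (0 : C)) ∈ e.target := by
    have h1 : Filter.Tendsto (fun q : E × ℝ => (q, (0 : C))) (𝓝 (p, 0)) (𝓝 ((p, 0), 0)) :=
      (by fun_prop : Continuous fun q : E × ℝ => (q, (0 : C))).tendsto _
    refine h1.eventually (e.open_target.mem_nhds ?_)
    rw [← hΨa, ← he]
    exact e.map_source hae
  have hGs : ∀ᶠ q in 𝓝 (p, (0 : ℝ)), ContDiffAt ℝ ∞ G q := by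
    filter_upwards [htarget] with q hq
    exact (hes _ hq).comp q (contDiff_id.prodMk contDiff_const).contDiffAt
  have hGt : Filter.Tendsto G (𝓝 (p, 0)) (𝓝 a) := by
    have := hGs.self_of_nhds.continuousAt.tendsto
    rwa [hGa] at this
  have hfix : ∀ q, (q, (0 : C)) ∈ e.target → (G q).1 = q ∧
      (G q).2 = c q.1 + q.2 • P (N (G q).2) := by
    intro q hq
    have h1 : Ψ (G q) = (q, 0) := by rw [← he]; exact e.right_inv hq
    have h2 : (G q).1 = q := congrArg Prod.fst h1
    have h3 : (G q).2 - c (G q).1.1 - (G q).1.2 • P (N (G q).2) = 0 := congrArg Prod.snd h1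
    refine ⟨h2, ?_⟩
    rw [h2, sub_sub, sub_eq_zero] at h3
    exact h3
  obtain ⟨r, hr, hrs⟩ := Metric.mem_nhds_iff.1 (e.open_source.mem_nhds hae)
  obtain ⟨δ, hδ, hδs⟩ := Metric.eventually_nhds_iff.1
    ((htarget.and (hGt.eventually (Metric.ball_mem_nhds a hr))).and
      (Metric.ball_mem_nhds (p, (0 : ℝ)) hr))
  -- Both sides solve the integral equation with parameter s t and lie where the local inverse is
  -- injective. Hence φ(x, s t) is the value at s of the curve for (x, t), which identifies the
  -- parameter t with time. Allowing negative s covers both time directions.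
  have hscale : ∀ x t, dist (x, t) (p, (0 : ℝ)) < δ → ∀ s : I,
      (G (x, s * t)).2 = (G (x, t)).2.comp (scaleIcc s) := by
    intro x t hxt s
    obtain ⟨⟨ht, hG⟩, hq⟩ := hδs hxt
    obtain ⟨h1, h2⟩ := hfix _ ht
    have hle : dist (x, (s : ℝ) * t) (p, (0 : ℝ)) ≤ dist (x, t) (p, (0 : ℝ)) := by
      simp only [Prod.dist_eq, dist_zero_right, norm_mul]
      exact max_le_max le_rfl (mul_le_of_le_one_left (norm_nonneg _) (abs_le.2 s.2))
    have hmem : (((x, (s : ℝ) * t), (G (x, t)).2.comp (scaleIcc s)) : (E × ℝ) × C) ∈ e.source := by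
      apply hrs
      rw [Metric.mem_ball]
      refine max_lt (lt_of_le_of_lt hle hq) (lt_of_le_of_lt ?_ hG)
      refine le_trans ?_ (le_max_right _ _)
      change dist ((G (x, t)).2.comp (scaleIcc s)) (c p) ≤ dist (G (x, t)).2 (c p)
      rw [ContinuousMap.dist_le dist_nonneg]
      intro τ
      exact ContinuousMap.dist_apply_le_dist (f := (G (x, t)).2) (g := c p) (scaleIcc s τ)
    have hval : e ((x, (s : ℝ) * t), (G (x, t)).2.comp (scaleIcc s)) = ((x, s * t), 0) := by
      rw [he]
      refine Prod.ext rfl ?_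
      change (G (x, t)).2.comp (scaleIcc s) - c x -
        ((s : ℝ) * t) • P ((N (G (x, t)).2).comp (scaleIcc s)) = 0
      have h3 := ContinuousMap.primitiveCLM_comp_scaleIcc (N (G (x, t)).2) s
      have h4 : ((s : ℝ) * t) • P ((N (G (x, t)).2).comp (scaleIcc s)) =
          t • (P (N (G (x, t)).2)).comp (scaleIcc s) := by
        rw [← h3, mul_comm, mul_smul]
      rw [h4]
      have h5 : (G (x, t)).2.comp (scaleIcc s) =
          (c x + t • P (N (G (x, t)).2)).comp (scaleIcc s) := congrArg (·.comp (scaleIcc s)) h2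
      rw [h5]
      ext τ
      change c x (scaleIcc s τ) + t • P (N (G (x, t)).2) (scaleIcc s τ) - c x τ -
        t • P (N (G (x, t)).2) (scaleIcc s τ) = 0
      change x + _ - x - _ = 0
      abel
    have := e.left_inv hmem
    rw [hval] at this
    exact congrArg Prod.snd this
  let one : I := ⟨1, by norm_num, le_rfl⟩
  have hφs : ∀ x t, dist (x, t) (p, (0 : ℝ)) < δ → ∀ s : I,
      (G (x, s * t)).2 one = (G (x, t)).2 s := by
    intro x t h s
    rw [hscale x t h s, ContinuousMap.comp_apply]
    congr 1
    exact Subtype.ext (mul_one _)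
  refine ⟨fun q => (G q).2 one, ?_, ?_, ?_⟩
  · filter_upwards [hGs] with q hq
    exact ((ContinuousMap.evalCLM ℝ one).contDiff.comp contDiff_snd).contDiffAt.comp q hq
  · have h1 : Filter.Tendsto (fun x : E => (x, (0 : ℝ))) (𝓝 p) (𝓝 (p, 0)) :=
      (by fun_prop : Continuous fun x : E => (x, (0 : ℝ))).tendsto _
    filter_upwards [h1.eventually htarget] with x hx
    rw [(hfix _ hx).2, zero_smul, add_zero]
    rfl
  · filter_upwards [Metric.ball_mem_nhds (p, (0 : ℝ)) (half_pos hδ)] with q hq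
    obtain ⟨x, t⟩ := q
    rw [Metric.mem_ball, Prod.dist_eq, max_lt_iff, dist_zero_right, Real.norm_eq_abs] at hq
    -- One reference curve, with parameter b, carries φ(x, t') for all |t'| < b as its value at
    -- t'/b; differentiating its integral equation gives the flow equation.
    set b := δ / 2 with hb
    have hb0 : 0 < b := half_pos hδ
    have hxb : dist (x, b) (p, (0 : ℝ)) < δ := by
      rw [Prod.dist_eq, max_lt_iff, dist_zero_right, Real.norm_of_nonneg hb0.le]
      exact ⟨hq.1.trans (by linarith), by linarith⟩
    set γ := (G (x, b)).2 with hγ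
    let ext : C(ℝ, E) := (N γ).IccExtend (by norm_num : (-1 : ℝ) ≤ 1)
    have hγs : ∀ s : I, γ s = x + b • ∫ τ in (0 : ℝ)..s, ext τ := by
      intro s
      have h1 := (hfix _ (hδs hxb).1.1).2
      rw [← hγ] at h1
      have h2 := DFunLike.congr_fun h1 s
      rw [h2]
      rfl
    have hloc : ∀ t' : ℝ, |t'| < b → ∃ hs : t' / b ∈ I, (G (x, t')).2 one = γ ⟨t' / b, hs⟩ := by
      intro t' ht'
      have hs : t' / b ∈ I := by
        rw [Set.mem_Icc, ← abs_le, abs_div, abs_of_pos hb0]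
        exact (div_le_one hb0).2 ht'.le
      refine ⟨hs, ?_⟩
      rw [← hφs x b hxb ⟨t' / b, hs⟩]
      simp only
      rw [div_mul_cancel₀ _ hb0.ne']
    have hder : HasDerivAt (fun t' : ℝ => x + b • ∫ τ in (0 : ℝ)..(t' / b), ext τ)
        (ext (t / b)) t := by
      have h1 := ext.continuous.integral_hasStrictDerivAt 0 (t / b)
      have h2 := h1.hasDerivAt.scomp t ((hasDerivAt_id t).div_const b)
      have h3 := (h2.const_smul b).const_add x
      refine h3.congr_deriv ?_
      rw [smul_smul, mul_one_div_cancel hb0.ne', one_smul]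
    have hopen : ∀ᶠ t' in 𝓝 t, |t'| < b := continuous_abs.continuousAt.eventually_lt_const hq.2
    obtain ⟨hs, hst⟩ := hloc t hq.2
    have hval : ext (t / b) = v ((G (x, t)).2 one) := by
      rw [hst]
      change N γ (Set.projIcc _ _ _ (t / b)) = _
      rw [Set.projIcc_of_mem _ hs]
      rfl
    change HasDerivAt (fun t' => (G (x, t')).2 one) (v ((G (x, t)).2 one)) t
    rw [← hval]
    refine hder.congr_of_eventuallyEq ?_
    filter_upwards [hopen] with t' ht'
    obtain ⟨hs', hst'⟩ := hloc t' ht'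
    rw [hst', hγs]

/-- A nonvanishing smooth vector field is constant in suitable local coordinates. -/
theorem exists_flowBox [FiniteDimensional ℝ E] {V : E → E} {p w : E}
    (hV : ∀ᶠ x in 𝓝 p, ContDiffAt ℝ ∞ V x) (hp : V p ≠ 0) (hw : w ≠ 0) :
    ∃ e : OpenPartialHomeomorph E E, 0 ∈ e.source ∧ e 0 = p ∧
      (∀ x ∈ e.source, ContDiffAt ℝ ∞ e x) ∧ (∀ y ∈ e.target, ContDiffAt ℝ ∞ e.symm y) ∧
      (∀ x ∈ e.source, ∃ g : E ≃L[ℝ] E, HasFDerivAt e (g : E →L[ℝ] E) x) ∧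
      ∀ᶠ x in 𝓝 0, fderiv ℝ e x w = V (e x) := by
  have : CompleteSpace E := FiniteDimensional.complete ℝ E
  obtain ⟨v, hv, hvV⟩ := exists_contDiff_eventuallyEq hV
  obtain ⟨φ, hφs, hφ0, hφd⟩ := exists_smooth_flow hv p
  obtain ⟨L, hL⟩ := SeparatingDual.exists_continuousLinearEquiv_apply_eq (R := ℝ) hw hp
  obtain ⟨ℓ, hℓ⟩ := SeparatingDual.exists_eq_one (R := ℝ) hw
  -- The component of y along w becomes the time of the flow, and the complement ker ℓ is sent by L
  -- to an affine slice through p. Since L w = V p, the derivative of the resulting map at 0 is L.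
  let A : E → E × ℝ := fun y => (p + L (y - ℓ y • w), ℓ y)
  have hAs : ContDiff ℝ ∞ A := by
    refine (contDiff_const.add (L.contDiff.comp (contDiff_id.sub ?_))).prodMk ℓ.contDiff
    exact ℓ.contDiff.smul contDiff_const
  have hA0 : A 0 = (p, 0) := by simp [A]
  have hAt : Filter.Tendsto A (𝓝 0) (𝓝 (p, 0)) := by
    rw [← hA0]; exact hAs.continuous.tendsto 0
  let Φ : E → E := fun y => φ (A y)
  have hΦs : ∀ᶠ y in 𝓝 0, ContDiffAt ℝ ∞ Φ y := by
    filter_upwards [hAt.eventually hφs] with y hy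
    exact hy.comp y hAs.contDiffAt
  have hΦ0 : Φ 0 = p := by
    change φ (A 0) = p
    rw [hA0]; exact hφ0.self_of_nhds
  have hΦt : Filter.Tendsto Φ (𝓝 0) (𝓝 p) := by
    have := hΦs.self_of_nhds.continuousAt.tendsto
    rwa [hΦ0] at this
  have hw' : ∀ᶠ y in 𝓝 0, fderiv ℝ Φ y w = V (Φ y) := by
    filter_upwards [hAt.eventually hφd, hΦs, hΦt.eventually hvV] with y hy hys hyv
    have h1 : HasDerivAt (fun s : ℝ => Φ (y + s • w)) (fderiv ℝ Φ y w) 0 := by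
      have h2 : HasFDerivAt Φ (fderiv ℝ Φ y) (y + (0 : ℝ) • w) := by
        simpa using (hys.differentiableAt (by simp)).hasFDerivAt
      have h3 : HasDerivAt (fun s : ℝ => y + s • w) w 0 := by
        simpa using ((hasDerivAt_id (0 : ℝ)).smul_const w).const_add y
      exact h2.comp_hasDerivAt 0 h3
    have h4 : (fun s : ℝ => Φ (y + s • w)) = fun s : ℝ => φ ((A y).1, (A y).2 + s) := by
      funext s
      simp only [Φ, A, map_add, map_smul, hℓ, smul_eq_mul, mul_one]
      congr 4
      module
    have h5 : HasDerivAt (fun s : ℝ => φ ((A y).1, (A y).2 + s)) (v (φ (A y))) 0 := by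
      have := hy.scomp_of_eq (0 : ℝ) ((hasDerivAt_id (0 : ℝ)).const_add (A y).2) (by simp)
      simpa [Function.comp_def] using this
    rw [h4] at h1
    rw [h1.unique h5]
    exact hyv
  have hd : HasFDerivAt Φ (L : E →L[ℝ] E) 0 := by
    have h0 := (hΦs.self_of_nhds.differentiableAt (by simp)).hasFDerivAt
    convert h0 using 1
    have h1 : ∀ y, ℓ y = 0 → fderiv ℝ Φ 0 y = L y := by
      intro y hy
      have h2 : HasDerivAt (fun s : ℝ => Φ (s • y)) (fderiv ℝ Φ 0 y) 0 := by
        have h3 : HasDerivAt (fun s : ℝ => s • y) y 0 := by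
          simpa using ((hasDerivAt_id (0 : ℝ)).smul_const y)
        exact HasFDerivAt.comp_hasDerivAt (f := fun s : ℝ => s • y) 0
          (by simpa using h0) h3
      have h4 : HasDerivAt (fun s : ℝ => p + s • L y) (L y) 0 := by
        simpa using ((hasDerivAt_id (0 : ℝ)).smul_const (L y)).const_add p
      have h5 : Filter.Tendsto (fun s : ℝ => p + s • L y) (𝓝 0) (𝓝 p) := by
        simpa using h4.continuousAt.tendsto
      refine h2.unique (h4.congr_of_eventuallyEq ?_)
      filter_upwards [h5.eventually hφ0] with s hs
      simp only [Φ, A, map_smul, hy, smul_zero, zero_smul, sub_zero]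
      exact hs
    ext y
    have h6 : y = (y - ℓ y • w) + ℓ y • w := by abel
    have h7 : fderiv ℝ Φ 0 w = L w := by rw [hw'.self_of_nhds, hΦ0, hL]
    rw [h6, map_add, map_add, map_smul, map_smul, h7, h1 _ (by simp [hℓ])]
    simp
  obtain ⟨e, he0, he, h1, h2, h3⟩ := exists_smooth_local_inverse hΦs L hd
  have heΦ : (e : E → E) = Φ := funext he
  rw [← heΦ] at h1 h2 hw' hΦ0
  exact ⟨e, he0, hΦ0, h1, h3, h2, hw'⟩

end Flow

/-! ### A convolution equation with rapidly decreasing coefficients -/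

section Convolution

open scoped ENNReal

variable {ι : Type*} [NormedAddCommGroup ι]

/-- A family indexed by a normed group is rapidly decreasing if it is summable against all
polynomial weights. -/
def RapidlyDecreasing (a : ι → ℂ) : Prop :=
  ∀ s : ℕ, Summable fun n => (1 + ‖n‖) ^ s * ‖a n‖

theorem RapidlyDecreasing.summable_norm {a : ι → ℂ} (ha : RapidlyDecreasing a) :
    Summable fun n => ‖a n‖ := by simpa using ha 0

theorem RapidlyDecreasing.of_le {a b : ι → ℂ} (ha : RapidlyDecreasing a) (C : ℝ)
    (h : ∀ n, ‖b n‖ ≤ C * ‖a n‖) : RapidlyDecreasing b := by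
  intro s
  refine Summable.of_nonneg_of_le (fun n => by positivity) (fun n => ?_) ((ha s).mul_left C)
  calc (1 + ‖n‖) ^ s * ‖b n‖ ≤ (1 + ‖n‖) ^ s * (C * ‖a n‖) := by gcongr; exact h n
    _ = C * ((1 + ‖n‖) ^ s * ‖a n‖) := by ring

/-- The iterated convolutions `M₀ = |a|`, `Mₖ₊₁ = |a| * (C Mₖ)`. -/
noncomputable def convMajorant (a : ι → ℂ) (C : ℝ≥0∞) : ℕ → ι → ℝ≥0∞
  | 0 => fun n => ‖a n‖ₑ
  | k + 1 => fun n => ∑' m, ‖a (n - m)‖ₑ * (C * convMajorant a C k m)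

/-- For a submultiplicative weight the weighted ℓ¹ norm is submultiplicative under convolution.
Working in `ℝ≥0∞` lets sums be interchanged without any summability hypothesis. -/
theorem tsum_weight_convMajorant_le (a : ι → ℂ) (C : ℝ≥0∞) (w : ι → ℝ≥0∞)
    (hw : ∀ m n, w (m + n) ≤ w m * w n) (k : ℕ) :
    ∑' n, w n * convMajorant a C k n ≤
      (C * ∑' n, w n * ‖a n‖ₑ) ^ k * ∑' n, w n * ‖a n‖ₑ := by
  induction k with
  | zero => simp [convMajorant]
  | succ k ih =>
    set A := ∑' n, w n * ‖a n‖ₑ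
    calc ∑' n, w n * convMajorant a C (k + 1) n
        = ∑' n, ∑' m, w n * (‖a (n - m)‖ₑ * (C * convMajorant a C k m)) := by
          simp only [convMajorant, ENNReal.tsum_mul_left]
      _ ≤ ∑' n, ∑' m, (w (n - m) * ‖a (n - m)‖ₑ) * (C * (w m * convMajorant a C k m)) := by
          refine ENNReal.tsum_le_tsum fun n => ENNReal.tsum_le_tsum fun m => ?_
          calc w n * (‖a (n - m)‖ₑ * (C * convMajorant a C k m))
              ≤ (w (n - m) * w m) * (‖a (n - m)‖ₑ * (C * convMajorant a C k m)) := by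
                gcongr
                simpa using hw (n - m) m
            _ = _ := by ring
      _ = ∑' m, ∑' n, (w (n - m) * ‖a (n - m)‖ₑ) * (C * (w m * convMajorant a C k m)) :=
          ENNReal.tsum_comm
      _ = ∑' m, A * (C * (w m * convMajorant a C k m)) := by
          refine tsum_congr fun m => ?_
          rw [ENNReal.tsum_mul_right]
          congr 1
          exact (Equiv.subRight m).tsum_eq (fun n => w n * ‖a n‖ₑ)
      _ = A * (C * ∑' m, w m * convMajorant a C k m) := by
          rw [ENNReal.tsum_mul_left, ENNReal.tsum_mul_left]
      _ ≤ A * (C * ((C * A) ^ k * A)) := by gcongr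
      _ = (C * A) ^ (k + 1) * A := by ring

theorem tsum_weight_tsum_convMajorant_le (a : ι → ℂ) (C : ℝ≥0∞) (w : ι → ℝ≥0∞)
    (hw : ∀ m n, w (m + n) ≤ w m * w n) :
    ∑' n, w n * ∑' k, convMajorant a C k n ≤
      (1 - C * ∑' n, w n * ‖a n‖ₑ)⁻¹ * ∑' n, w n * ‖a n‖ₑ := by
  calc ∑' n, w n * ∑' k, convMajorant a C k n
      = ∑' k, ∑' n, w n * convMajorant a C k n := by
        simp only [← ENNReal.tsum_mul_left]
        exact ENNReal.tsum_comm
    _ ≤ ∑' k, (C * ∑' n, w n * ‖a n‖ₑ) ^ k * ∑' n, w n * ‖a n‖ₑ :=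
        ENNReal.tsum_le_tsum fun k => tsum_weight_convMajorant_le a C w hw k
    _ = _ := by rw [ENNReal.tsum_mul_right, ENNReal.tsum_geometric]

/-- The terms of the Neumann series of `W = a + a * (T W)`. -/
noncomputable def neumannTerm (a T : ι → ℂ) : ℕ → ι → ℂ
  | 0 => a
  | k + 1 => fun n => ∑' m, a (n - m) * (T m * neumannTerm a T k m)

theorem enorm_neumannTerm_le (a T : ι → ℂ) (C : ℝ≥0∞) (hT : ∀ n, ‖T n‖ₑ ≤ C) (k : ℕ) (n : ι) :
    ‖neumannTerm a T k n‖ₑ ≤ convMajorant a C k n := by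
  induction k generalizing n with
  | zero => exact le_rfl
  | succ k ih =>
    refine enorm_tsum_le_tsum_enorm.trans (ENNReal.tsum_le_tsum fun m => ?_)
    rw [enorm_mul, enorm_mul]
    gcongr
    · exact hT m
    · exact ih m

theorem tsum_ofReal_mul_enorm {ι : Type*} {w : ι → ℝ} (hw : ∀ n, 0 ≤ w n) {a : ι → ℂ}
    (h : Summable fun n => w n * ‖a n‖) :
    ∑' n, ENNReal.ofReal (w n) * ‖a n‖ₑ = ENNReal.ofReal (∑' n, w n * ‖a n‖) := by
  rw [ENNReal.ofReal_tsum_of_nonneg (fun n => mul_nonneg (hw n) (norm_nonneg _)) h]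
  refine tsum_congr fun n => ?_
  rw [ENNReal.ofReal_mul (hw n), ofReal_norm]

theorem one_add_mul_norm_pow_submul (δ : ℝ) (hδ : 0 ≤ δ) (s : ℕ) (m n : ι) :
    (1 + δ * ‖m + n‖) ^ s ≤ (1 + δ * ‖m‖) ^ s * (1 + δ * ‖n‖) ^ s := by
  rw [← mul_pow]
  refine pow_le_pow_left₀ (by positivity) ?_ s
  have h1 := mul_le_mul_of_nonneg_left (norm_add_le m n) hδ
  have h2 : 0 ≤ (δ * ‖m‖) * (δ * ‖n‖) := by positivity
  nlinarith

/-- Dominated convergence as δ → 0. The weights (1 + δ‖n‖)^s define the same summable families for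
every δ > 0, so the unweighted smallness condition suffices for decay of every order: δ is chosen
anew for each s. -/
theorem exists_small_weight {a : ι → ℂ} (ha : RapidlyDecreasing a) (s : ℕ) {B : ℝ}
    (hB : ∑' n, ‖a n‖ < B) :
    ∃ δ : ℝ, 0 < δ ∧ δ ≤ 1 ∧ (Summable fun n => (1 + δ * ‖n‖) ^ s * ‖a n‖) ∧
      ∑' n, (1 + δ * ‖n‖) ^ s * ‖a n‖ < B := by
  have hbd : ∀ δ : ℝ, 0 ≤ δ → δ ≤ 1 → ∀ n : ι,
      (1 + δ * ‖n‖) ^ s * ‖a n‖ ≤ (1 + ‖n‖) ^ s * ‖a n‖ := by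
    intro δ h0 h1 n
    gcongr
    exact mul_le_of_le_one_left (norm_nonneg _) h1
  have h01 : ∀ᶠ δ : ℝ in 𝓝[>] 0, 0 < δ ∧ δ ≤ 1 := by
    filter_upwards [Ioc_mem_nhdsGT (zero_lt_one' ℝ)] with δ hδ using hδ
  have hlim : Filter.Tendsto (fun δ : ℝ => ∑' n, (1 + δ * ‖n‖) ^ s * ‖a n‖) (𝓝[>] 0)
      (𝓝 (∑' n, ‖a n‖)) := by
    refine tendsto_tsum_of_dominated_convergence (ha s) (fun n => ?_) ?_
    · have : Continuous fun δ : ℝ => (1 + δ * ‖n‖) ^ s * ‖a n‖ := by fun_prop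
      have h := this.tendsto 0
      simp only [zero_mul, add_zero, one_pow, one_mul] at h
      exact h.mono_left nhdsWithin_le_nhds
    · filter_upwards [h01] with δ hδ n
      have := hδ.1.le
      rw [Real.norm_of_nonneg (by positivity)]
      exact hbd δ hδ.1.le hδ.2 n
  obtain ⟨δ, hδ, hlt⟩ := (h01.and (hlim.eventually_lt_const hB)).exists
  refine ⟨δ, hδ.1, hδ.2, ?_, hlt⟩
  have := hδ.1.le
  exact Summable.of_nonneg_of_le (fun n => by positivity) (hbd δ hδ.1.le hδ.2) (ha s)

/-- Solution of the convolution equation `W = a + a * (T W)` for a bounded multiplier `T` and small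
rapidly decreasing `a`: the solution is again rapidly decreasing. -/
theorem exists_convolution_solution {a T : ι → ℂ} (ha : RapidlyDecreasing a) {C : ℝ} (hC : 0 ≤ C)
    (hT : ∀ n, ‖T n‖ ≤ C) (hsmall : C * ∑' n, ‖a n‖ < 1 / 2) :
    ∃ W : ι → ℂ, RapidlyDecreasing W ∧ (∀ n, W n = a n + ∑' m, a (n - m) * (T m * W m)) ∧
      C * ∑' n, ‖W n‖ < 1 := by
  set A := ∑' n, ‖a n‖ with hA
  have hA0 : 0 ≤ A := tsum_nonneg fun n => norm_nonneg _
  set C' := ENNReal.ofReal C with hC'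
  have hT' : ∀ n, ‖T n‖ₑ ≤ C' := fun n => by
    rw [← ofReal_norm]; exact ENNReal.ofReal_le_ofReal (hT n)
  let M : ι → ℝ≥0∞ := fun n => ∑' k, convMajorant a C' k n
  have hbound : ∀ (w : ι → ℝ), (∀ n, 0 ≤ w n) → (∀ m n, w (m + n) ≤ w m * w n) →
      (Summable fun n => w n * ‖a n‖) → C * ∑' n, w n * ‖a n‖ < 1 →
      ∑' n, ENNReal.ofReal (w n) * M n ≤
        ENNReal.ofReal ((1 - C * ∑' n, w n * ‖a n‖)⁻¹ * ∑' n, w n * ‖a n‖) := by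
    intro w hw0 hw hs hlt
    have h := tsum_weight_tsum_convMajorant_le a C' (fun n => ENNReal.ofReal (w n)) (fun m n => by
      rw [← ENNReal.ofReal_mul (hw0 m)]; exact ENNReal.ofReal_le_ofReal (hw m n))
    rw [tsum_ofReal_mul_enorm hw0 hs] at h
    refine h.trans_eq ?_
    have hpos : 0 < 1 - C * ∑' n, w n * ‖a n‖ := by linarith
    have hS : 0 ≤ ∑' n, w n * ‖a n‖ := tsum_nonneg fun n => mul_nonneg (hw0 n) (norm_nonneg _)
    rw [ENNReal.ofReal_mul (inv_nonneg.2 hpos.le), ENNReal.ofReal_inv_of_pos hpos,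
      ENNReal.ofReal_sub _ (mul_nonneg hC hS), ENNReal.ofReal_one, ENNReal.ofReal_mul hC]
  have hM1 : ∑' n, M n ≤ ENNReal.ofReal ((1 - C * A)⁻¹ * A) := by
    simpa using hbound (fun _ => 1) (fun _ => zero_le_one) (fun _ _ => by simp)
      (by simpa using ha.summable_norm) (by simpa using by linarith)
  have hMtop : ∀ n, M n ≠ ⊤ := fun n =>
    ne_top_of_le_ne_top ENNReal.ofReal_ne_top ((ENNReal.le_tsum n).trans hM1)
  have hsumk : ∀ n, Summable fun k => neumannTerm a T k n := by
    intro n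
    refine Summable.of_enorm ?_
    exact ne_top_of_le_ne_top (hMtop n)
      (ENNReal.tsum_le_tsum fun k => enorm_neumannTerm_le a T C' hT' k n)
  let W : ι → ℂ := fun n => ∑' k, neumannTerm a T k n
  have hWM : ∀ n, ‖W n‖ₑ ≤ M n := fun n => enorm_tsum_le_tsum_enorm.trans
    (ENNReal.tsum_le_tsum fun k => enorm_neumannTerm_le a T C' hT' k n)
  have hweight : ∀ (w : ι → ℝ), (∀ n, 0 ≤ w n) → (∀ m n, w (m + n) ≤ w m * w n) →
      (Summable fun n => w n * ‖a n‖) → C * ∑' n, w n * ‖a n‖ < 1 →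
      (Summable fun n => w n * ‖W n‖) ∧ ∑' n, w n * ‖W n‖ ≤
        (1 - C * ∑' n, w n * ‖a n‖)⁻¹ * ∑' n, w n * ‖a n‖ := by
    intro w hw0 hw hs hlt
    have h1 := hbound w hw0 hw hs hlt
    have h2 : ∑' n, ENNReal.ofReal (w n) * ‖W n‖ₑ ≤ _ :=
      (ENNReal.tsum_le_tsum fun n => mul_le_mul_right (hWM n) _).trans h1
    have h3 : Summable fun n => w n * ‖W n‖ := by
      have h4 : Summable fun n => ((w n : ℂ) * W n) := by
        refine Summable.of_enorm (ne_top_of_le_ne_top ENNReal.ofReal_ne_top (le_trans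
          (ENNReal.tsum_le_tsum fun n => ?_) h2))
        rw [enorm_mul, ← ofReal_norm (w n : ℂ), Complex.norm_real, Real.norm_of_nonneg (hw0 n)]
      refine h4.norm.congr fun n => ?_
      rw [norm_mul, Complex.norm_real, Real.norm_of_nonneg (hw0 n)]
    refine ⟨h3, ?_⟩
    rw [tsum_ofReal_mul_enorm hw0 h3] at h2
    refine (ENNReal.ofReal_le_ofReal_iff (mul_nonneg (inv_nonneg.2 (by linarith))
      (tsum_nonneg fun n => mul_nonneg (hw0 n) (norm_nonneg _)))).1 h2
  refine ⟨W, ?_, ?_, ?_⟩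
  · intro s
    -- For C = 0 the multiplier vanishes and W = a; otherwise the smallness bound may be divided by
    -- C.
    rcases hC.eq_or_lt with hC0 | hCpos
    · have hT0 : ∀ n, T n = 0 := fun n => norm_le_zero_iff.1 (hC0 ▸ hT n)
      have hW : W = a := by
        funext n
        refine (tsum_eq_single 0 fun k hk => ?_)
        obtain ⟨k, rfl⟩ := Nat.exists_eq_succ_of_ne_zero hk
        simp [neumannTerm, hT0]
      rw [hW]; exact ha s
    · have hlt : A < 1 / C := by rw [lt_div_iff₀ hCpos]; linarith
      obtain ⟨δ, hδ0, hδ1, hδs, hδlt⟩ := exists_small_weight ha s hlt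
      have h1 := (hweight (fun n => (1 + δ * ‖n‖) ^ s) (fun n => by positivity)
        (one_add_mul_norm_pow_submul δ hδ0.le s) hδs
        (by rwa [lt_div_iff₀ hCpos, mul_comm] at hδlt)).1
      refine Summable.of_nonneg_of_le (fun n => by positivity) (fun n => ?_)
        (h1.mul_left ((δ ^ s)⁻¹))
      rw [← mul_assoc, ← inv_pow, ← mul_pow]
      gcongr
      rw [mul_add, inv_mul_cancel_left₀ hδ0.ne', mul_one]
      gcongr
      exact (one_le_inv₀ hδ0).2 hδ1
  · intro n
    have h1 : W n = a n + ∑' k, neumannTerm a T (k + 1) n := (hsumk n).tsum_eq_zero_add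
    rw [h1]
    congr 1
    -- Absolute summability over (k, m), from the majorants, permits summing the Neumann recursion
    -- term by term.
    have h2 : Summable (Function.uncurry fun (k : ℕ) (m : ι) =>
        a (n - m) * (T m * neumannTerm a T k m)) := by
      refine Summable.of_enorm ?_
      rw [ENNReal.tsum_prod']
      refine ne_top_of_le_ne_top (hMtop n) (le_trans (b := ∑' k, convMajorant a C' (k + 1) n) ?_ ?_)
      · refine ENNReal.tsum_le_tsum fun k => ENNReal.tsum_le_tsum fun m => ?_
        rw [Function.uncurry_apply_pair, enorm_mul, enorm_mul]
        gcongr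
        · exact hT' m
        · exact enorm_neumannTerm_le a T C' hT' k m
      · exact ENNReal.tsum_comp_le_tsum_of_injective (add_left_injective 1)
          (fun k => convMajorant a C' k n)
    calc ∑' k, neumannTerm a T (k + 1) n
        = ∑' k, ∑' m, a (n - m) * (T m * neumannTerm a T k m) := rfl
      _ = ∑' m, ∑' k, a (n - m) * (T m * neumannTerm a T k m) := h2.tsum_comm.symm
      _ = ∑' m, a (n - m) * (T m * W m) := by
          refine tsum_congr fun m => ?_
          rw [tsum_mul_left, tsum_mul_left]
  · have h1 := (hweight (fun _ => 1) (fun _ => zero_le_one) (fun _ _ => by simp)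
      (by simpa using ha.summable_norm) (by simpa using by linarith)).2
    simp only [one_mul] at h1
    -- With t = CA, the bound t/(1 - t) is less than 1 exactly when t < 1/2, whence the constant in
    -- the smallness hypothesis.
    calc C * ∑' n, ‖W n‖ ≤ C * ((1 - C * A)⁻¹ * A) := by gcongr
      _ = (C * A) / (1 - C * A) := by rw [div_eq_inv_mul]; ring
      _ < 1 := by rw [div_lt_one (by linarith)]; linarith

end Convolution

/-! ### Fourier series of smooth functions supported in the unit square -/

section Fourier

open scoped FourierTransform SchwartzMap
open MeasureTheory

/-- The Euclidean plane. -/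
abbrev E2 : Type := EuclideanSpace ℝ (Fin 2)

/-- The lattice point of the plane with integral coordinates `n`. -/
noncomputable def latticePoint (n : Fin 2 → ℤ) : E2 := WithLp.toLp 2 fun i => (n i : ℝ)

/-- The phase `2π ⟨n, x⟩` as a linear functional. -/
noncomputable def phase (n : Fin 2 → ℤ) : E2 →L[ℝ] ℝ :=
  (2 * Real.pi * n 0) • EuclideanSpace.proj 0 + (2 * Real.pi * n 1) • EuclideanSpace.proj 1

theorem phase_apply (n : Fin 2 → ℤ) (x : E2) :
    phase n x = 2 * Real.pi * n 0 * x 0 + 2 * Real.pi * n 1 * x 1 := by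
  simp [phase]

/-- The exponential monomial `exp (2πi ⟨n, x⟩)` on the plane. -/
noncomputable def expMonomial (n : Fin 2 → ℤ) (x : E2) : ℂ :=
  Complex.exp (Complex.I * (phase n x : ℝ))

theorem expMonomial_add (m n : Fin 2 → ℤ) (x : E2) :
    expMonomial (m + n) x = expMonomial m x * expMonomial n x := by
  rw [expMonomial, expMonomial, expMonomial, ← Complex.exp_add, phase_apply, phase_apply,
    phase_apply]
  congr 1
  push_cast [Pi.add_apply]
  ring

theorem norm_expMonomial (n : Fin 2 → ℤ) (x : E2) : ‖expMonomial n x‖ = 1 := by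
  rw [expMonomial, mul_comm]; exact Complex.norm_exp_ofReal_mul_I _

theorem mFourier_coe (n : Fin 2 → ℤ) (x : Fin 2 → ℝ) :
    UnitAddTorus.mFourier n (fun i => (x i : UnitAddCircle)) =
      expMonomial n (WithLp.toLp 2 x) := by
  rw [UnitAddTorus.mFourier, ContinuousMap.coe_mk, Fin.prod_univ_two, fourier_coe_apply,
    fourier_coe_apply, ← Complex.exp_add, expMonomial, phase_apply]
  congr 1
  push_cast
  ring

/-- The periodic extension of a function supported in `|xᵢ| ≤ 1/4`. -/
noncomputable def torusLift (f : E2 → ℂ) (t : UnitAddTorus (Fin 2)) : ℂ :=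
  f (WithLp.toLp 2 fun i => (AddCircle.equivIoc 1 (-1 / 2 : ℝ) (t i) : ℝ))

theorem torusLift_coe (f : E2 → ℂ) {x : Fin 2 → ℝ}
    (hx : ∀ i, x i ∈ Set.Ioc (-1 / 2 : ℝ) (-1 / 2 + 1)) :
    torusLift f (fun i => (x i : UnitAddCircle)) = f (WithLp.toLp 2 x) := by
  unfold torusLift
  congr 2
  funext i
  exact AddCircle.equivIoc_coe_of_mem (hx i)

/-- The choice of representative is discontinuous only on the seam where a coordinate is -1/2, and
there the lift is locally zero, because the support stays within |xᵢ| ≤ 1/4. -/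
theorem continuous_torusLift {f : E2 → ℂ} (hf : Continuous f)
    (hsupp : ∀ x, f x ≠ 0 → ∀ i, |x i| ≤ 1 / 4) : Continuous (torusLift f) := by
  rw [continuous_iff_continuousAt]
  intro t
  by_cases ht : ∀ i, t i ≠ ((-1 / 2 : ℝ) : UnitAddCircle)
  · have h1 : ContinuousAt (fun t : UnitAddTorus (Fin 2) =>
        (fun i => (AddCircle.equivIoc 1 (-1 / 2 : ℝ) (t i) : ℝ))) t := by
      refine continuousAt_pi.2 fun i => ?_
      exact continuous_subtype_val.continuousAt.comp (ContinuousAt.comp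
        (f := fun t : UnitAddTorus (Fin 2) => t i)
        (AddCircle.continuousAt_equivIoc 1 _ (ht i)) (continuous_apply i).continuousAt)
    exact (hf.comp (PiLp.continuous_toLp 2 _)).continuousAt.comp h1
  · push Not at ht
    obtain ⟨i, hi⟩ := ht
    let K : Set UnitAddCircle := (fun x : ℝ => (x : UnitAddCircle)) '' Set.Icc (-1 / 4) (1 / 4)
    have hK : IsClosed K := (isCompact_Icc.image (AddCircle.continuous_mk' 1)).isClosed
    have hiK : t i ∉ K := by
      rintro ⟨x, hx, hxt⟩
      have h1 : AddCircle.equivIoc 1 (-1 / 2 : ℝ) (t i) = x := by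
        rw [← hxt]
        exact AddCircle.equivIoc_coe_of_mem ⟨by linarith [hx.1], by linarith [hx.2]⟩
      have h2 : (AddCircle.equivIoc 1 (-1 / 2 : ℝ) (t i) : ℝ) = 1 / 2 := by
        have h3 : t i = ((1 / 2 : ℝ) : UnitAddCircle) := by
          rw [hi, ← AddCircle.coe_add_period 1 (-1 / 2 : ℝ)]
          norm_num
        rw [h3]
        exact AddCircle.equivIoc_coe_of_mem ⟨by norm_num, by norm_num⟩
      rw [h1] at h2
      linarith [hx.2]
    have hev : ∀ᶠ s : UnitAddTorus (Fin 2) in 𝓝 t, s i ∉ K :=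
      (continuous_apply i).continuousAt.eventually (hK.isOpen_compl.mem_nhds hiK)
    refine (continuousAt_const (y := (0 : ℂ))).congr ?_
    filter_upwards [hev] with s hs
    by_contra hne
    have h1 := hsupp _ (Ne.symm hne) i
    apply hs
    refine ⟨_, ?_, AddCircle.coe_equivIoc (a := (-1 / 2 : ℝ))⟩
    have h2 := abs_le.1 h1
    exact ⟨by linarith [h2.1], h2.2⟩

/-- The support lies inside one fundamental cell, so the integral over the torus is the integral
over the whole plane. Decay of Fourier coefficients can thus be read off from the Schwartz space. -/
theorem mFourierCoeff_torusLift {f : E2 → ℂ} (hsupp : ∀ x, f x ≠ 0 → ∀ i, |x i| ≤ 1 / 4)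
    (n : Fin 2 → ℤ) :
    UnitAddTorus.mFourierCoeff (torusLift f) n = 𝓕 f (latticePoint n) := by
  rw [UnitAddTorus.mFourierCoeff_eq_integral _ _ (fun _ => -1 / 2), Real.fourier_eq']
  have h1 : ∀ x ∈ {x : Fin 2 → ℝ | ∀ i, x i ∈ Set.Ioc (-1 / 2 : ℝ) (-1 / 2 + 1)},
      UnitAddTorus.mFourier (-n) (fun i => (x i : UnitAddCircle)) •
        torusLift f (fun i => (x i : UnitAddCircle)) =
      expMonomial (-n) (WithLp.toLp 2 x) * f (WithLp.toLp 2 x) := by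
    intro x hx
    rw [torusLift_coe f hx, mFourier_coe, smul_eq_mul]
  have hm : MeasurableSet {x : Fin 2 → ℝ | ∀ i, x i ∈ Set.Ioc (-1 / 2 : ℝ) (-1 / 2 + 1)} :=
    MeasurableSet.univ_pi' fun i => measurableSet_Ioc
  rw [setIntegral_congr_fun hm h1, setIntegral_eq_integral_of_forall_compl_eq_zero]
  · rw [← (EuclideanSpace.volume_preserving_symm_measurableEquiv_toLp (Fin 2)).symm.integral_comp
      (MeasurableEquiv.toLp 2 (Fin 2 → ℝ)).measurableEmbedding]
    refine integral_congr_ae (Filter.Eventually.of_forall fun x => ?_)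
    change expMonomial (-n) (WithLp.toLp 2 x) * f (WithLp.toLp 2 x) =
      Complex.exp _ • f (WithLp.toLp 2 x)
    rw [smul_eq_mul, expMonomial, phase_apply]
    congr 2
    change _ = ((-2 * Real.pi * inner ℝ (WithLp.toLp 2 x) (latticePoint n) : ℝ) : ℂ) * Complex.I
    simp only [latticePoint, PiLp.inner_apply, Fin.sum_univ_two, RCLike.inner_apply, conj_trivial,
      Pi.neg_apply]
    push_cast
    ring
  · intro x hx
    by_contra hne
    have h2 := hsupp _ (right_ne_zero_of_mul hne)
    apply hx
    intro i
    have h3 := abs_le.1 (h2 i)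
    exact ⟨by linarith [h3.1], by linarith [h3.2]⟩

/-- Pointwise Fourier inversion for functions supported in `|xᵢ| ≤ 1/4`. -/
theorem hasSum_fourier_expMonomial {f : E2 → ℂ} (hf : Continuous f)
    (hsupp : ∀ x, f x ≠ 0 → ∀ i, |x i| ≤ 1 / 4)
    (hs : Summable fun n : Fin 2 → ℤ => 𝓕 f (latticePoint n)) {x : E2}
    (hx : ∀ i, |x i| ≤ 1 / 4) :
    HasSum (fun n => 𝓕 f (latticePoint n) * expMonomial n x) (f x) := by
  have h1 : UnitAddTorus.mFourierCoeff (torusLift f) = fun n => 𝓕 f (latticePoint n) :=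
    funext (mFourierCoeff_torusLift hsupp)
  have h2 := UnitAddTorus.hasSum_mFourier_series_apply_of_summable
    (f := (⟨torusLift f, continuous_torusLift hf hsupp⟩ : C(UnitAddTorus (Fin 2), ℂ)))
    (by rw [ContinuousMap.coe_mk, h1]; exact hs) (fun i => ((x i : ℝ) : UnitAddCircle))
  rw [ContinuousMap.coe_mk, h1, torusLift_coe f (x := x) (fun i => by
    have h3 := abs_le.1 (hx i)
    exact ⟨by linarith [h3.1], by linarith [h3.2]⟩)] at h2
  simpa only [mFourier_coe, smul_eq_mul] using h2

theorem norm_le_norm_latticePoint (n : Fin 2 → ℤ) : ‖n‖ ≤ ‖latticePoint n‖ := by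
  refine (pi_norm_le_iff_of_nonneg (norm_nonneg _)).2 fun i => ?_
  have := PiLp.norm_apply_le (latticePoint n) i
  rwa [latticePoint, Real.norm_eq_abs, ← Int.norm_eq_abs] at this

/-- The exponent 3 exceeds the rank 2 of the lattice. The comparison series fails to dominate only
at n = 0, which a cofinite statement ignores. -/
theorem summable_one_add_norm_pow_inv :
    Summable fun n : Fin 2 → ℤ => ((1 + ‖n‖) ^ 3)⁻¹ := by
  have h := EisensteinSeries.summable_one_div_norm_rpow (k := 3) (by norm_num)
  refine Summable.of_norm_bounded_eventually h ?_
  have h0 : ∀ᶠ n : Fin 2 → ℤ in Filter.cofinite, n ≠ 0 := by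
    simp [Filter.eventually_cofinite]
  filter_upwards [h0] with n hn
  have hn' : 0 < ‖n‖ := norm_pos_iff.2 hn
  rw [Real.norm_of_nonneg (by positivity), Real.rpow_neg hn'.le]
  norm_cast
  gcongr
  linarith

theorem one_add_norm_pow_mul_fourier_le (f : 𝓢(E2, ℂ)) (k : ℕ) (n : Fin 2 → ℤ) :
    (1 + ‖n‖) ^ k * ‖𝓕 (f : E2 → ℂ) (latticePoint n)‖ ≤
      2 ^ k * (Finset.Iic (k, 0)).sup (fun m => SchwartzMap.seminorm ℝ m.1 m.2) (𝓕 f) := by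
  have h := SchwartzMap.one_add_le_sup_seminorm_apply (𝕜 := ℝ) (m := (k, 0)) (k := k) (n := 0)
    le_rfl le_rfl (𝓕 f) (latticePoint n)
  rw [norm_iteratedFDeriv_zero] at h
  refine le_trans ?_ h
  rw [SchwartzMap.fourier_coe]
  gcongr
  exact norm_le_norm_latticePoint n

theorem rapidlyDecreasing_fourier (f : 𝓢(E2, ℂ)) :
    RapidlyDecreasing fun n : Fin 2 → ℤ => 𝓕 (f : E2 → ℂ) (latticePoint n) := by
  intro s
  refine Summable.of_nonneg_of_le (fun n => by positivity) (fun n => ?_)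
    (summable_one_add_norm_pow_inv.mul_left (2 ^ (s + 3) *
      (Finset.Iic (s + 3, 0)).sup (fun m => SchwartzMap.seminorm ℝ m.1 m.2) (𝓕 f)))
  have h := one_add_norm_pow_mul_fourier_le f (s + 3) n
  rw [← div_eq_mul_inv, le_div_iff₀ (by positivity)]
  refine le_trans (le_of_eq ?_) h
  ring

/-- The `ℓ¹` norm of the Fourier coefficients tends to zero along families of Schwartz functions
tending to zero. -/
theorem tendsto_tsum_norm_fourier {u : ℝ → 𝓢(E2, ℂ)} {l : Filter ℝ}
    (hu : Filter.Tendsto u l (𝓝 0)) :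
    Filter.Tendsto (fun s => ∑' n, ‖𝓕 (u s : E2 → ℂ) (latticePoint n)‖) l (𝓝 0) := by
  have h1 : Filter.Tendsto (fun s => 𝓕 (u s)) l (𝓝 0) := by
    have := ((SchwartzMap.fourierTransformCLM ℝ (V := E2) (E := ℂ)).continuous.tendsto 0).comp hu
    rw [map_zero] at this
    exact this
  let p := (Finset.Iic (3, 0)).sup (schwartzSeminormFamily ℝ E2 ℂ)
  have h2 : Filter.Tendsto (fun s => p (𝓕 (u s))) l (𝓝 0) := by
    rw [Metric.tendsto_nhds]
    intro ε hε
    filter_upwards [((schwartz_withSeminorms ℝ E2 ℂ).tendsto_nhds' _ 0).1 h1 _ ε hε] with s hs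
    rw [dist_zero_right, Real.norm_of_nonneg (apply_nonneg _ _)]
    simpa using hs
  have h3 : Filter.Tendsto (fun s => 2 ^ 3 * p (𝓕 (u s)) *
      ∑' n : Fin 2 → ℤ, ((1 + ‖n‖) ^ 3)⁻¹) l (𝓝 0) := by
    simpa using (h2.const_mul (2 ^ 3)).mul_const (∑' n : Fin 2 → ℤ, ((1 + ‖n‖) ^ 3)⁻¹)
  refine squeeze_zero (fun s => tsum_nonneg fun n => norm_nonneg _) (fun s => ?_) h3
  rw [← tsum_mul_left]
  refine (rapidlyDecreasing_fourier (u s)).summable_norm.tsum_le_tsum (fun n => ?_)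
    (summable_one_add_norm_pow_inv.mul_left _)
  rw [← div_eq_mul_inv, le_div_iff₀ (by positivity), mul_comm]
  exact one_add_norm_pow_mul_fourier_le (u s) 3 n

/-- A compactly supported smooth family of functions vanishing at parameter zero tends to zero in
the Schwartz space. -/
theorem tendsto_toSchwartzMap_zero {G : ℝ × E2 → ℂ} (hG : ContDiff ℝ ∞ G) {K : Set E2}
    (hK : IsCompact K) (hsupp : ∀ s, tsupport (fun x => G (s, x)) ⊆ K) (h0 : ∀ x, G (0, x) = 0)
    {u : ℝ → 𝓢(E2, ℂ)} (hu : ∀ s x, u s x = G (s, x)) :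
    Filter.Tendsto u (𝓝 0) (𝓝 0) := by
  rw [(schwartz_withSeminorms ℝ E2 ℂ).tendsto_nhds]
  rintro ⟨k, l⟩ ε hε
  simp only [sub_zero]
  have hcomp : ∀ s, (u s : E2 → ℂ) =
      (fun q : ℝ × E2 => G ((s, 0) + q)) ∘ (ContinuousLinearMap.inr ℝ ℝ E2) := by
    intro s
    funext x
    simp [hu]
  -- Restricting the full derivative of G to the second factor expresses the derivatives in x as a
  -- function jointly continuous in (s, x). It vanishes at s = 0, so compactness of K gives uniform
  -- smallness for s near 0.
  let H : ℝ × E2 → ContinuousMultilinearMap ℝ (fun _ : Fin l => E2) ℂ := fun q =>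
    (iteratedFDeriv ℝ l G q).compContinuousLinearMap fun _ => ContinuousLinearMap.inr ℝ ℝ E2
  have hH : ∀ s x, iteratedFDeriv ℝ l (u s) x = H (s, x) := by
    intro s x
    rw [hcomp s, (ContinuousLinearMap.inr ℝ ℝ E2).iteratedFDeriv_comp_right
      (n := (∞ : WithTop ℕ∞)) (by fun_prop) x (by exact_mod_cast le_top),
      iteratedFDeriv_comp_add_left]
    simp [H]
  have hHc : Continuous H := by
    have h1 : Continuous (iteratedFDeriv ℝ l G) :=
      hG.continuous_iteratedFDeriv (by exact_mod_cast le_top)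
    exact (ContinuousMultilinearMap.compContinuousLinearMapL (𝕜 := ℝ)
      (fun _ : Fin l => ContinuousLinearMap.inr ℝ ℝ E2)).continuous.comp h1
  have hH0 : ∀ x, H (0, x) = 0 := by
    intro x
    have hz : (u 0 : E2 → ℂ) = fun _ => 0 := funext fun x => by rw [hu, h0]
    rw [← hH, hz]
    simp
  let N : ℝ × E2 → ℝ := fun q => ‖q.2‖ ^ k * ‖H q‖
  have hN : Continuous N := by fun_prop
  have hev : ∀ᶠ s in 𝓝 (0 : ℝ), ∀ x ∈ K, N (s, x) < ε / 2 := by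
    refine hK.eventually_forall_of_forall_eventually fun x hx => ?_
    refine hN.continuousAt.eventually_lt_const ?_
    simp only [N, hH0, norm_zero, mul_zero]
    positivity
  filter_upwards [hev] with s hs
  refine lt_of_le_of_lt (SchwartzMap.seminorm_le_bound ℝ k l (u s) (half_pos hε).le fun x => ?_)
    (half_lt_self hε)
  by_cases hx : x ∈ K
  · rw [hH]; exact (hs x hx).le
  · have h1 : x ∉ tsupport (u s) := fun h => hx (hsupp s (by
      rwa [show (u s : E2 → ℂ) = fun x => G (s, x) from funext (hu s)] at h))
    have h2 : iteratedFDeriv ℝ l (u s) x = 0 := by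
      by_contra hne
      exact h1 (support_iteratedFDeriv_subset l hne)
    rw [h2]
    simp only [norm_zero, mul_zero]
    positivity

/-- Rescaling a smooth function vanishing at the origin: near the origin it is given by a Fourier
series with small rapidly decreasing coefficients. -/
theorem exists_small_fourier_series {ρ : E2 → ℂ} (hρ : ContDiff ℝ ∞ ρ) (h0 : ρ 0 = 0) {ε : ℝ}
    (hε : 0 < ε) :
    ∃ (s : ℝ) (a : (Fin 2 → ℤ) → ℂ), 0 < s ∧ RapidlyDecreasing a ∧ ∑' n, ‖a n‖ < ε ∧
      ∀ᶠ x in 𝓝 (0 : E2), HasSum (fun n => a n * expMonomial n x) (ρ (s • x)) := by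
  let χ : ContDiffBump (0 : E2) := ⟨1 / 8, 1 / 4, by norm_num, by norm_num⟩
  -- Zooming in by s makes ρ(s x) tend to ρ(0) = 0 with all derivatives, while the cutoff keeps the
  -- support in a fixed ball inside the unit cell.
  let G : ℝ × E2 → ℂ := fun q => χ q.2 • ρ (q.1 • q.2)
  have hG : ContDiff ℝ ∞ G := by
    have h1 : ContDiff ℝ ∞ (fun q : ℝ × E2 => χ q.2) := χ.contDiff.comp contDiff_snd
    exact h1.smul (hρ.comp (contDiff_fst.smul contDiff_snd))
  have hsub : ∀ s, tsupport (fun x => G (s, x)) ⊆ Metric.closedBall 0 (1 / 4) := by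
    intro s
    rw [← χ.tsupport_eq]
    exact closure_mono (Function.support_smul_subset_left χ (fun x => ρ (s • x)))
  have hsupp : ∀ s x, G (s, x) ≠ 0 → ∀ i, |x i| ≤ 1 / 4 := by
    intro s x hx i
    have h1 := hsub s (subset_tsupport _ hx)
    rw [mem_closedBall_zero_iff] at h1
    exact (PiLp.norm_apply_le x i).trans h1
  have hcs : ∀ s, HasCompactSupport fun x => G (s, x) := fun s =>
    HasCompactSupport.of_support_subset_isCompact (isCompact_closedBall 0 (1 / 4))
      ((subset_tsupport _).trans (hsub s))
  have hGs : ∀ s, ContDiff ℝ ∞ fun x => G (s, x) := fun s =>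
    hG.comp (contDiff_const.prodMk contDiff_id)
  let u : ℝ → 𝓢(E2, ℂ) := fun s => (hcs s).toSchwartzMap (hGs s)
  have hu := tendsto_toSchwartzMap_zero hG (isCompact_closedBall 0 (1 / 4)) hsub
    (fun x => by simp [G, h0]) (u := u) (fun s x => rfl)
  have hpos : ∀ᶠ s in 𝓝[>] (0 : ℝ), 0 < s := self_mem_nhdsWithin
  obtain ⟨s, hs0, hs⟩ := (hpos.and (((tendsto_tsum_norm_fourier hu).mono_left
    (nhdsWithin_le_nhds (s := Set.Ioi (0 : ℝ)))).eventually_lt_const hε)).exists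
  refine ⟨s, fun n => 𝓕 (u s : E2 → ℂ) (latticePoint n), hs0, rapidlyDecreasing_fourier _, hs, ?_⟩
  filter_upwards [χ.eventuallyEq_one, Metric.closedBall_mem_nhds (0 : E2)
    (by norm_num : (0 : ℝ) < 1 / 4)] with x hx hxb
  have h1 := hasSum_fourier_expMonomial (f := u s) (u s).continuous (hsupp s)
    (rapidlyDecreasing_fourier (u s)).summable_norm.of_norm (x := x) (fun i =>
      (PiLp.norm_apply_le x i).trans (mem_closedBall_zero_iff.1 hxb))
  have h2 : u s x = ρ (s • x) := by
    change χ x • ρ (s • x) = _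
    rw [hx]; simp
  rwa [h2] at h1

end Fourier

/-! ### Isothermal coordinates: the Beltrami equation in the plane -/

section Beltrami

theorem norm_phase_le (n : Fin 2 → ℤ) : ‖phase n‖ ≤ 4 * Real.pi * ‖n‖ := by
  have hpi := Real.pi_pos
  refine ContinuousLinearMap.opNorm_le_bound _ (by positivity) fun x => ?_
  rw [phase_apply, Real.norm_eq_abs]
  have hn : ∀ i, |(n i : ℝ)| ≤ ‖n‖ := fun i => by
    have := norm_le_pi_norm n i
    rwa [Int.norm_eq_abs] at this
  have hx : ∀ i, |x i| ≤ ‖x‖ := fun i => PiLp.norm_apply_le x i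
  have h : ∀ i, |2 * Real.pi * n i * x i| ≤ 2 * Real.pi * ‖n‖ * ‖x‖ := fun i => by
    rw [abs_mul, abs_mul, abs_of_pos (by positivity : 0 < 2 * Real.pi)]
    gcongr
    · exact hn i
    · exact hx i
  calc _ ≤ _ := abs_add_le _ _
    _ ≤ _ := add_le_add (h 0) (h 1)
    _ = _ := by ring

theorem iteratedDeriv_cexp_I_mul (k : ℕ) :
    iteratedDeriv k (fun t : ℝ => Complex.exp (Complex.I * t)) =
      fun t : ℝ => Complex.I ^ k * Complex.exp (Complex.I * t) := by
  induction k with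
  | zero => simp
  | succ k ih =>
    rw [iteratedDeriv_succ, ih]
    funext t
    have h1 : HasDerivAt (fun t : ℝ => Complex.I * (t : ℂ)) Complex.I t := by
      simpa using (Complex.ofRealCLM.hasDerivAt (x := t)).const_mul Complex.I
    rw [(h1.cexp.const_mul (Complex.I ^ k)).deriv]
    ring

theorem norm_iteratedFDeriv_expMonomial_le (n : Fin 2 → ℤ) (k : ℕ) (x : E2) :
    ‖iteratedFDeriv ℝ k (expMonomial n) x‖ ≤ (4 * Real.pi * ‖n‖) ^ k := by
  have hg : ContDiff ℝ ∞ (fun t : ℝ => Complex.exp (Complex.I * t)) :=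
    (contDiff_const.mul Complex.ofRealCLM.contDiff).cexp
  have h1 : expMonomial n = (fun t : ℝ => Complex.exp (Complex.I * t)) ∘ phase n := rfl
  rw [h1, (phase n).iteratedFDeriv_comp_right hg x (by exact_mod_cast le_top)]
  refine (ContinuousMultilinearMap.norm_compContinuousLinearMap_le _ _).trans ?_
  rw [norm_iteratedFDeriv_eq_norm_iteratedDeriv, iteratedDeriv_cexp_I_mul, norm_mul, norm_pow,
    Complex.norm_I, one_pow, one_mul, mul_comm Complex.I, Complex.norm_exp_ofReal_mul_I, one_mul,
    Finset.prod_const, Finset.card_univ, Fintype.card_fin]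
  gcongr
  exact norm_phase_le n

theorem hasFDerivAt_expMonomial (n : Fin 2 → ℤ) (x : E2) :
    HasFDerivAt (expMonomial n) ((Complex.I * expMonomial n x) •
      (Complex.ofRealCLM.comp (phase n))) x := by
  have h1 : HasFDerivAt (fun x : E2 => Complex.I * ((phase n x : ℝ) : ℂ))
      (Complex.I • (Complex.ofRealCLM.comp (phase n))) x :=
    (Complex.ofRealCLM.comp (phase n)).hasFDerivAt.const_mul Complex.I
  refine h1.cexp.congr_fderiv ?_
  rw [smul_smul, mul_comm]
  rfl

theorem contDiff_expMonomial (n : Fin 2 → ℤ) : ContDiff ℝ ∞ (expMonomial n) :=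
  (contDiff_const.mul (Complex.ofRealCLM.contDiff.comp (phase n).contDiff)).cexp

/-- A derivative of order k costs a factor (4π‖n‖)^k, which the polynomial weights absorb. -/
theorem RapidlyDecreasing.contDiff_tsum {b : (Fin 2 → ℤ) → ℂ} (hb : RapidlyDecreasing b) :
    ContDiff ℝ ∞ fun x => ∑' n, b n * expMonomial n x := by
  refine _root_.contDiff_tsum (N := ⊤)
    (v := fun k n => (4 * Real.pi) ^ k * ((1 + ‖n‖) ^ k * ‖b n‖))
    (fun n => contDiff_const.mul (contDiff_expMonomial n)) (fun k _ => (hb k).mul_left _)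
    fun k n x _ => ?_
  have h1 : iteratedFDeriv ℝ k (fun x => b n * expMonomial n x) x =
      b n • iteratedFDeriv ℝ k (expMonomial n) x :=
    iteratedFDeriv_const_smul_apply (a := b n) (i := k) (x := x) (f := expMonomial n)
      ((contDiff_expMonomial n).of_le (by exact_mod_cast le_top)).contDiffAt
  rw [h1, norm_smul, mul_comm]
  have hpi := Real.pi_pos
  calc _ ≤ (4 * Real.pi * ‖n‖) ^ k * ‖b n‖ := by
        gcongr; exact norm_iteratedFDeriv_expMonomial_le n k x
    _ ≤ (4 * Real.pi * (1 + ‖n‖)) ^ k * ‖b n‖ := by gcongr; linarith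
    _ = _ := by rw [mul_pow]; ring

theorem RapidlyDecreasing.hasFDerivAt_tsum {b : (Fin 2 → ℤ) → ℂ} (hb : RapidlyDecreasing b)
    (x : E2) : HasFDerivAt (fun x => ∑' n, b n * expMonomial n x)
      (∑' n, b n • ((Complex.I * expMonomial n x) • (Complex.ofRealCLM.comp (phase n)))) x := by
  refine _root_.hasFDerivAt_tsum (u := fun n => (4 * Real.pi) * ((1 + ‖n‖) ^ 1 * ‖b n‖))
    ((hb 1).mul_left _) (fun n x => (hasFDerivAt_expMonomial n x).const_mul (b n))
    (fun n x => ?_) (x₀ := 0) ?_ x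
  · rw [norm_smul, norm_smul, norm_mul, Complex.norm_I, norm_expMonomial, one_mul, one_mul]
    have h1 : ‖Complex.ofRealCLM.comp (phase n)‖ ≤ 4 * Real.pi * ‖n‖ := by
      refine (ContinuousLinearMap.opNorm_comp_le _ _).trans ?_
      rw [Complex.ofRealCLM_norm, one_mul]
      exact norm_phase_le n
    have hpi := Real.pi_pos
    calc _ ≤ ‖b n‖ * (4 * Real.pi * ‖n‖) := by gcongr
      _ ≤ ‖b n‖ * (4 * Real.pi * (1 + ‖n‖)) := by gcongr; linarith
      _ = _ := by ring
  · refine Summable.of_norm (hb.summable_norm.congr fun n => ?_)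
    rw [norm_mul, norm_expMonomial, mul_one]

theorem RapidlyDecreasing.summable_fderiv {b : (Fin 2 → ℤ) → ℂ} (hb : RapidlyDecreasing b)
    (x : E2) : Summable fun n =>
      b n • ((Complex.I * expMonomial n x) • (Complex.ofRealCLM.comp (phase n))) := by
  refine Summable.of_norm_bounded ((hb 1).mul_left (4 * Real.pi)) fun n => ?_
  rw [norm_smul, norm_smul, norm_mul, Complex.norm_I, norm_expMonomial, one_mul, one_mul]
  have h1 : ‖Complex.ofRealCLM.comp (phase n)‖ ≤ 4 * Real.pi * ‖n‖ := by
    refine (ContinuousLinearMap.opNorm_comp_le _ _).trans ?_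
    rw [Complex.ofRealCLM_norm, one_mul]
    exact norm_phase_le n
  have hpi := Real.pi_pos
  calc _ ≤ ‖b n‖ * (4 * Real.pi * ‖n‖) := by gcongr
    _ ≤ ‖b n‖ * (4 * Real.pi * (1 + ‖n‖)) := by gcongr; linarith
    _ = _ := by ring

theorem RapidlyDecreasing.fderiv_tsum_apply {b : (Fin 2 → ℤ) → ℂ} (hb : RapidlyDecreasing b)
    (x v : E2) : fderiv ℝ (fun x => ∑' n, b n * expMonomial n x) x v =
      ∑' n, b n * (Complex.I * (phase n v : ℝ)) * expMonomial n x := by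
  rw [(hb.hasFDerivAt_tsum x).fderiv]
  have h := (ContinuousLinearMap.apply ℝ ℂ v).map_tsum (hb.summable_fderiv x)
  refine h.trans (tsum_congr fun n => ?_)
  simp
  ring

/-- For real p, q the imaginary part is -p Im σ₀. This is the ellipticity of ∂_v - σ₀ ∂_u. -/
theorem norm_sub_mul_ge (σ₀ : ℂ) (p q : ℝ) : |σ₀.im| * |p| ≤ ‖(q : ℂ) - σ₀ * p‖ := by
  have h := Complex.abs_im_le_norm ((q : ℂ) - σ₀ * p)
  simpa [abs_mul] using h

theorem summable_mul_expMonomial {c : (Fin 2 → ℤ) → ℂ} (hc : Summable fun n => ‖c n‖) (x : E2) :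
    Summable fun n => ‖c n * expMonomial n x‖ :=
  hc.congr fun n => by rw [norm_mul, norm_expMonomial, mul_one]

/-- The product of two absolutely convergent Fourier series. -/
theorem tsum_mul_tsum_expMonomial {a c : (Fin 2 → ℤ) → ℂ} (ha : Summable fun n => ‖a n‖)
    (hc : Summable fun n => ‖c n‖) (x : E2) :
    (∑' n, a n * expMonomial n x) * (∑' n, c n * expMonomial n x) =
      ∑' n, (∑' m, a (n - m) * c m) * expMonomial n x := by
  have haS := summable_mul_expMonomial ha x
  have hcS := summable_mul_expMonomial hc x
  -- Shear of the index lattice, collecting the products of total frequency n.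
  let e : ((Fin 2 → ℤ) × (Fin 2 → ℤ)) ≃ ((Fin 2 → ℤ) × (Fin 2 → ℤ)) :=
    { toFun := fun z => (z.1 - z.2, z.2)
      invFun := fun z => (z.1 + z.2, z.2)
      left_inv := fun z => by simp
      right_inv := fun z => by simp }
  have hprod' := e.summable_iff.2 (summable_mul_of_summable_norm haS hcS)
  rw [tsum_mul_tsum_of_summable_norm haS hcS, ← e.tsum_eq]
  refine (Summable.tsum_prod hprod').trans ?_
  refine tsum_congr fun n => ?_
  rw [← tsum_mul_right]
  refine tsum_congr fun m => ?_
  have h1 : expMonomial n x = expMonomial (n - m) x * expMonomial m x := by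
    rw [← expMonomial_add, sub_add_cancel]
  change (a (n - m) * expMonomial (n - m) x) * (c m * expMonomial m x) = _
  rw [h1]; ring

/-- The symbol of the operator `∂_v - σ₀ ∂_u`, up to the factor `2πi`. -/
noncomputable def beltramiSymbol (σ₀ : ℂ) (n : Fin 2 → ℤ) : ℂ := (n 1 : ℂ) - σ₀ * (n 0 : ℂ)

/-- This quotient is the multiplier taking F_v - σ₀ F_u to the oscillating part of F_u. Its
boundedness means that no derivative is lost, so a Neumann series suffices. -/
theorem norm_div_beltramiSymbol_le {σ₀ : ℂ} (h : σ₀.im ≠ 0) (n : Fin 2 → ℤ) :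
    ‖(n 0 : ℂ) / beltramiSymbol σ₀ n‖ ≤ |σ₀.im|⁻¹ := by
  have hm0 : 0 < |σ₀.im| := abs_pos.2 h
  have hD : |σ₀.im| * |(n 0 : ℝ)| ≤ ‖beltramiSymbol σ₀ n‖ := by
    simpa [beltramiSymbol] using norm_sub_mul_ge σ₀ (n 0) (n 1)
  rw [norm_div, Complex.norm_intCast]
  rcases eq_or_ne (n 0) 0 with h0 | h0
  · rw [h0]; simp only [Int.cast_zero, abs_zero, zero_div]; positivity
  · have h1 : 0 < |(n 0 : ℝ)| := abs_pos.2 (Int.cast_ne_zero.2 h0)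
    rw [div_le_iff₀ (lt_of_lt_of_le (by positivity) hD)]
    calc |(n 0 : ℝ)| = |σ₀.im|⁻¹ * (|σ₀.im| * |(n 0 : ℝ)|) := by field_simp
      _ ≤ _ := by gcongr

/-- Either n₀ ≠ 0 and ellipticity applies, or the symbol is the nonzero integer n₁. There are no
small denominators. -/
theorem min_le_norm_beltramiSymbol (σ₀ : ℂ) {n : Fin 2 → ℤ} (hn : n ≠ 0) :
    min |σ₀.im| 1 ≤ ‖beltramiSymbol σ₀ n‖ := by
  rcases eq_or_ne (n 0) 0 with h0 | h0
  · have h1 : n 1 ≠ 0 := by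
      intro h1
      exact hn (funext fun i => by fin_cases i <;> assumption)
    have h2 : (1 : ℝ) ≤ |(n 1 : ℝ)| := by exact_mod_cast Int.one_le_abs h1
    refine (min_le_right _ _).trans (h2.trans ?_)
    simp [beltramiSymbol, h0, Complex.norm_intCast]
  · have h2 : (1 : ℝ) ≤ |(n 0 : ℝ)| := by exact_mod_cast Int.one_le_abs h0
    have hD : |σ₀.im| * |(n 0 : ℝ)| ≤ ‖beltramiSymbol σ₀ n‖ := by
      simpa [beltramiSymbol] using norm_sub_mul_ge σ₀ (n 0) (n 1)
    exact (min_le_left _ _).trans (le_trans (le_mul_of_one_le_right (abs_nonneg _) h2) hD)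

theorem beltramiSymbol_ne_zero {σ₀ : ℂ} (h : σ₀.im ≠ 0) {n : Fin 2 → ℤ} (hn : n ≠ 0) :
    beltramiSymbol σ₀ n ≠ 0 :=
  norm_pos_iff.1 (lt_of_lt_of_le (lt_min (abs_pos.2 h) one_pos) (min_le_norm_beltramiSymbol σ₀ hn))

theorem RapidlyDecreasing.div_beltramiSymbol {W : (Fin 2 → ℤ) → ℂ} (hW : RapidlyDecreasing W)
    {σ₀ : ℂ} (h : σ₀.im ≠ 0) :
    RapidlyDecreasing fun n => W n / (2 * Real.pi * Complex.I * beltramiSymbol σ₀ n) := by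
  refine hW.of_le (2 * Real.pi * min |σ₀.im| 1)⁻¹ fun n => ?_
  have hpi := Real.pi_pos
  have hmin : 0 < min |σ₀.im| 1 := lt_min (abs_pos.2 h) one_pos
  rcases eq_or_ne n 0 with rfl | hn
  · simp only [beltramiSymbol, Pi.zero_apply, Int.cast_zero, mul_zero, sub_zero, div_zero,
      norm_zero]
    positivity
  · have h1 : ‖W n / (2 * Real.pi * Complex.I * beltramiSymbol σ₀ n)‖ =
        ‖W n‖ / (2 * Real.pi * ‖beltramiSymbol σ₀ n‖) := by
      simp [abs_of_pos hpi]
    rw [h1, div_eq_inv_mul]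
    gcongr
    exact min_le_norm_beltramiSymbol σ₀ hn

/-- For every absolutely convergent Fourier series `w` with rapidly decreasing coefficients `W`,
there is `F` with `F_v - σ₀ F_u = w` and `F_u = 1 + ∑ T W e`, with `T` of order zero. -/
theorem exists_beltrami_primitive {W : (Fin 2 → ℤ) → ℂ} (hW : RapidlyDecreasing W) {σ₀ : ℂ}
    (h : σ₀.im ≠ 0) :
    ∃ F : E2 → ℂ, ContDiff ℝ ∞ F ∧
      (∀ x, fderiv ℝ F x (EuclideanSpace.single 0 1) =
        1 + ∑' n, (n 0 : ℂ) / beltramiSymbol σ₀ n * W n * expMonomial n x) ∧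
      ∀ x, fderiv ℝ F x (EuclideanSpace.single 1 1) =
        σ₀ * fderiv ℝ F x (EuclideanSpace.single 0 1) + ∑' n, W n * expMonomial n x := by
  let D := beltramiSymbol σ₀
  let b : (Fin 2 → ℤ) → ℂ := fun n => W n / (2 * Real.pi * Complex.I * D n)
  have hb : RapidlyDecreasing b := hW.div_beltramiSymbol h
  let S : E2 → ℂ := fun x => ∑' n, b n * expMonomial n x
  -- The part u + σ₀ v solves the unperturbed equation. The term W₀ v handles the constant mode,
  -- where the symbol vanishes and division by zero makes b 0 = 0.
  let Λ : E2 →L[ℝ] ℂ := Complex.ofRealCLM.comp (EuclideanSpace.proj 0) +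
    (σ₀ + W 0) • Complex.ofRealCLM.comp (EuclideanSpace.proj 1)
  have hS : ContDiff ℝ ∞ S := hb.contDiff_tsum
  have hFd : ∀ x v, fderiv ℝ (fun x => Λ x + S x) x v =
      Λ v + ∑' n, b n * (Complex.I * (phase n v : ℝ)) * expMonomial n x := by
    intro x v
    have h1 : fderiv ℝ (fun x => Λ x + S x) x = Λ + fderiv ℝ S x :=
      (Λ.hasFDerivAt.add (hS.differentiable (by simp) x).hasFDerivAt).fderiv
    rw [h1, add_apply, hb.fderiv_tsum_apply]
  have hphase : ∀ (n : Fin 2 → ℤ) (i : Fin 2),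
      ((phase n (EuclideanSpace.single i 1) : ℝ) : ℂ) = 2 * Real.pi * n i := by
    intro n i
    rw [phase_apply]
    fin_cases i <;> simp
  have hbD : ∀ n, n ≠ 0 → b n * (2 * Real.pi * Complex.I) * D n = W n := by
    intro n hn
    have h1 : D n ≠ 0 := beltramiSymbol_ne_zero h hn
    rw [mul_assoc]
    exact div_mul_cancel₀ _ (mul_ne_zero Complex.two_pi_I_ne_zero h1)
  have hi : ∀ x n i, b n * (Complex.I * (phase n (EuclideanSpace.single i 1) : ℝ)) *
      expMonomial n x = b n * (2 * Real.pi * Complex.I) * n i * expMonomial n x := by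
    intro x n i
    rw [hphase]; ring
  have hsumi : ∀ x i, Summable fun n => b n * (2 * Real.pi * Complex.I) * n i * expMonomial n x := by
    intro x i
    have h1 := ((ContinuousLinearMap.apply ℝ ℂ (EuclideanSpace.single i 1 : E2)).summable
      (hb.summable_fderiv x))
    refine h1.congr fun n => ?_
    rw [← hi]
    simp
    ring
  refine ⟨fun x => Λ x + S x, Λ.contDiff.add hS, fun x => ?_, fun x => ?_⟩
  · rw [hFd]
    congr 1
    · simp [Λ]
    · refine tsum_congr fun n => ?_
      rw [hi]
      congr 1
      rcases eq_or_ne n 0 with rfl | hn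
      · simp
      · rw [← hbD n hn]
        field_simp [beltramiSymbol_ne_zero h hn]
        rfl
  · rw [hFd, hFd]
    simp only [hi]
    have h1 : ∀ n, W n * expMonomial n x = (if n = 0 then W 0 else 0) +
        (b n * (2 * Real.pi * Complex.I) * n 1 * expMonomial n x -
          σ₀ * (b n * (2 * Real.pi * Complex.I) * n 0 * expMonomial n x)) := by
      intro n
      split_ifs with hn
      · subst hn
        simp [expMonomial, phase_apply]
      · rw [← hbD n hn]
        simp only [D, beltramiSymbol]
        ring
    rw [tsum_congr h1, Summable.tsum_add (hasSum_ite_eq (0 : Fin 2 → ℤ) (W 0)).summable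
      ((hsumi x 1).sub ((hsumi x 0).mul_left σ₀)), tsum_ite_eq,
      Summable.tsum_sub (hsumi x 1) ((hsumi x 0).mul_left σ₀), tsum_mul_left]
    simp [Λ]
    ring

/-- Global solvability of the Beltrami equation when the coefficient is a small perturbation of a
constant. -/
theorem exists_beltrami_solution_of_small {σ₀ : ℂ} (h : σ₀.im ≠ 0) {a : (Fin 2 → ℤ) → ℂ}
    (ha : RapidlyDecreasing a) (hsmall : ∑' n, ‖a n‖ < |σ₀.im| / 2) :
    ∃ F : E2 → ℂ, ContDiff ℝ ∞ F ∧ (∀ x, fderiv ℝ F x (EuclideanSpace.single 0 1) ≠ 0) ∧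
      ∀ x, fderiv ℝ F x (EuclideanSpace.single 1 1) =
        (σ₀ + ∑' n, a n * expMonomial n x) * fderiv ℝ F x (EuclideanSpace.single 0 1) := by
  have hm0 : 0 < |σ₀.im| := abs_pos.2 h
  let T : (Fin 2 → ℤ) → ℂ := fun n => (n 0 : ℂ) / beltramiSymbol σ₀ n
  have hT : ∀ n, ‖T n‖ ≤ |σ₀.im|⁻¹ := norm_div_beltramiSymbol_le h
  -- Writing F_v - σ₀ F_u = ∑ W e and F_u = 1 + ∑ T W e, the Beltrami equation becomes W = a + a *
  -- (T W). The bound on W keeps F_u - 1 below 1 in modulus, so F_u never vanishes.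
  obtain ⟨W, hW, hWeq, hWsmall⟩ := exists_convolution_solution ha (inv_nonneg.2 hm0.le) hT
    (by rw [inv_mul_lt_iff₀ hm0]; linarith)
  obtain ⟨F, hF, hF0, hF1⟩ := exists_beltrami_primitive hW h
  have hTWle : ∀ n, ‖T n * W n‖ ≤ |σ₀.im|⁻¹ * ‖W n‖ := fun n => by
    rw [norm_mul]; gcongr; exact hT n
  have hTW : Summable fun n => ‖T n * W n‖ :=
    Summable.of_nonneg_of_le (fun n => norm_nonneg _) hTWle (hW.summable_norm.mul_left _)
  refine ⟨F, hF, fun x hx => ?_, fun x => ?_⟩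
  · rw [hF0] at hx
    have h1 : ‖∑' n, T n * W n * expMonomial n x‖ < 1 := by
      refine lt_of_le_of_lt (norm_tsum_le_tsum_norm (summable_mul_expMonomial hTW x))
        (lt_of_le_of_lt ?_ hWsmall)
      rw [← tsum_mul_left]
      refine (summable_mul_expMonomial hTW x).tsum_le_tsum (fun n => ?_)
        (hW.summable_norm.mul_left _)
      rw [norm_mul _ (expMonomial n x), norm_expMonomial, mul_one]
      exact hTWle n
    rw [eq_neg_of_add_eq_zero_right hx, norm_neg, norm_one] at h1
    exact lt_irrefl _ h1
  · rw [hF1, add_mul]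
    congr 1
    have hsumm : Summable fun n => (∑' m, a (n - m) * (T m * W m)) * expMonomial n x := by
      refine ((summable_mul_expMonomial hW.summable_norm x).of_norm.sub
        (summable_mul_expMonomial ha.summable_norm x).of_norm).congr fun n => ?_
      rw [← sub_mul, hWeq n, add_sub_cancel_left]
    rw [hF0, mul_add, mul_one]
    change _ = _ + (∑' n, a n * expMonomial n x) * ∑' n, T n * W n * expMonomial n x
    rw [tsum_mul_tsum_expMonomial ha.summable_norm hTW,
      ← (summable_mul_expMonomial ha.summable_norm x).of_norm.tsum_add hsumm]
    refine tsum_congr fun n => ?_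
    rw [← add_mul, ← hWeq n]

/-- Local solvability of the Beltrami equation `F_v = σ F_u` with smooth coefficient `σ`. -/
theorem exists_beltrami_solution {σ : E2 → ℂ} (hσ : ∀ᶠ x in 𝓝 0, ContDiffAt ℝ ∞ σ x)
    (him : (σ 0).im ≠ 0) :
    ∃ F : E2 → ℂ, ContDiff ℝ ∞ F ∧ fderiv ℝ F 0 (EuclideanSpace.single 0 1) ≠ 0 ∧
      ∀ᶠ x in 𝓝 0, fderiv ℝ F x (EuclideanSpace.single 1 1) =
        σ x * fderiv ℝ F x (EuclideanSpace.single 0 1) := by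
  obtain ⟨σ', hσ', heq⟩ := exists_contDiff_eventuallyEq hσ
  have hσ'0 : σ' 0 = σ 0 := heq.self_of_nhds
  obtain ⟨s, a, hs0, ha, hsmall, hsum⟩ := exists_small_fourier_series
    (ρ := fun x => σ' x - σ 0) (hσ'.sub contDiff_const) (by simp [hσ'0])
    (half_pos (abs_pos.2 him))
  obtain ⟨F, hF, hF0, hF1⟩ := exists_beltrami_solution_of_small him ha hsmall
  let R : E2 →L[ℝ] E2 := s⁻¹ • ContinuousLinearMap.id ℝ E2
  have hR : ∀ x v, fderiv ℝ (fun x => F (R x)) x v = s⁻¹ * fderiv ℝ F (R x) v := by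
    intro x v
    have h1 := ((hF.differentiable (by simp) (R x)).hasFDerivAt.comp x R.hasFDerivAt).fderiv
    change fderiv ℝ (F ∘ R) x v = _
    rw [h1]
    simp [R]
  have hs' : ((s⁻¹ : ℝ) : ℂ) ≠ 0 := Complex.ofReal_ne_zero.2 (inv_ne_zero hs0.ne')
  refine ⟨fun x => F (R x), hF.comp R.contDiff, ?_, ?_⟩
  · rw [hR]
    exact mul_ne_zero hs' (hF0 _)
  · have hRt : Filter.Tendsto R (𝓝 0) (𝓝 0) := by
      simpa using R.continuous.tendsto 0
    filter_upwards [hRt.eventually hsum, heq] with x hx hxσ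
    have h1 : s • R x = x := by simp [R, smul_smul, hs0.ne']
    rw [hR, hR, hF1, hx.tsum_eq, h1, hxσ]
    ring

end Beltrami

/-! ### Functions smooth near a point of a Euclidean space -/

section SmoothNear

variable {E F G : Type*} [NormedAddCommGroup E] [NormedSpace ℝ E] [NormedAddCommGroup F]
  [NormedSpace ℝ F] [NormedAddCommGroup G] [NormedSpace ℝ G]

/-- `f` is smooth in a neighbourhood of `a`. -/
abbrev SmoothNear (f : E → F) (a : E) : Prop := ∀ᶠ x in 𝓝 a, ContDiffAt ℝ ∞ f x

theorem SmoothNear.continuousAt {f : E → F} {a : E} (hf : SmoothNear f a) : ContinuousAt f a :=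
  hf.self_of_nhds.continuousAt

theorem SmoothNear.differentiableAt {f : E → F} {a : E} (hf : SmoothNear f a) :
    ∀ᶠ x in 𝓝 a, DifferentiableAt ℝ f x := by
  filter_upwards [hf] with x hx using hx.differentiableAt (by simp)

theorem SmoothNear.comp {g : F → G} {f : E → F} {a : E} {b : F} (hg : SmoothNear g b)
    (hf : SmoothNear f a) (hb : f a = b) : SmoothNear (fun x => g (f x)) a := by
  have h1 : Filter.Tendsto f (𝓝 a) (𝓝 b) := hb ▸ hf.continuousAt.tendsto
  filter_upwards [hf, h1.eventually hg] with x hx hy using hy.comp x hx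

theorem ContDiff.smoothNear {f : E → F} (hf : ContDiff ℝ ∞ f) (a : E) : SmoothNear f a :=
  Filter.Eventually.of_forall fun _ => hf.contDiffAt

theorem SmoothNear.add {f g : E → F} {a : E} (hf : SmoothNear f a) (hg : SmoothNear g a) :
    SmoothNear (fun x => f x + g x) a := by
  filter_upwards [hf, hg] with x hx hy using hx.add hy

theorem SmoothNear.sub {f g : E → F} {a : E} (hf : SmoothNear f a) (hg : SmoothNear g a) :
    SmoothNear (fun x => f x - g x) a := by
  filter_upwards [hf, hg] with x hx hy using hx.sub hy

theorem SmoothNear.neg {f : E → F} {a : E} (hf : SmoothNear f a) :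
    SmoothNear (fun x => - f x) a := by
  filter_upwards [hf] with x hx using hx.neg

theorem SmoothNear.const (c : F) (a : E) : SmoothNear (fun _ => c) a :=
  contDiff_const.smoothNear a

theorem SmoothNear.mul {𝔸 : Type*} [NormedRing 𝔸] [NormedAlgebra ℝ 𝔸] {f g : E → 𝔸} {a : E}
    (hf : SmoothNear f a) (hg : SmoothNear g a) : SmoothNear (fun x => f x * g x) a := by
  filter_upwards [hf, hg] with x hx hy using hx.mul hy

theorem SmoothNear.div {𝕜 : Type*} [NormedField 𝕜] [NormedAlgebra ℝ 𝕜] [CompleteSpace 𝕜]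
    {f g : E → 𝕜} {a : E}
    (hf : SmoothNear f a) (hg : SmoothNear g a) (h0 : g a ≠ 0) :
    SmoothNear (fun x => f x / g x) a := by
  filter_upwards [hf, hg, hg.continuousAt.eventually_ne h0] with x hx hy h
  simp only [div_eq_mul_inv]
  exact hx.mul (hy.inv h)

theorem SmoothNear.fderiv_apply {f : E → F} {a : E} (hf : SmoothNear f a) (v : E) :
    SmoothNear (fun x => fderiv ℝ f x v) a := by
  filter_upwards [hf] with x hx
  exact (hx.fderiv_right (m := ∞) (by simp)).clm_apply contDiffAt_const

end SmoothNear

/-! ### Partial derivatives on Euclidean space -/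

section Partial

variable {n : ℕ} {F : Type*} [NormedAddCommGroup F] [NormedSpace ℝ F]

/-- The `i`-th partial derivative. -/
noncomputable def pd (i : Fin n) (f : EuclideanSpace ℝ (Fin n) → F)
    (z : EuclideanSpace ℝ (Fin n)) : F := fderiv ℝ f z (EuclideanSpace.single i 1)

theorem SmoothNear.pd {f : EuclideanSpace ℝ (Fin n) → F} {a : EuclideanSpace ℝ (Fin n)}
    (hf : SmoothNear f a) (i : Fin n) : SmoothNear (pd i f) a :=
  hf.fderiv_apply _

variable {i : Fin n} {z : EuclideanSpace ℝ (Fin n)}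

theorem pd_add {f g : EuclideanSpace ℝ (Fin n) → F} (hf : DifferentiableAt ℝ f z)
    (hg : DifferentiableAt ℝ g z) : pd i (fun x => f x + g x) z = pd i f z + pd i g z := by
  simp only [pd]; rw [fderiv_fun_add hf hg]; rfl

theorem pd_sub {f g : EuclideanSpace ℝ (Fin n) → F} (hf : DifferentiableAt ℝ f z)
    (hg : DifferentiableAt ℝ g z) : pd i (fun x => f x - g x) z = pd i f z - pd i g z := by
  simp only [pd]; rw [fderiv_fun_sub hf hg]; rfl

theorem pd_mul {𝔸 : Type*} [NormedCommRing 𝔸] [NormedAlgebra ℝ 𝔸]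
    {f g : EuclideanSpace ℝ (Fin n) → 𝔸} (hf : DifferentiableAt ℝ f z)
    (hg : DifferentiableAt ℝ g z) :
    pd i (fun x => f x * g x) z = pd i f z * g z + f z * pd i g z := by
  simp only [pd]; rw [fderiv_fun_mul hf hg]
  simp [mul_comm, add_comm]

theorem pd_const_mul {𝔸 : Type*} [NormedCommRing 𝔸] [NormedAlgebra ℝ 𝔸]
    {f : EuclideanSpace ℝ (Fin n) → 𝔸} (c : 𝔸) (hf : DifferentiableAt ℝ f z) :
    pd i (fun x => c * f x) z = c * pd i f z := by
  simp only [pd]; rw [fderiv_const_mul hf]; simp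

theorem pd_clm {G : Type*} [NormedAddCommGroup G] [NormedSpace ℝ G] (L : F →L[ℝ] G)
    {f : EuclideanSpace ℝ (Fin n) → F} (hf : DifferentiableAt ℝ f z) :
    pd i (fun x => L (f x)) z = L (pd i f z) := by
  change fderiv ℝ (L ∘ f) z _ = _
  rw [(L.hasFDerivAt.comp z hf.hasFDerivAt).fderiv]; rfl

theorem pd_congr {f g : EuclideanSpace ℝ (Fin n) → F} (h : f =ᶠ[𝓝 z] g) : pd i f z = pd i g z := by
  simp only [pd]; rw [h.fderiv_eq]

end Partial

/-! ### Functions on space that are constant along the third coordinate -/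

section Descent

/-- The projection to the first two coordinates. -/
noncomputable def planeProj : E3 →L[ℝ] E2 :=
  LinearMap.toContinuousLinearMap
    { toFun := fun z => !₂[z 0, z 1]
      map_add' := fun z w => by ext i; fin_cases i <;> simp
      map_smul' := fun c z => by ext i; fin_cases i <;> simp }

/-- The inclusion of the plane as the zero section of the third coordinate. -/
noncomputable def planeIncl : E2 →L[ℝ] E3 :=
  LinearMap.toContinuousLinearMap
    { toFun := fun x => !₂[x 0, x 1, 0]
      map_add' := fun z w => by ext i; fin_cases i <;> simp
      map_smul' := fun c z => by ext i; fin_cases i <;> simp }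

theorem planeProj_apply (z : E3) : planeProj z = !₂[z 0, z 1] := rfl

theorem planeIncl_apply (x : E2) : planeIncl x = !₂[x 0, x 1, 0] := rfl

theorem planeProj_single_two : planeProj (EuclideanSpace.single 2 1) = 0 := by
  rw [planeProj_apply]; ext i; fin_cases i <;> simp

theorem eq_planeIncl_add (z : E3) :
    z = planeIncl (planeProj z) + z 2 • EuclideanSpace.single 2 1 := by
  rw [planeIncl_apply, planeProj_apply]; ext i; fin_cases i <;> simp

variable {F : Type*} [NormedAddCommGroup F] [NormedSpace ℝ F]

theorem tendsto_planeProj : Filter.Tendsto planeProj (𝓝 0) (𝓝 0) := by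
  simpa using planeProj.continuous.tendsto 0

theorem SmoothNear.comp_planeProj {f : E2 → F} (hf : SmoothNear f 0) :
    SmoothNear (fun z => f (planeProj z)) 0 :=
  hf.comp (planeProj.contDiff.smoothNear 0) (map_zero _)

theorem SmoothNear.comp_planeIncl {f : E3 → F} (hf : SmoothNear f 0) :
    SmoothNear (fun z => f (planeIncl z)) 0 :=
  hf.comp (planeIncl.contDiff.smoothNear 0) (map_zero _)

theorem fderiv_comp_planeProj {f : E2 → F} {z : E3} (hf : DifferentiableAt ℝ f (planeProj z))
    (v : E3) : fderiv ℝ (fun z => f (planeProj z)) z v = fderiv ℝ f (planeProj z) (planeProj v) := by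
  rw [show (fun z => f (planeProj z)) = f ∘ planeProj from rfl,
    (hf.hasFDerivAt.comp z planeProj.hasFDerivAt).fderiv]
  rfl

theorem pd_two_comp_planeProj {f : E2 → F} {z : E3} (hf : DifferentiableAt ℝ f (planeProj z)) :
    pd 2 (fun z => f (planeProj z)) z = 0 := by
  simp only [pd]; rw [fderiv_comp_planeProj hf, planeProj_single_two, map_zero]

/-- Keeps the vertical segment from z to its projection inside every ball about 0 that contains z,
so integration along it stays where the hypotheses hold. -/
theorem norm_planeIncl_planeProj_add_le (z : E3) {s : ℝ} (hs : s ∈ Set.Icc (0 : ℝ) 1) :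
    ‖planeIncl (planeProj z) + s • z 2 • EuclideanSpace.single 2 (1 : ℝ)‖ ≤ ‖z‖ := by
  rw [EuclideanSpace.norm_eq, EuclideanSpace.norm_eq]
  refine Real.sqrt_le_sqrt ?_
  simp only [Fin.sum_univ_three, planeIncl_apply, planeProj_apply]
  simp only [PiLp.add_apply, PiLp.smul_apply, PiLp.single_apply, Real.norm_eq_abs, sq_abs]
  simp
  have h1 : s ^ 2 ≤ 1 := pow_le_one₀ hs.1 hs.2
  nlinarith [sq_nonneg (z 2)]

/-- A function with vanishing third partial derivative near the origin is a function of the first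
two coordinates. -/
theorem eventually_eq_comp_planeProj {f : E3 → F} (hf : SmoothNear f 0)
    (hd : ∀ᶠ z in 𝓝 0, pd 2 f z = 0) :
    ∀ᶠ z in 𝓝 0, f z = f (planeIncl (planeProj z)) := by
  obtain ⟨r, hr, h⟩ := Metric.eventually_nhds_iff.1 (hf.and hd)
  filter_upwards [Metric.ball_mem_nhds (0 : E3) hr] with z hz
  rw [mem_ball_zero_iff] at hz
  let γ : ℝ → E3 := fun s => planeIncl (planeProj z) + s • z 2 • EuclideanSpace.single 2 (1 : ℝ)
  have hγ : ∀ s ∈ Set.Icc (0 : ℝ) 1, HasDerivAt (fun s => f (γ s)) 0 s := by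
    intro s hs
    have h1 : dist (γ s) 0 < r := by
      rw [dist_zero_right]
      exact (norm_planeIncl_planeProj_add_le z hs).trans_lt hz
    obtain ⟨h2, h3⟩ := h h1
    have h4 : HasDerivAt γ (z 2 • EuclideanSpace.single 2 (1 : ℝ)) s := by
      have h := ((hasDerivAt_id s).smul_const
        (z 2 • (EuclideanSpace.single 2 (1 : ℝ) : E3))).const_add (planeIncl (planeProj z))
      rw [one_smul] at h
      exact h
    have h5 := (h2.differentiableAt (by simp)).hasFDerivAt.comp_hasDerivAt s h4
    rw [map_smul] at h5
    change HasDerivAt _ (z 2 • pd 2 f (γ s)) s at h5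
    rwa [h3, smul_zero] at h5
  have h6 := constant_of_has_deriv_right_zero (f := fun s => f (γ s)) (a := 0) (b := 1)
    (fun s hs => (hγ s hs).continuousAt.continuousWithinAt)
    (fun s hs => (hγ s ⟨hs.1, hs.2.le⟩).hasDerivWithinAt) 1 ⟨zero_le_one, le_rfl⟩
  have h7 : γ 1 = z := by
    simp only [γ, one_smul]
    exact (eq_planeIncl_add z).symm
  have h8 : γ 0 = planeIncl (planeProj z) := by simp [γ]
  simpa only [h7, h8] using h6

/-- If the direction of `(n₁, n₂)` is constant along the third coordinate, then the ratio `n₂ / n₁`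
is a function of the first two coordinates. -/
theorem exists_ratio_of_wronskian_eq_zero {𝕜 : Type*} [NormedField 𝕜] [NormedAlgebra ℝ 𝕜]
    [CompleteSpace 𝕜] {n₁ n₂ : E3 → 𝕜} (h₁ : SmoothNear n₁ 0) (h₂ : SmoothNear n₂ 0)
    (hw : ∀ᶠ z in 𝓝 0, n₁ z * pd 2 n₂ z - n₂ z * pd 2 n₁ z = 0) (h0 : n₁ 0 ≠ 0) :
    ∃ σ : E2 → 𝕜, SmoothNear σ 0 ∧ ∀ᶠ z in 𝓝 0, n₂ z = σ (planeProj z) * n₁ z := by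
  have hτ : SmoothNear (fun z => n₂ z / n₁ z) 0 := h₂.div h₁ h0
  refine ⟨fun x => n₂ (planeIncl x) / n₁ (planeIncl x), hτ.comp_planeIncl, ?_⟩
  have hne := h₁.continuousAt.eventually_ne h0
  have hd : ∀ᶠ z in 𝓝 0, pd 2 (fun z => n₂ z / n₁ z) z = 0 := by
    filter_upwards [hw, hτ.differentiableAt, h₁.differentiableAt, hne.eventually_nhds]
      with z hz hd1 hd2 hn
    have h3 : pd 2 (fun z => n₂ z / n₁ z * n₁ z) z = pd 2 n₂ z := by
      apply pd_congr
      filter_upwards [hn] with y hy using div_mul_cancel₀ _ hy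
    rw [pd_mul hd1 hd2] at h3
    have hn0 := hn.self_of_nhds
    -- Quotient rule: the derivative of n₂/n₁ times n₁² is the Wronskian.
    have h4 : pd 2 (fun z => n₂ z / n₁ z) z * n₁ z ^ 2 = 0 := by
      rw [← hz, ← h3]
      field_simp
      ring
    exact (mul_eq_zero.1 h4).resolve_right (pow_ne_zero 2 hn0)
  filter_upwards [eventually_eq_comp_planeProj hτ hd, hne] with z hz hn
  rw [← hz, div_mul_cancel₀ _ hn]

/-- A plane-valued function on space whose direction is constant along the third coordinate is
proportional to a function of the first two coordinates. -/
theorem exists_direction_of_wronskian_eq_zero {n₁ n₂ : E3 → ℝ} (h₁ : SmoothNear n₁ 0)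
    (h₂ : SmoothNear n₂ 0) (hw : ∀ᶠ z in 𝓝 0, n₁ z * pd 2 n₂ z - n₂ z * pd 2 n₁ z = 0)
    (h0 : n₁ 0 ≠ 0 ∨ n₂ 0 ≠ 0) :
    ∃ β₁ β₂ : E2 → ℝ, SmoothNear β₁ 0 ∧ SmoothNear β₂ 0 ∧ (∀ x, β₁ x ≠ 0 ∨ β₂ x ≠ 0) ∧
      ∀ᶠ z in 𝓝 0, n₁ z * β₂ (planeProj z) = n₂ z * β₁ (planeProj z) := by
  rcases h0 with h0 | h0
  · obtain ⟨σ, hσ, h⟩ := exists_ratio_of_wronskian_eq_zero h₁ h₂ hw h0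
    refine ⟨fun _ => 1, σ, SmoothNear.const 1 0, hσ, fun _ => Or.inl one_ne_zero, ?_⟩
    filter_upwards [h] with z hz
    rw [hz]; ring
  · obtain ⟨σ, hσ, h⟩ := exists_ratio_of_wronskian_eq_zero h₂ h₁
      (by filter_upwards [hw] with z hz; linarith) h0
    refine ⟨σ, fun _ => 1, hσ, SmoothNear.const 1 0, fun _ => Or.inr one_ne_zero, ?_⟩
    filter_upwards [h] with z hz
    rw [hz]; ring

end Descent

/-! ### First integrals of planar vector fields -/

section FirstIntegral

theorem clm_apply_eq_pd {f : E2 → ℝ} {x : E2} (v : E2) :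
    fderiv ℝ f x v = v 0 * pd 0 f x + v 1 * pd 1 f x := by
  have h : v = v 0 • EuclideanSpace.single 0 1 + v 1 • EuclideanSpace.single 1 1 := by
    ext i; fin_cases i <;> simp
  conv_lhs => rw [h, map_add, map_smul, map_smul]
  rfl

/-- A nonvanishing planar vector field `v₁ ∂_u + v₂ ∂_v` has a nondegenerate first integral `f`
and a function `g` growing with unit speed along it. -/
theorem exists_firstIntegral {v₁ v₂ : E2 → ℝ} (h₁ : SmoothNear v₁ 0) (h₂ : SmoothNear v₂ 0)
    (h0 : v₁ 0 ≠ 0 ∨ v₂ 0 ≠ 0) :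
    ∃ f g : E2 → ℝ, SmoothNear f 0 ∧ SmoothNear g 0 ∧ (pd 0 f 0 ≠ 0 ∨ pd 1 f 0 ≠ 0) ∧
      (∀ᶠ x in 𝓝 0, v₁ x * pd 0 f x + v₂ x * pd 1 f x = 0) ∧
      ∀ᶠ x in 𝓝 0, v₁ x * pd 0 g x + v₂ x * pd 1 g x = 1 := by
  let V : E2 → E2 := fun x => v₁ x • EuclideanSpace.single 0 1 + v₂ x • EuclideanSpace.single 1 1
  have hV0 : ∀ x, V x 0 = v₁ x := fun x => by simp [V]
  have hV1 : ∀ x, V x 1 = v₂ x := fun x => by simp [V]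
  have hV : SmoothNear V 0 := by
    filter_upwards [h₁, h₂] with x hx hy
    exact (hx.smul contDiffAt_const).add (hy.smul contDiffAt_const)
  have hVne : V 0 ≠ 0 := by
    intro h
    rcases h0 with h0 | h0
    · exact h0 (by rw [← hV0, h]; rfl)
    · exact h0 (by rw [← hV1, h]; rfl)
  have hw : (EuclideanSpace.single 0 1 : E2) ≠ 0 := by simp
  -- In the flow box the field is ∂₀, so the coordinate 1 of the inverse is a first integral and the
  -- coordinate 0 grows with unit speed.
  obtain ⟨e, he0, hep, hes, hes', hed, hw'⟩ := exists_flowBox hV hVne hw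
  have h0t : (0 : E2) ∈ e.target := by rw [← hep]; exact e.map_source he0
  have hsymm0 : e.symm 0 = 0 := by
    have h := e.left_inv he0
    rwa [hep] at h
  have hsm : SmoothNear e.symm 0 := by
    filter_upwards [e.open_target.mem_nhds h0t] with y hy using hes' y hy
  have hst : Filter.Tendsto e.symm (𝓝 0) (𝓝 0) := by
    have := hsm.continuousAt.tendsto
    rwa [hsymm0] at this
  have hVs : ∀ᶠ y in 𝓝 0, fderiv ℝ e.symm y (V y) = EuclideanSpace.single 0 1 := by
    filter_upwards [e.open_target.mem_nhds h0t, hst.eventually hw'] with y hy hwy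
    obtain ⟨g, hg⟩ := hed _ (e.map_target hy)
    have h3 := e.hasFDerivAt_symm hy hg
    rw [hg.fderiv, e.right_inv hy] at hwy
    rw [h3.fderiv, ← hwy]
    exact g.symm_apply_apply _
  have hproj : ∀ i : Fin 2, ∀ᶠ y in 𝓝 0, ∀ v : E2,
      fderiv ℝ (fun y => e.symm y i) y v = fderiv ℝ e.symm y v i := by
    intro i
    filter_upwards [hsm] with y hy v
    have := (((EuclideanSpace.proj i : E2 →L[ℝ] ℝ).hasFDerivAt).comp y
      (hy.differentiableAt (by simp)).hasFDerivAt).fderiv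
    change fderiv ℝ ((EuclideanSpace.proj i : E2 →L[ℝ] ℝ) ∘ e.symm) y v = _
    rw [this]
    rfl
  have hsi : ∀ i : Fin 2, SmoothNear (fun y => e.symm y i) 0 := fun i => by
    filter_upwards [hsm] with y hy
    exact (EuclideanSpace.proj i : E2 →L[ℝ] ℝ).contDiff.contDiffAt.comp y hy
  refine ⟨fun y => e.symm y 1, fun y => e.symm y 0, hsi 1, hsi 0, ?_, ?_, ?_⟩
  · by_contra hcon
    push Not at hcon
    have hzero : ∀ v : E2, fderiv ℝ e.symm 0 v 1 = 0 := by
      intro v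
      rw [← (hproj 1).self_of_nhds, clm_apply_eq_pd, hcon.1, hcon.2]
      ring
    obtain ⟨g, hg⟩ := hed _ (e.map_target h0t)
    have h3 := (e.hasFDerivAt_symm h0t hg).fderiv
    have h4 := hzero (g (EuclideanSpace.single 1 1))
    rw [h3] at h4
    have h5 : ((g.symm : E2 →L[ℝ] E2) (g (EuclideanSpace.single 1 1))) =
      EuclideanSpace.single 1 1 := g.symm_apply_apply _
    rw [h5] at h4
    simp at h4
  · filter_upwards [hproj 1, hVs] with y hy hv
    have := clm_apply_eq_pd (f := fun y => e.symm y 1) (x := y) (V y)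
    rw [hV0, hV1, hy, hv] at this
    rw [← this]
    simp
  · filter_upwards [hproj 0, hVs] with y hy hv
    have := clm_apply_eq_pd (f := fun y => e.symm y 0) (x := y) (V y)
    rw [hV0, hV1, hy, hv] at this
    rw [← this]
    simp

end FirstIntegral

/-! ### Balanced pairs of forms annihilating the third coordinate direction -/

section BalancedPlanar

/-- Coefficients of two contact forms `f₁ du + f₂ dv` and `g₁ du + g₂ dv` near the origin of space
which are balanced with sign `ε`, transverse, and have constant generating invariant `c`. -/
structure IsBalancedPlanar (ε c : ℝ) (f₁ f₂ g₁ g₂ : E3 → ℝ) : Prop where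
  smooth_f₁ : SmoothNear f₁ 0
  smooth_f₂ : SmoothNear f₂ 0
  smooth_g₁ : SmoothNear g₁ 0
  smooth_g₂ : SmoothNear g₂ 0
  nondeg : ∀ᶠ z in 𝓝 0, f₁ z * pd 2 f₂ z - f₂ z * pd 2 f₁ z ≠ 0
  balanced : ∀ᶠ z in 𝓝 0, g₁ z * pd 2 g₂ z - g₂ z * pd 2 g₁ z =
    ε * (f₁ z * pd 2 f₂ z - f₂ z * pd 2 f₁ z)
  invariant : ∀ᶠ z in 𝓝 0, f₁ z * pd 2 g₂ z - f₂ z * pd 2 g₁ z +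
    (g₁ z * pd 2 f₂ z - g₂ z * pd 2 f₁ z) = c * (f₁ z * pd 2 f₂ z - f₂ z * pd 2 f₁ z)
  indep : f₁ 0 * g₂ 0 - f₂ 0 * g₁ 0 ≠ 0

/-- The planar functions `x, y` put the pair of forms into the normal form
`m dy + l dx`, `(c m - l) dy + ε m dx`. -/
structure IsNormalizing (ε c : ℝ) (f₁ f₂ g₁ g₂ : E3 → ℝ) (x y : E2 → ℝ) : Prop where
  smooth_x : SmoothNear x 0
  smooth_y : SmoothNear y 0
  jacobian : pd 0 x 0 * pd 1 y 0 - pd 1 x 0 * pd 0 y 0 ≠ 0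
  normal : ∀ᶠ z in 𝓝 0, ∃ m l : ℝ,
    f₁ z = m * pd 0 y (planeProj z) + l * pd 0 x (planeProj z) ∧
    f₂ z = m * pd 1 y (planeProj z) + l * pd 1 x (planeProj z) ∧
    g₁ z = (c * m - l) * pd 0 y (planeProj z) + ε * m * pd 0 x (planeProj z) ∧
    g₂ z = (c * m - l) * pd 1 y (planeProj z) + ε * m * pd 1 x (planeProj z)

variable {ε c : ℝ} {f₁ f₂ g₁ g₂ : E3 → ℝ}

theorem SmoothNear.const_mul {E : Type*} [NormedAddCommGroup E] [NormedSpace ℝ E] {f : E → ℝ}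
    {a : E} (k : ℝ) (hf : SmoothNear f a) : SmoothNear (fun x => k * f x) a :=
  (SmoothNear.const k a).mul hf

theorem SmoothNear.clm {E F G : Type*} [NormedAddCommGroup E] [NormedSpace ℝ E]
    [NormedAddCommGroup F] [NormedSpace ℝ F] [NormedAddCommGroup G] [NormedSpace ℝ G]
    {f : E → F} {a : E} (L : F →L[ℝ] G) (hf : SmoothNear f a) : SmoothNear (fun x => L (f x)) a :=
  (L.contDiff.smoothNear (f a)).comp hf rfl

/-- A plane-valued function on space whose direction is constant along the third coordinate is
proportional to the gradient of a planar function. -/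
theorem exists_potential_of_wronskian_eq_zero {n₁ n₂ : E3 → ℝ} (h₁ : SmoothNear n₁ 0)
    (h₂ : SmoothNear n₂ 0) (hw : ∀ᶠ z in 𝓝 0, n₁ z * pd 2 n₂ z - n₂ z * pd 2 n₁ z = 0)
    (h0 : n₁ 0 ≠ 0 ∨ n₂ 0 ≠ 0) :
    ∃ (F : E2 → ℝ) (h : E3 → ℝ), SmoothNear F 0 ∧ SmoothNear h 0 ∧
      (pd 0 F 0 ≠ 0 ∨ pd 1 F 0 ≠ 0) ∧
      ∀ᶠ z in 𝓝 0, n₁ z = h z * pd 0 F (planeProj z) ∧ n₂ z = h z * pd 1 F (planeProj z) := by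
  obtain ⟨β₁, β₂, hβ₁, hβ₂, hβ, hn⟩ := exists_direction_of_wronskian_eq_zero h₁ h₂ hw h0
  -- A first integral of the rotated field (β₂, -β₁) has gradient parallel to (β₁, β₂).
  obtain ⟨F, -, hF, -, hF0, hdF, -⟩ := exists_firstIntegral hβ₂ hβ₁.neg (by
    rcases hβ 0 with h | h
    · exact Or.inr (neg_ne_zero.2 h)
    · exact Or.inl h)
  have hN : pd 0 F (planeProj 0) * pd 0 F (planeProj 0) +
      pd 1 F (planeProj 0) * pd 1 F (planeProj 0) ≠ 0 := by
    rw [map_zero]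
    rcases hF0 with h | h
    · have := mul_self_pos.2 h
      nlinarith [mul_self_nonneg (pd 1 F 0)]
    · have := mul_self_pos.2 h
      nlinarith [mul_self_nonneg (pd 0 F 0)]
  have hs0 := (hF.pd 0).comp_planeProj
  have hs1 := (hF.pd 1).comp_planeProj
  have hsN := (hs0.mul hs0).add (hs1.mul hs1)
  -- The factor is the orthogonal projection of (n₁, n₂) on the gradient, which is smooth without
  -- choosing a component to divide by.
  refine ⟨F, fun z => (n₁ z * pd 0 F (planeProj z) + n₂ z * pd 1 F (planeProj z)) /
    (pd 0 F (planeProj z) * pd 0 F (planeProj z) + pd 1 F (planeProj z) * pd 1 F (planeProj z)),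
    hF, ((h₁.mul hs0).add (h₂.mul hs1)).div hsN hN, hF0, ?_⟩
  filter_upwards [hn, tendsto_planeProj.eventually hdF, hsN.continuousAt.eventually_ne hN]
    with z hz hdz hNz
  generalize planeProj z = w at *
  have key : n₁ z * pd 1 F w = n₂ z * pd 0 F w := by
    rcases hβ w with h | h
    · refine mul_left_cancel₀ h ?_
      linear_combination (n₁ z) * (-hdz) + (pd 0 F w) * hz
    · refine mul_left_cancel₀ h ?_
      linear_combination (pd 1 F w) * hz - (n₂ z) * hdz
  constructor
  · rw [div_mul_eq_mul_div, eq_div_iff hNz]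
    linear_combination pd 1 F w * key
  · rw [div_mul_eq_mul_div, eq_div_iff hNz]
    linear_combination -pd 0 F w * key

/-- The Wronskian is quadratic, so that of g - κf is (κ² - cκ + ε) times that of f. This is the
integrability of α' - κα, and the place where constancy of the invariant enters for real roots. -/
theorem IsBalancedPlanar.wronskian_eq_zero (H : IsBalancedPlanar ε c f₁ f₂ g₁ g₂) {κ : ℝ}
    (hκ : κ ^ 2 - c * κ + ε = 0) :
    ∀ᶠ z in 𝓝 0, (g₁ z - κ * f₁ z) * pd 2 (fun z => g₂ z - κ * f₂ z) z -
      (g₂ z - κ * f₂ z) * pd 2 (fun z => g₁ z - κ * f₁ z) z = 0 := by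
  filter_upwards [H.balanced, H.invariant, H.smooth_f₁.differentiableAt,
    H.smooth_f₂.differentiableAt, H.smooth_g₁.differentiableAt, H.smooth_g₂.differentiableAt]
    with z hb hi h1 h2 h3 h4
  rw [pd_sub h4 (h2.const_mul κ), pd_sub h3 (h1.const_mul κ), pd_const_mul κ h1,
    pd_const_mul κ h2]
  linear_combination hb - κ * hi + (f₁ z * pd 2 f₂ z - f₂ z * pd 2 f₁ z) * hκ

theorem IsBalancedPlanar.exists_potential (H : IsBalancedPlanar ε c f₁ f₂ g₁ g₂) {κ : ℝ}
    (hκ : κ ^ 2 - c * κ + ε = 0) :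
    ∃ (F : E2 → ℝ) (h : E3 → ℝ), SmoothNear F 0 ∧ SmoothNear h 0 ∧
      (pd 0 F 0 ≠ 0 ∨ pd 1 F 0 ≠ 0) ∧
      ∀ᶠ z in 𝓝 0, g₁ z - κ * f₁ z = h z * pd 0 F (planeProj z) ∧
        g₂ z - κ * f₂ z = h z * pd 1 F (planeProj z) := by
  refine exists_potential_of_wronskian_eq_zero (H.smooth_g₁.sub (H.smooth_f₁.const_mul κ))
    (H.smooth_g₂.sub (H.smooth_f₂.const_mul κ)) (H.wronskian_eq_zero hκ) ?_
  by_contra! hcon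
  exact H.indep (by linear_combination f₁ 0 * hcon.2 - f₂ 0 * hcon.1)

/-- The two potentials must be Fᵢ = y + κᵢ x; solving this linear system defines x and y. -/
theorem IsBalancedPlanar.exists_isNormalizing_of_ne (H : IsBalancedPlanar ε c f₁ f₂ g₁ g₂)
    {κ₁ κ₂ : ℝ} (hκ₁ : κ₁ ^ 2 - c * κ₁ + ε = 0) (hκ₂ : κ₂ ^ 2 - c * κ₂ + ε = 0) (hne : κ₁ ≠ κ₂) :
    ∃ x y : E2 → ℝ, IsNormalizing ε c f₁ f₂ g₁ g₂ x y := by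
  obtain ⟨F₁, h₁, hF₁, hh₁, -, hn₁⟩ := H.exists_potential hκ₁
  obtain ⟨F₂, h₂, hF₂, hh₂, -, hn₂⟩ := H.exists_potential hκ₂
  have hk : κ₁ - κ₂ ≠ 0 := sub_ne_zero.2 hne
  have hx : SmoothNear (fun x => (κ₁ - κ₂)⁻¹ * (F₁ x - F₂ x)) 0 := (hF₁.sub hF₂).const_mul _
  have hdx : ∀ i, ∀ᶠ w in 𝓝 0, pd i (fun x => (κ₁ - κ₂)⁻¹ * (F₁ x - F₂ x)) w =
      (κ₁ - κ₂)⁻¹ * (pd i F₁ w - pd i F₂ w) := by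
    intro i
    filter_upwards [hF₁.differentiableAt, hF₂.differentiableAt] with w h1 h2
    rw [pd_const_mul _ (h1.fun_sub h2), pd_sub h1 h2]
  have hdy : ∀ i, ∀ᶠ w in 𝓝 0, pd i (fun x => F₁ x - κ₁ * ((κ₁ - κ₂)⁻¹ * (F₁ x - F₂ x))) w =
      pd i F₁ w - κ₁ * ((κ₁ - κ₂)⁻¹ * (pd i F₁ w - pd i F₂ w)) := by
    intro i
    filter_upwards [hF₁.differentiableAt, hx.differentiableAt, hdx i] with w h1 h2 h3
    rw [pd_sub h1 (h2.const_mul _), pd_const_mul _ h2, h3]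
  refine ⟨_, _, hx, hF₁.sub (hx.const_mul κ₁), ?_, ?_⟩
  · rw [(hdx 0).self_of_nhds, (hdx 1).self_of_nhds, (hdy 0).self_of_nhds, (hdy 1).self_of_nhds]
    obtain ⟨h1, h2⟩ := hn₁.self_of_nhds
    obtain ⟨h3, h4⟩ := hn₂.self_of_nhds
    rw [map_zero] at h1 h2 h3 h4
    intro hcon
    -- If the gradients of F₁ and F₂ were parallel, so would be g - κ₁f and g - κ₂f, and hence f and
    -- g, against transversality.
    have hJ : pd 0 F₁ 0 * pd 1 F₂ 0 - pd 1 F₁ 0 * pd 0 F₂ 0 = 0 := by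
      field_simp at hcon
      refine mul_left_cancel₀ hk ?_
      linear_combination hcon
    refine H.indep (mul_left_cancel₀ hk ?_)
    linear_combination h₁ 0 * h₂ 0 * (-hJ) - (g₂ 0 - κ₂ * f₂ 0) * h1 + (g₁ 0 - κ₂ * f₁ 0) * h2
      + h₁ 0 * pd 1 F₁ 0 * h3 - h₁ 0 * pd 0 F₁ 0 * h4
  · filter_upwards [hn₁, hn₂, tendsto_planeProj.eventually (hdx 0),
      tendsto_planeProj.eventually (hdx 1), tendsto_planeProj.eventually (hdy 0),
      tendsto_planeProj.eventually (hdy 1)] with z h1 h2 h3 h4 h5 h6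
    rw [h3, h4, h5, h6]
    generalize planeProj z = w at *
    -- Solves h₁ = κ₂ m - l and h₂ = κ₁ m - l.
    refine ⟨(κ₁ - κ₂)⁻¹ * (h₂ z - h₁ z),
      (c - κ₁) * ((κ₁ - κ₂)⁻¹ * (h₂ z - h₁ z)) - h₁ z, ?_⟩
    have hc : c = κ₁ + κ₂ := by
      refine mul_left_cancel₀ hk ?_
      linear_combination hκ₂ - hκ₁
    have he : ε = κ₁ * κ₂ := by linear_combination hκ₁ + κ₁ * hc
    have hf : ∀ f g a b A B : ℝ, g - κ₁ * f = a * A → g - κ₂ * f = b * B →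
        f = (κ₁ - κ₂)⁻¹ * (b * B - a * A) ∧ g = (κ₁ - κ₂)⁻¹ * (κ₁ * (b * B) - κ₂ * (a * A)) := by
      intro f g a b A B h h'
      rw [← h, ← h']
      constructor <;> field_simp <;> ring
    obtain ⟨e1, e3⟩ := hf _ _ _ _ _ _ h1.1 h2.1
    obtain ⟨e2, e4⟩ := hf _ _ _ _ _ _ h1.2 h2.2
    rw [e1, e2, e3, e4, hc, he]
    refine ⟨?_, ?_, ?_, ?_⟩ <;> field_simp <;> ring

/-- The root gives only F = y + κx, with h = κm - l. The normal form then reads α = m dF - h dx, so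
x is subject only to α ∧ dF = -h dx ∧ dF. This is a planar equation, because the ratio q of α ∧ dF
to h du ∧ dv is independent of the third coordinate. -/
theorem IsBalancedPlanar.exists_isNormalizing_of_double (H : IsBalancedPlanar ε c f₁ f₂ g₁ g₂)
    {κ : ℝ} (hc : c = 2 * κ) (he : ε = κ ^ 2) :
    ∃ x y : E2 → ℝ, IsNormalizing ε c f₁ f₂ g₁ g₂ x y := by
  obtain ⟨F, h, hF, hh, hF0, hn⟩ := H.exists_potential (κ := κ) (by rw [hc, he]; ring)
  have hs0 := (hF.pd 0).comp_planeProj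
  have hs1 := (hF.pd 1).comp_planeProj
  have hn0 := hn.self_of_nhds
  rw [map_zero] at hn0
  have hh0 : h 0 ≠ 0 := by
    intro h0
    rw [h0, zero_mul, zero_mul] at hn0
    exact H.indep (by linear_combination f₁ 0 * hn0.2 - f₂ 0 * hn0.1)
  have hD : SmoothNear (fun z => f₁ z * pd 1 F (planeProj z) - f₂ z * pd 0 F (planeProj z)) 0 :=
    (H.smooth_f₁.mul hs1).sub (H.smooth_f₂.mul hs0)
  have hw : ∀ᶠ z in 𝓝 0, h z * pd 2
      (fun z => f₁ z * pd 1 F (planeProj z) - f₂ z * pd 0 F (planeProj z)) z -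
      (f₁ z * pd 1 F (planeProj z) - f₂ z * pd 0 F (planeProj z)) * pd 2 h z = 0 := by
    filter_upwards [H.invariant, H.smooth_f₁.differentiableAt,
      H.smooth_f₂.differentiableAt, H.smooth_g₁.differentiableAt, H.smooth_g₂.differentiableAt,
      hs0.differentiableAt, hs1.differentiableAt, hh.differentiableAt, hn.eventually_nhds,
      tendsto_planeProj.eventually (hF.pd 0).differentiableAt,
      tendsto_planeProj.eventually (hF.pd 1).differentiableAt]
      with z hi h1 h2 h3 h4 h5 h6 h7 hn h8 h9
    have e1 : pd 2 (fun z => g₁ z - κ * f₁ z) z = pd 2 (fun z => h z * pd 0 F (planeProj z)) z :=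
      pd_congr (hn.mono fun _ h => h.1)
    have e2 : pd 2 (fun z => g₂ z - κ * f₂ z) z = pd 2 (fun z => h z * pd 1 F (planeProj z)) z :=
      pd_congr (hn.mono fun _ h => h.2)
    obtain ⟨e3, e4⟩ := hn.self_of_nhds
    rw [pd_sub h3 (h1.const_mul κ), pd_const_mul κ h1, pd_mul h7 h5,
      pd_two_comp_planeProj h8] at e1
    rw [pd_sub h4 (h2.const_mul κ), pd_const_mul κ h2, pd_mul h7 h6,
      pd_two_comp_planeProj h9] at e2
    rw [pd_sub (h1.fun_mul h6) (h2.fun_mul h5), pd_mul h1 h6, pd_mul h2 h5, pd_two_comp_planeProj h8,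
      pd_two_comp_planeProj h9]
    rw [hc] at hi
    linear_combination f₁ z * e2 - f₂ z * e1 - hi + pd 2 f₂ z * e3 - pd 2 f₁ z * e4
  obtain ⟨q, hq, hqD⟩ := exists_ratio_of_wronskian_eq_zero hh hD hw hh0
  have hq0 : q 0 ≠ 0 := by
    intro h0
    have := hqD.self_of_nhds
    rw [map_zero, h0, zero_mul] at this
    refine H.indep ?_
    linear_combination f₁ 0 * hn0.2 - f₂ 0 * hn0.1 + h 0 * this
  -- Dividing the rotated gradient (-F_v, F_u) by q turns x_u F_v - x_v F_u = -q into unit growth of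
  -- x along a nonvanishing field.
  obtain ⟨-, x, -, hx, -, -, hVx⟩ := exists_firstIntegral
    ((hF.pd 1).div hq hq0).neg ((hF.pd 0).div hq hq0) (by
      rcases hF0 with h | h
      · exact Or.inr (div_ne_zero h hq0)
      · exact Or.inl (neg_ne_zero.2 (div_ne_zero h hq0)))
  have hxF : ∀ᶠ w in 𝓝 0, pd 0 x w * pd 1 F w - pd 1 x w * pd 0 F w = - q w := by
    filter_upwards [hVx, hq.continuousAt.eventually_ne hq0] with w h1 h2
    field_simp at h1
    linear_combination -h1
  have hdy : ∀ i, ∀ᶠ w in 𝓝 0, pd i (fun w => F w - κ * x w) w = pd i F w - κ * pd i x w := by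
    intro i
    filter_upwards [hF.differentiableAt, hx.differentiableAt] with w h1 h2
    rw [pd_sub h1 (h2.const_mul _), pd_const_mul _ h2]
  refine ⟨x, _, hx, hF.sub (hx.const_mul κ), ?_, ?_⟩
  · rw [(hdy 0).self_of_nhds, (hdy 1).self_of_nhds]
    intro hcon
    apply hq0
    linear_combination hxF.self_of_nhds - hcon
  · have hN : pd 0 F (planeProj 0) * pd 0 F (planeProj 0) +
        pd 1 F (planeProj 0) * pd 1 F (planeProj 0) ≠ 0 := by
      rw [map_zero]
      rcases hF0 with h | h
      · have := mul_self_pos.2 h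
        nlinarith [mul_self_nonneg (pd 1 F 0)]
      · have := mul_self_pos.2 h
        nlinarith [mul_self_nonneg (pd 0 F 0)]
    filter_upwards [hn, hqD, tendsto_planeProj.eventually hxF,
      tendsto_planeProj.eventually (hdy 0), tendsto_planeProj.eventually (hdy 1),
      ((hs0.mul hs0).add (hs1.mul hs1)).continuousAt.eventually_ne hN] with z h1 h2 h3 h4 h5 hNz
    rw [h4, h5]
    generalize planeProj z = w at *
    set m := ((f₁ z + h z * pd 0 x w) * pd 0 F w + (f₂ z + h z * pd 1 x w) * pd 1 F w) /
      (pd 0 F w * pd 0 F w + pd 1 F w * pd 1 F w) with hm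
    have hpar : (f₁ z + h z * pd 0 x w) * pd 1 F w = (f₂ z + h z * pd 1 x w) * pd 0 F w := by
      linear_combination h2 + h z * h3
    have e1 : f₁ z = m * pd 0 F w - h z * pd 0 x w := by
      rw [eq_sub_iff_add_eq, hm, div_mul_eq_mul_div, eq_div_iff hNz]
      linear_combination pd 1 F w * hpar
    have e2 : f₂ z = m * pd 1 F w - h z * pd 1 x w := by
      rw [eq_sub_iff_add_eq, hm, div_mul_eq_mul_div, eq_div_iff hNz]
      linear_combination -pd 0 F w * hpar
    refine ⟨m, κ * m - h z, ?_, ?_, ?_, ?_⟩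
    · linear_combination e1
    · linear_combination e2
    · rw [hc, he]; linear_combination h1.1 + κ * e1
    · rw [hc, he]; linear_combination h1.2 + κ * e2

/-- Here κ = a + ib is a nonreal root, and g - κf has the complex ratio σ, a planar function. A
Beltrami solution F makes g - κf a multiple of dF, and F = y + κx gives x = Im F / b and y = Re F -
a x. -/
theorem IsBalancedPlanar.exists_isNormalizing_of_lt (H : IsBalancedPlanar ε c f₁ f₂ g₁ g₂)
    {a b : ℝ} (hb : b ≠ 0) (hc : c = 2 * a) (he : ε = a ^ 2 + b ^ 2) :
    ∃ x y : E2 → ℝ, IsNormalizing ε c f₁ f₂ g₁ g₂ x y := by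
  set κ : ℂ := ⟨a, b⟩ with hκ
  have hκ2 : κ ^ 2 - c * κ + ε = 0 := by
    rw [hκ, hc, he]
    apply Complex.ext <;> simp [pow_two] <;> ring
  let n : (E3 → ℝ) → (E3 → ℝ) → E3 → ℂ := fun f g z => (g z : ℂ) - κ * (f z : ℂ)
  have hre : ∀ f g z, (n f g z).re = g z - a * f z := fun f g z => by simp [n, hκ]
  have him : ∀ f g z, (n f g z).im = - b * f z := fun f g z => by simp [n, hκ]
  have hsm : ∀ {f g : E3 → ℝ}, SmoothNear f 0 → SmoothNear g 0 → SmoothNear (n f g) 0 :=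
    fun hf hg => (hg.clm Complex.ofRealCLM).sub
      ((SmoothNear.const κ 0).mul (hf.clm Complex.ofRealCLM))
  have hpd : ∀ {f g : E3 → ℝ} {z : E3}, DifferentiableAt ℝ f z → DifferentiableAt ℝ g z →
      pd 2 (n f g) z = ((pd 2 g z : ℝ) : ℂ) - κ * ((pd 2 f z : ℝ) : ℂ) := by
    intro f g z hf hg
    have hf' : DifferentiableAt ℝ (fun z => (f z : ℂ)) z :=
      Complex.ofRealCLM.differentiableAt.comp z hf
    have hg' : DifferentiableAt ℝ (fun z => (g z : ℂ)) z :=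
      Complex.ofRealCLM.differentiableAt.comp z hg
    have h1 := pd_clm (i := 2) Complex.ofRealCLM hf
    have h2 := pd_clm (i := 2) Complex.ofRealCLM hg
    simp only [Complex.ofRealCLM_apply] at h1 h2
    rw [pd_sub hg' (hf'.const_mul κ), pd_const_mul κ hf', h1, h2]
  have hw : ∀ᶠ z in 𝓝 0, n f₁ g₁ z * pd 2 (n f₂ g₂) z - n f₂ g₂ z * pd 2 (n f₁ g₁) z = 0 := by
    filter_upwards [H.balanced, H.invariant, H.smooth_f₁.differentiableAt,
      H.smooth_f₂.differentiableAt, H.smooth_g₁.differentiableAt, H.smooth_g₂.differentiableAt]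
      with z hb hi h1 h2 h3 h4
    rw [hpd h1 h3, hpd h2 h4]
    have hb' := congrArg (fun t : ℝ => (t : ℂ)) hb
    have hi' := congrArg (fun t : ℝ => (t : ℂ)) hi
    push_cast at hb' hi'
    simp only [n]
    linear_combination hb' - κ * hi' + ((f₁ z : ℂ) * (pd 2 f₂ z : ℝ) - (f₂ z : ℂ) * (pd 2 f₁ z : ℝ)) * hκ2
  have hn0 : n f₁ g₁ 0 ≠ 0 := by
    intro h0
    have h1 := hre f₁ g₁ 0
    have h2 := him f₁ g₁ 0
    rw [h0] at h1 h2
    simp only [Complex.zero_re, Complex.zero_im] at h1 h2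
    have h3 : f₁ 0 = 0 := by
      rcases mul_eq_zero.1 h2.symm with h | h
      · exact absurd (neg_eq_zero.1 h) hb
      · exact h
    exact H.indep (by linear_combination (g₂ 0 - a * f₂ 0) * h3 + f₂ 0 * h1)
  obtain ⟨σ, hσ, hσn⟩ := exists_ratio_of_wronskian_eq_zero (hsm H.smooth_f₁ H.smooth_g₁)
    (hsm H.smooth_f₂ H.smooth_g₂) hw hn0
  -- A real ratio σ would make both f and g proportional to (1, σ), against transversality; so the
  -- equation is elliptic.
  have hσ0 : (σ 0).im ≠ 0 := by
    intro h0
    have h1 := hσn.self_of_nhds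
    rw [map_zero] at h1
    have h2 := congrArg Complex.im h1
    have h3 := congrArg Complex.re h1
    rw [Complex.mul_im, h0, zero_mul, add_zero, him, him] at h2
    rw [Complex.mul_re, h0, zero_mul, sub_zero, hre, hre] at h3
    refine H.indep (mul_left_cancel₀ hb ?_)
    linear_combination (g₁ 0) * h2 + b * f₁ 0 * h3 - a * f₁ 0 * h2
  obtain ⟨F, hF, hF0, hFσ⟩ := exists_beltrami_solution hσ hσ0
  have hFd : ∀ w, DifferentiableAt ℝ F w := fun w => hF.contDiffAt.differentiableAt (by simp)
  have hdre : ∀ i w, pd i (fun w => (F w).re) w = (pd i F w).re :=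
    fun i w => pd_clm Complex.reCLM (hFd w)
  have hdim : ∀ i w, pd i (fun w => (F w).im) w = (pd i F w).im :=
    fun i w => pd_clm Complex.imCLM (hFd w)
  have hsre : SmoothNear (fun w => (F w).re) 0 := (hF.smoothNear 0).clm Complex.reCLM
  have hsim : SmoothNear (fun w => (F w).im) 0 := (hF.smoothNear 0).clm Complex.imCLM
  have hdre' : ∀ w, DifferentiableAt ℝ (fun w => (F w).re) w :=
    fun w => Complex.reCLM.differentiableAt.comp w (hFd w)
  have hdim' : ∀ w, DifferentiableAt ℝ (fun w => (F w).im) w :=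
    fun w => Complex.imCLM.differentiableAt.comp w (hFd w)
  have hdx : ∀ i w, pd i (fun w => b⁻¹ * (F w).im) w = b⁻¹ * (pd i F w).im :=
    fun i w => by rw [pd_const_mul _ (hdim' w), hdim]
  have hdy : ∀ i w, pd i (fun w => (F w).re - a * b⁻¹ * (F w).im) w =
      (pd i F w).re - a * b⁻¹ * (pd i F w).im :=
    fun i w => by
      rw [pd_sub (hdre' w) ((hdim' w).const_mul _), pd_const_mul _ (hdim' w), hdre, hdim]
  change pd 0 F 0 ≠ 0 at hF0
  replace hFσ : ∀ᶠ x in 𝓝 0, pd 1 F x = σ x * pd 0 F x := hFσ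
  refine ⟨_, _, hsim.const_mul b⁻¹, hsre.sub (hsim.const_mul (a * b⁻¹)), ?_, ?_⟩
  · rw [hdx, hdx, hdy, hdy, hFσ.self_of_nhds, Complex.mul_re, Complex.mul_im]
    intro hcon
    field_simp at hcon
    have h1 : (σ 0).im * ((pd 0 F 0).re * (pd 0 F 0).re + (pd 0 F 0).im * (pd 0 F 0).im) = 0 := by
      refine mul_left_cancel₀ hb ?_
      linear_combination -hcon
    rcases mul_eq_zero.1 h1 with h | h
    · exact hσ0 h
    · rw [← Complex.normSq_apply, Complex.normSq_eq_zero] at h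
      exact hF0 h
  · have hFu : ∀ᶠ w in 𝓝 0, pd 0 F w ≠ 0 :=
      ((hF.smoothNear 0).pd 0).continuousAt.eventually_ne hF0
    filter_upwards [hσn, tendsto_planeProj.eventually hFσ, tendsto_planeProj.eventually hFu]
      with z h1 h2 h3
    rw [hdx, hdx, hdy, hdy]
    generalize planeProj z = w at *
    set h : ℂ := n f₁ g₁ z / pd 0 F w with hh
    have e1 : n f₁ g₁ z = h * pd 0 F w := (div_mul_cancel₀ _ h3).symm
    have e2 : n f₂ g₂ z = h * pd 1 F w := by rw [h1, h2, e1]; ring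
    have r1 := congrArg Complex.re e1
    have i1 := congrArg Complex.im e1
    have r2 := congrArg Complex.re e2
    have i2 := congrArg Complex.im e2
    rw [Complex.mul_re, hre] at r1 r2
    rw [Complex.mul_im, him] at i1 i2
    have hb1 : b⁻¹ * b = 1 := inv_mul_cancel₀ hb
    have key : ∀ f g A B : ℝ, g - a * f = h.re * A - h.im * B → -b * f = h.re * B + h.im * A →
        f = -b⁻¹ * h.im * (A - a * b⁻¹ * B) + (-a * b⁻¹ * h.im - h.re) * (b⁻¹ * B) ∧
        g = (c * (-b⁻¹ * h.im) - (-a * b⁻¹ * h.im - h.re)) * (A - a * b⁻¹ * B) +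
          ε * (-b⁻¹ * h.im) * (b⁻¹ * B) := by
      intro f g A B hr hi
      have hf : f = -b⁻¹ * (h.re * B + h.im * A) := by
        linear_combination (-b⁻¹) * hi - f * hb1
      have hg : g = a * f + (h.re * A - h.im * B) := by linear_combination hr
      rw [hg, hf, hc, he]
      constructor
      · field_simp; ring
      · field_simp; ring
    -- Real and imaginary parts of h = (a - ib) m - l, solved for m and l.
    refine ⟨-b⁻¹ * h.im, -a * b⁻¹ * h.im - h.re, ?_⟩
    obtain ⟨k1, k3⟩ := key _ _ _ _ r1 i1
    obtain ⟨k2, k4⟩ := key _ _ _ _ r2 i2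
    exact ⟨k1, k2, k3, k4⟩

/-- A balanced pair with constant generating invariant admits normalizing planar functions. -/
theorem IsBalancedPlanar.exists_isNormalizing (H : IsBalancedPlanar ε c f₁ f₂ g₁ g₂) :
    ∃ x y : E2 → ℝ, IsNormalizing ε c f₁ f₂ g₁ g₂ x y := by
  -- Sign of the discriminant of κ² - cκ + ε.
  rcases lt_trichotomy (c ^ 2) (4 * ε) with h | h | h
  · have h0 : 0 < ε - (c / 2) ^ 2 := by nlinarith
    refine H.exists_isNormalizing_of_lt (a := c / 2) (b := √(ε - (c / 2) ^ 2))
      (Real.sqrt_pos.2 h0).ne' (by ring) ?_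
    rw [Real.sq_sqrt h0.le]; ring
  · exact H.exists_isNormalizing_of_double (κ := c / 2) (by ring) (by linarith)
  · have h0 : 0 < (c / 2) ^ 2 - ε := by nlinarith
    have hs := Real.sq_sqrt h0.le
    have hp := Real.sqrt_pos.2 h0
    refine H.exists_isNormalizing_of_ne (κ₁ := c / 2 + √((c / 2) ^ 2 - ε))
      (κ₂ := c / 2 - √((c / 2) ^ 2 - ε)) ?_ ?_ (by intro hh; linarith)
    · linear_combination hs
    · linear_combination hs

end BalancedPlanar

/-! ### From normalizing functions to the coordinates (x, y, p) -/

section NormalForm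

variable {ε c : ℝ} {f₁ f₂ g₁ g₂ : E3 → ℝ} {x y : E2 → ℝ}

/-- Normalizing functions are preserved by linear changes of coordinates that commute with the
normal form. -/
theorem IsNormalizing.linearChange (H : IsNormalizing ε c f₁ f₂ g₁ g₂ x y) {r s Δ : ℝ}
    (hΔ : Δ ≠ 0) (hrs : Δ = s ^ 2 + c * s * r + ε * r ^ 2) :
    IsNormalizing ε c f₁ f₂ g₁ g₂
      (fun w => (s + r * c) / Δ * x w +
        r / Δ * y w)
      (fun w => -(r * ε) / Δ * x w +
        s / Δ * y w) ∧
    ∀ a b m l : ℝ,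
      m * a + l * b = (s * m + r * (c * m - l)) * (-(r * ε) / Δ * b +
        s / Δ * a) +
        (s * l + r * ε * m) * ((s + r * c) / Δ * b +
        r / Δ * a) := by
  -- The coefficients of α' arise from those of α by J(m, l) = (cm - l, εm), and J² - cJ + ε = 0.
  -- The change s + rJ commutes with J and has determinant Δ.
  have hd : ∀ (j k : ℝ) i, ∀ᶠ w in 𝓝 0, pd i (fun w => j * x w + k * y w) w =
      j * pd i x w + k * pd i y w := by
    intro j k i
    filter_upwards [H.smooth_x.differentiableAt, H.smooth_y.differentiableAt] with w h1 h2
    rw [pd_add (h1.const_mul _) (h2.const_mul _), pd_const_mul _ h1, pd_const_mul _ h2]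
  have hform : ∀ a b m l : ℝ,
      m * a + l * b = (s * m + r * (c * m - l)) * (-(r * ε) / Δ * b +
        s / Δ * a) +
        (s * l + r * ε * m) * ((s + r * c) / Δ * b +
        r / Δ * a) := by
    intro a b m l
    field_simp
    linear_combination (m * a + l * b) * hrs
  have hform' : ∀ a b m l : ℝ, (c * m - l) * a + ε * m * b =
      (c * (s * m + r * (c * m - l)) - (s * l + r * ε * m)) *
        (-(r * ε) / Δ * b +
        s / Δ * a) +
        ε * (s * m + r * (c * m - l)) * ((s + r * c) / Δ * b +
        r / Δ * a) := by
    intro a b m l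
    field_simp
    linear_combination ((c * m - l) * a + ε * m * b) * hrs
  refine ⟨⟨(H.smooth_x.const_mul _).add (H.smooth_y.const_mul _),
    (H.smooth_x.const_mul _).add (H.smooth_y.const_mul _), ?_, ?_⟩, hform⟩
  · rw [(hd _ _ 0).self_of_nhds, (hd _ _ 1).self_of_nhds, (hd _ _ 0).self_of_nhds,
      (hd _ _ 1).self_of_nhds]
    intro hcon
    refine H.jacobian ?_
    field_simp at hcon
    refine mul_left_cancel₀ hΔ ?_
    linear_combination hcon + (pd 0 x 0 * pd 1 y 0 - pd 1 x 0 * pd 0 y 0) * hrs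
  · filter_upwards [H.normal, tendsto_planeProj.eventually (hd _ _ 0),
      tendsto_planeProj.eventually (hd _ _ 1), tendsto_planeProj.eventually (hd _ _ 0),
      tendsto_planeProj.eventually (hd _ _ 1)] with z ⟨m, l, h1, h2, h3, h4⟩ e1 e2 e3 e4
    rw [e1, e2, e3, e4]
    exact ⟨s * m + r * (c * m - l), s * l + r * ε * m, h1.trans (hform _ _ _ _),
      h2.trans (hform _ _ _ _), h3.trans (hform' _ _ _ _), h4.trans (hform' _ _ _ _)⟩

/-- Normalizing functions can be chosen such that the leading coefficients do not vanish. -/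
theorem IsBalancedPlanar.exists_isNormalizing_ne_zero (H : IsBalancedPlanar ε c f₁ f₂ g₁ g₂)
    (hε : ε = 1 ∨ ε = -1) :
    ∃ x y : E2 → ℝ, IsNormalizing ε c f₁ f₂ g₁ g₂ x y ∧ ∀ m l : ℝ,
      f₁ 0 = m * pd 0 y 0 + l * pd 0 x 0 → f₂ 0 = m * pd 1 y 0 + l * pd 1 x 0 →
      m ≠ 0 ∧ c * m - l ≠ 0 := by
  obtain ⟨x, y, hxy⟩ := H.exists_isNormalizing
  have huniq : ∀ {x y : E2 → ℝ}, IsNormalizing ε c f₁ f₂ g₁ g₂ x y → ∀ {m l m' l' : ℝ},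
      f₁ 0 = m * pd 0 y 0 + l * pd 0 x 0 → f₂ 0 = m * pd 1 y 0 + l * pd 1 x 0 →
      f₁ 0 = m' * pd 0 y 0 + l' * pd 0 x 0 → f₂ 0 = m' * pd 1 y 0 + l' * pd 1 x 0 →
      m' = m ∧ l' = l := by
    intro x y h m l m' l' h1 h2 h3 h4
    constructor
    · refine mul_right_cancel₀ h.jacobian ?_
      linear_combination pd 0 x 0 * (h2 - h4) - pd 1 x 0 * (h1 - h3)
    · refine mul_right_cancel₀ h.jacobian ?_
      linear_combination pd 1 y 0 * (h1 - h3) - pd 0 y 0 * (h2 - h4)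
  obtain ⟨m, l, h1, h2, h3, h4⟩ := hxy.normal.self_of_nhds
  rw [map_zero] at h1 h2 h3 h4
  by_cases hml : m ≠ 0 ∧ c * m - l ≠ 0
  · refine ⟨x, y, hxy, fun m' l' h1' h2' => ?_⟩
    obtain ⟨rfl, rfl⟩ := huniq hxy h1 h2 h1' h2'
    exact hml
  · have hQ : ε * m ^ 2 - c * l * m + l ^ 2 ≠ 0 := by
      intro hQ
      refine H.indep ?_
      rw [h1, h2, h3, h4]
      linear_combination (pd 0 y 0 * pd 1 x 0 - pd 1 y 0 * pd 0 x 0) * hQ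
    -- Take r = 1 and s = |c| + 2. If m = 0, the new values of m and cm - l are -l and -(s + c) l;
    -- if l = cm, they are sm and -εm. This s is large enough for s, s + c and Δ all to be positive.
    have hs1 : 0 < |c| + 2 := by positivity
    have hs2 : 2 ≤ |c| + 2 + c := by linarith [neg_abs_le c]
    have hε0 : ε ≠ 0 := by rcases hε with h | h <;> rw [h] <;> norm_num
    have hΔ : (|c| + 2) ^ 2 + c * (|c| + 2) * 1 + ε * 1 ^ 2 ≠ 0 := by
      have : 0 < (|c| + 2) * (|c| + 2 + c) - 1 := by nlinarith [abs_nonneg c]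
      have hε1 : -1 ≤ ε := by rcases hε with h | h <;> rw [h]; norm_num
      nlinarith
    obtain ⟨hN, hform⟩ := hxy.linearChange hΔ rfl
    refine ⟨_, _, hN, fun m' l' h1' h2' => ?_⟩
    have hd : ∀ (j k : ℝ) i, pd i (fun w => j * x w + k * y w) 0 =
        j * pd i x 0 + k * pd i y 0 := by
      intro j k i
      have h1 := hxy.smooth_x.differentiableAt.self_of_nhds
      have h2 := hxy.smooth_y.differentiableAt.self_of_nhds
      rw [pd_add (h1.const_mul _) (h2.const_mul _), pd_const_mul _ h1, pd_const_mul _ h2]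
    obtain ⟨rfl, rfl⟩ := huniq hN (m := (|c| + 2) * m + 1 * (c * m - l))
      (l := (|c| + 2) * l + 1 * ε * m)
      (by rw [hd, hd]; exact h1.trans (hform _ _ _ _))
      (by rw [hd, hd]; exact h2.trans (hform _ _ _ _)) h1' h2'
    rw [not_and_or, not_not, not_not] at hml
    rcases hml with rfl | hml
    · have hl : l ≠ 0 := by rintro rfl; exact hQ (by ring)
      constructor
      · rw [show (|c| + 2) * 0 + 1 * (c * 0 - l) = -l by ring]
        exact neg_ne_zero.2 hl
      · rw [show c * ((|c| + 2) * 0 + 1 * (c * 0 - l)) - ((|c| + 2) * l + 1 * ε * 0) =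
          -((|c| + 2 + c) * l) by ring]
        exact neg_ne_zero.2 (mul_ne_zero (by linarith) hl)
    · obtain rfl : l = c * m := by linarith
      have hm : m ≠ 0 := by rintro rfl; exact hQ (by ring)
      constructor
      · rw [sub_self, mul_zero, add_zero]
        exact mul_ne_zero hs1.ne' hm
      · rw [show c * ((|c| + 2) * m + 1 * (c * m - c * m)) - ((|c| + 2) * (c * m) + 1 * ε * m) =
          -(ε * m) by ring]
        exact neg_ne_zero.2 (mul_ne_zero hε0 hm)

/-- Since x and y do not depend on the third coordinate, the derivative is block triangular with
diagonal blocks the planar Jacobian and ∂p/∂w. -/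
theorem exists_isLocalDiffeo_of_jacobian_ne_zero {p : E3 → ℝ} (hx : SmoothNear x 0)
    (hy : SmoothNear y 0) (hp : SmoothNear p 0)
    (hJ : pd 0 x 0 * pd 1 y 0 - pd 1 x 0 * pd 0 y 0 ≠ 0) (hdp : pd 2 p 0 ≠ 0) :
    ∃ Θ : OpenPartialHomeomorph E3 E3, 0 ∈ Θ.source ∧
      (∀ z, Θ z = !₂[x (planeProj z), y (planeProj z), p z]) ∧
      (∀ z ∈ Θ.source, ContDiffAt ℝ ∞ Θ z) ∧ (∀ z ∈ Θ.target, ContDiffAt ℝ ∞ Θ.symm z) ∧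
      ∀ᶠ z in 𝓝 0, ∀ v : E3,
        fderiv ℝ Θ z v 0 = v 0 * pd 0 x (planeProj z) + v 1 * pd 1 x (planeProj z) ∧
        fderiv ℝ Θ z v 1 = v 0 * pd 0 y (planeProj z) + v 1 * pd 1 y (planeProj z) := by
  let T : E3 → E3 := fun z => !₂[x (planeProj z), y (planeProj z), p z]
  have hT0 : ∀ z, T z 0 = x (planeProj z) := fun z => rfl
  have hT1 : ∀ z, T z 1 = y (planeProj z) := fun z => rfl
  have hT2 : ∀ z, T z 2 = p z := fun z => rfl
  have hTs : SmoothNear T 0 := by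
    filter_upwards [hx.comp_planeProj, hy.comp_planeProj, hp] with z h1 h2 h3
    rw [contDiffAt_euclidean]
    intro i
    fin_cases i
    · exact h1
    · exact h2
    · exact h3
  have hcomp : ∀ i, ∀ᶠ z in 𝓝 0, ∀ v : E3, fderiv ℝ T z v i = fderiv ℝ (fun z => T z i) z v := by
    intro i
    filter_upwards [hTs.differentiableAt] with z hz v
    have h := ((EuclideanSpace.proj i : E3 →L[ℝ] ℝ).hasFDerivAt.comp z hz.hasFDerivAt).fderiv
    change _ = fderiv ℝ ((EuclideanSpace.proj i : E3 →L[ℝ] ℝ) ∘ T) z v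
    rw [h]
    rfl
  have hT : ∀ᶠ z in 𝓝 0, ∀ v : E3,
      fderiv ℝ T z v 0 = v 0 * pd 0 x (planeProj z) + v 1 * pd 1 x (planeProj z) ∧
      fderiv ℝ T z v 1 = v 0 * pd 0 y (planeProj z) + v 1 * pd 1 y (planeProj z) := by
    filter_upwards [hcomp 0, hcomp 1, tendsto_planeProj.eventually hx.differentiableAt,
      tendsto_planeProj.eventually hy.differentiableAt] with z h0 h1 h2 h3 v
    rw [h0, h1]
    constructor
    · exact (fderiv_comp_planeProj h2 v).trans (clm_apply_eq_pd _)
    · exact (fderiv_comp_planeProj h3 v).trans (clm_apply_eq_pd _)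
  have hinj : Function.Injective (fderiv ℝ T 0 : E3 →ₗ[ℝ] E3) := by
    rw [← LinearMap.ker_eq_bot, LinearMap.ker_eq_bot']
    intro v hv
    change fderiv ℝ T 0 v = 0 at hv
    obtain ⟨h0, h1⟩ := hT.self_of_nhds v
    have h2 := (hcomp 2).self_of_nhds v
    rw [hv, map_zero] at h0 h1
    rw [hv] at h2
    change 0 = _ at h0
    change 0 = _ at h1
    change 0 = _ at h2
    have hv0 : v 0 = 0 := by
      refine (mul_eq_zero.1 (?_ : v 0 * _ = 0)).resolve_right hJ
      linear_combination pd 1 x 0 * h1 - pd 1 y 0 * h0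
    have hv1 : v 1 = 0 := by
      refine (mul_eq_zero.1 (?_ : v 1 * _ = 0)).resolve_right hJ
      linear_combination pd 0 y 0 * h0 - pd 0 x 0 * h1
    have hv' : v = v 2 • EuclideanSpace.single 2 1 := by
      ext i; fin_cases i <;> simp [hv0, hv1]
    rw [hv', map_smul] at h2
    have hv2 : v 2 = 0 := (mul_eq_zero.1 h2.symm).resolve_right hdp
    rw [hv', hv2, zero_smul]
  let L := (LinearEquiv.ofInjectiveEndo (fderiv ℝ T 0 : E3 →ₗ[ℝ] E3) hinj).toContinuousLinearEquiv
  have hL : HasFDerivAt T (L : E3 →L[ℝ] E3) 0 := by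
    have h : (L : E3 →L[ℝ] E3) = fderiv ℝ T 0 := by ext1 v; rfl
    rw [h]
    exact hTs.differentiableAt.self_of_nhds.hasFDerivAt
  obtain ⟨Θ, h0, hΘ, hs, -, hs'⟩ := exists_smooth_local_inverse hTs L hL
  have hΘT : (Θ : E3 → E3) = T := funext hΘ
  refine ⟨Θ, h0, hΘ, ?_, hs', ?_⟩
  · rwa [hΘT]
  · rwa [hΘT]

/-- The normal form of a balanced pair with constant generating invariant, annihilating the third
coordinate direction. -/
theorem IsBalancedPlanar.exists_normalForm (H : IsBalancedPlanar ε c f₁ f₂ g₁ g₂)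
    (hε : ε = 1 ∨ ε = -1) :
    ∃ Θ : OpenPartialHomeomorph E3 E3, 0 ∈ Θ.source ∧
      (∀ z ∈ Θ.source, ContDiffAt ℝ ∞ Θ z) ∧ (∀ z ∈ Θ.target, ContDiffAt ℝ ∞ Θ.symm z) ∧
      ∀ᶠ z in 𝓝 0, ∃ m : ℝ, m ≠ 0 ∧ Θ z 2 + c ≠ 0 ∧ ∀ v : E3,
        f₁ z * v 0 + f₂ z * v 1 = m * (fderiv ℝ Θ z v 1 - Θ z 2 * fderiv ℝ Θ z v 0) ∧
        g₁ z * v 0 + g₂ z * v 1 = m * ((Θ z 2 + c) * fderiv ℝ Θ z v 1 +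
          ε * fderiv ℝ Θ z v 0) := by
  obtain ⟨x, y, N, hne⟩ := H.exists_isNormalizing_ne_zero hε
  have hxu := (N.smooth_x.pd 0).comp_planeProj
  have hxv := (N.smooth_x.pd 1).comp_planeProj
  have hyu := (N.smooth_y.pd 0).comp_planeProj
  have hyv := (N.smooth_y.pd 1).comp_planeProj
  have hJs := (hxu.mul hyv).sub (hxv.mul hyu)
  have hJ0 : pd 0 x (planeProj 0) * pd 1 y (planeProj 0) -
      pd 1 x (planeProj 0) * pd 0 y (planeProj 0) ≠ 0 := by
    rw [map_zero]; exact N.jacobian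
  let m : E3 → ℝ := fun z => (pd 0 x (planeProj z) * f₂ z - pd 1 x (planeProj z) * f₁ z) /
    (pd 0 x (planeProj z) * pd 1 y (planeProj z) - pd 1 x (planeProj z) * pd 0 y (planeProj z))
  let l : E3 → ℝ := fun z => (pd 1 y (planeProj z) * f₁ z - pd 0 y (planeProj z) * f₂ z) /
    (pd 0 x (planeProj z) * pd 1 y (planeProj z) - pd 1 x (planeProj z) * pd 0 y (planeProj z))
  have hm : SmoothNear m 0 := ((hxu.mul H.smooth_f₂).sub (hxv.mul H.smooth_f₁)).div hJs hJ0
  have hl : SmoothNear l 0 := ((hyv.mul H.smooth_f₁).sub (hyu.mul H.smooth_f₂)).div hJs hJ0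
  have hnf : ∀ᶠ z in 𝓝 0,
      f₁ z = m z * pd 0 y (planeProj z) + l z * pd 0 x (planeProj z) ∧
      f₂ z = m z * pd 1 y (planeProj z) + l z * pd 1 x (planeProj z) ∧
      g₁ z = (c * m z - l z) * pd 0 y (planeProj z) + ε * m z * pd 0 x (planeProj z) ∧
      g₂ z = (c * m z - l z) * pd 1 y (planeProj z) + ε * m z * pd 1 x (planeProj z) := by
    filter_upwards [N.normal, hJs.continuousAt.eventually_ne hJ0] with z ⟨m', l', h1, h2, h3, h4⟩ hJ
    have e1 : m z = m' := by
      simp only [m]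
      rw [div_eq_iff hJ, h1, h2]; ring
    have e2 : l z = l' := by
      simp only [l]
      rw [div_eq_iff hJ, h1, h2]; ring
    rw [e1, e2]
    exact ⟨h1, h2, h3, h4⟩
  have hnf0 := hnf.self_of_nhds
  rw [map_zero] at hnf0
  obtain ⟨hm0, hml0⟩ := hne _ _ hnf0.1 hnf0.2.1
  have hp : SmoothNear (fun z => -l z / m z) 0 := hl.neg.div hm hm0
  have hmne := hm.continuousAt.eventually_ne hm0
  have hmlne := (((SmoothNear.const c 0).mul hm).sub hl).continuousAt.eventually_ne hml0
  -- Write f = m (dy - p dx) with dx, dy constant along the third coordinate. If p had zero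
  -- derivative there, ∂f/∂w would be parallel to f and the contact Wronskian would vanish.
  have hdp : pd 2 (fun z => -l z / m z) 0 ≠ 0 := by
    intro hdp
    refine H.nondeg.self_of_nhds ?_
    have hd : ∀ {w : E2 → ℝ}, SmoothNear w 0 → SmoothNear (fun z => w (planeProj z)) 0 →
        pd 2 (fun z => w (planeProj z)) 0 = 0 := fun hw _ =>
      pd_two_comp_planeProj (by rw [map_zero]; exact hw.differentiableAt.self_of_nhds)
    have key : ∀ {f : E3 → ℝ} {a b : E2 → ℝ}, SmoothNear a 0 → SmoothNear b 0 →
        (∀ᶠ z in 𝓝 0, f z = m z * a (planeProj z) + l z * b (planeProj z)) →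
        pd 2 f 0 = pd 2 m 0 * (a 0 - -l 0 / m 0 * b 0) := by
      intro f a b ha hb hf
      have ha' := ha.comp_planeProj
      have hb' := hb.comp_planeProj
      have h1 : f =ᶠ[𝓝 0] fun z => m z * (a (planeProj z) - -l z / m z * b (planeProj z)) := by
        filter_upwards [hf, hmne] with z hz hmz
        rw [hz]; field_simp; ring
      rw [pd_congr h1, pd_mul hm.differentiableAt.self_of_nhds
        (ha'.sub (hp.mul hb')).differentiableAt.self_of_nhds,
        pd_sub ha'.differentiableAt.self_of_nhds (hp.mul hb').differentiableAt.self_of_nhds,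
        pd_mul hp.differentiableAt.self_of_nhds hb'.differentiableAt.self_of_nhds, hdp,
        hd ha ha', hd hb hb', map_zero]
      ring
    rw [key (N.smooth_y.pd 0) (N.smooth_x.pd 0) (hnf.mono fun _ h => h.1),
      key (N.smooth_y.pd 1) (N.smooth_x.pd 1) (hnf.mono fun _ h => h.2.1), hnf0.1, hnf0.2.1]
    field_simp
    ring
  obtain ⟨Θ, h0, hΘ, hs, hs', hd⟩ :=
    exists_isLocalDiffeo_of_jacobian_ne_zero N.smooth_x N.smooth_y hp N.jacobian hdp
  refine ⟨Θ, h0, hs, hs', ?_⟩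
  filter_upwards [hnf, hmne, hmlne, hd] with z ⟨h1, h2, h3, h4⟩ hmz hmlz hdz
  have hΘ2 : Θ z 2 = -l z / m z := by rw [hΘ]; rfl
  refine ⟨m z, hmz, ?_, fun v => ?_⟩
  · rw [hΘ2]
    intro hcon
    refine hmlz ?_
    field_simp at hcon
    linear_combination hcon
  · obtain ⟨e0, e1⟩ := hdz v
    rw [hΘ2, e0, e1, h1, h2, h3, h4]
    constructor <;> field_simp <;> ring

end NormalForm

/-! ### One-forms on the model space -/

section Forms

/-- The exterior derivative of a one-form on the model space. -/
noncomputable def extD (A : E3 → E3 →L[ℝ] ℝ) (z v w : E3) : ℝ :=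
  fderiv ℝ A z v w - fderiv ℝ A z w v

/-- The wedge product of a one-form and the exterior derivative of a one-form. -/
noncomputable def wedgeExtD (A B : E3 → E3 →L[ℝ] ℝ) (z u v w : E3) : ℝ :=
  A z u * extD B z v w + A z v * extD B z w u + A z w * extD B z u v

theorem eq_sum_single (v : E3) : v = v 0 • EuclideanSpace.single 0 1 +
    v 1 • EuclideanSpace.single 1 1 + v 2 • EuclideanSpace.single 2 1 := by
  ext i; fin_cases i <;> simp

theorem clm_apply_eq_sum (L : E3 →L[ℝ] ℝ) (v : E3) :
    L v = v 0 * L (EuclideanSpace.single 0 1) + v 1 * L (EuclideanSpace.single 1 1) +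
      v 2 * L (EuclideanSpace.single 2 1) := by
  conv_lhs => rw [eq_sum_single v]
  simp

theorem extD_eq_sum (A : E3 → E3 →L[ℝ] ℝ) (z v w : E3) :
    extD A z v w =
      (v 0 * w 1 - v 1 * w 0) * extD A z (EuclideanSpace.single 0 1) (EuclideanSpace.single 1 1) +
      (v 1 * w 2 - v 2 * w 1) * extD A z (EuclideanSpace.single 1 1) (EuclideanSpace.single 2 1) +
      (v 2 * w 0 - v 0 * w 2) * extD A z (EuclideanSpace.single 2 1) (EuclideanSpace.single 0 1) := by
  have h : ∀ v w : E3, fderiv ℝ A z v w =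
      v 0 * fderiv ℝ A z (EuclideanSpace.single 0 1) w +
      v 1 * fderiv ℝ A z (EuclideanSpace.single 1 1) w +
      v 2 * fderiv ℝ A z (EuclideanSpace.single 2 1) w := by
    intro v w
    conv_lhs => rw [eq_sum_single v]
    simp
  simp only [extD]
  rw [h v w, h w v]
  simp only [clm_apply_eq_sum _ v, clm_apply_eq_sum _ w]
  ring

/-- The determinant of three vectors. -/
def det₃ (u v w : E3) : ℝ :=
  u 0 * (v 1 * w 2 - v 2 * w 1) + u 1 * (v 2 * w 0 - v 0 * w 2) + u 2 * (v 0 * w 1 - v 1 * w 0)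

/-- Space of 3-forms in dimension three is a line: all identities between them reduce to their
values on the standard frame. -/
theorem wedgeExtD_eq_det (A B : E3 → E3 →L[ℝ] ℝ) (z u v w : E3) :
    wedgeExtD A B z u v w = det₃ u v w * wedgeExtD A B z (EuclideanSpace.single 0 1)
      (EuclideanSpace.single 1 1) (EuclideanSpace.single 2 1) := by
  simp only [wedgeExtD, det₃]
  rw [extD_eq_sum B z v w, extD_eq_sum B z w u, extD_eq_sum B z u v, clm_apply_eq_sum (A z) u,
    clm_apply_eq_sum (A z) v, clm_apply_eq_sum (A z) w]
  ring

/-- The pullback of a one-form. -/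
noncomputable def pullbackForm (φ : E3 → E3) (A : E3 → E3 →L[ℝ] ℝ) (x : E3) : E3 →L[ℝ] ℝ :=
  (A (φ x)).comp (fderiv ℝ φ x)

/-- The second derivative of φ enters symmetrically and cancels on antisymmetrizing. -/
theorem extD_pullbackForm {φ : E3 → E3} {A : E3 → E3 →L[ℝ] ℝ} {x : E3} (hφ : ContDiffAt ℝ ∞ φ x)
    (hA : DifferentiableAt ℝ A (φ x)) (v w : E3) :
    extD (pullbackForm φ A) x v w = extD A (φ x) (fderiv ℝ φ x v) (fderiv ℝ φ x w) := by
  have h1 : HasFDerivAt φ (fderiv ℝ φ x) x := (hφ.differentiableAt (by simp)).hasFDerivAt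
  have h2 : HasFDerivAt (fderiv ℝ φ) (fderiv ℝ (fderiv ℝ φ) x) x :=
    ((hφ.fderiv_right (m := ∞) (by simp)).differentiableAt (by simp)).hasFDerivAt
  have h3 := ((hA.hasFDerivAt.comp x h1).clm_comp h2).fderiv
  have hsymm := (hφ.isSymmSndFDerivAt
    (by simpa using ENat.LEInfty.out)) v w
  have h4 : ∀ v w, fderiv ℝ (pullbackForm φ A) x v w =
      A (φ x) (fderiv ℝ (fderiv ℝ φ) x v w) +
        fderiv ℝ A (φ x) (fderiv ℝ φ x v) (fderiv ℝ φ x w) := by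
    intro v w
    change fderiv ℝ (fun x => ((A ∘ φ) x).comp (fderiv ℝ φ x)) x v w = _
    rw [h3]
    rfl
  simp only [extD]
  rw [h4, h4, hsymm]
  ring

theorem wedgeExtD_pullbackForm {φ : E3 → E3} {A B : E3 → E3 →L[ℝ] ℝ} {x : E3}
    (hφ : ContDiffAt ℝ ∞ φ x) (hB : DifferentiableAt ℝ B (φ x)) (u v w : E3) :
    wedgeExtD (pullbackForm φ A) (pullbackForm φ B) x u v w =
      wedgeExtD A B (φ x) (fderiv ℝ φ x u) (fderiv ℝ φ x v) (fderiv ℝ φ x w) := by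
  simp only [wedgeExtD, extD_pullbackForm hφ hB]
  rfl

theorem SmoothNear.pullbackForm {φ : E3 → E3} {A : E3 → E3 →L[ℝ] ℝ} {x y : E3}
    (hφ : SmoothNear φ x) (hA : SmoothNear A y) (hy : φ x = y) :
    SmoothNear (pullbackForm φ A) x := by
  filter_upwards [hA.comp hφ hy, hφ] with z h1 h2
  exact h1.clm_comp (h2.fderiv_right (m := ∞) (by simp))

theorem fderiv_clm_apply_const {A : E3 → E3 →L[ℝ] ℝ} {z : E3} (hA : DifferentiableAt ℝ A z)
    (v w : E3) : fderiv ℝ (fun z => A z w) z v = fderiv ℝ A z v w := by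
  rw [(hA.hasFDerivAt.clm_apply (hasFDerivAt_const w z)).fderiv]
  simp

/-- If `A` and `B` annihilate the third coordinate direction, then `A ∧ dB` is a Wronskian. -/
theorem wedgeExtD_eq_wronskian {A B : E3 → E3 →L[ℝ] ℝ} {z : E3} (hB : DifferentiableAt ℝ B z)
    (hA2 : A z (EuclideanSpace.single 2 1) = 0)
    (hB2 : ∀ᶠ z in 𝓝 z, B z (EuclideanSpace.single 2 1) = 0) :
    wedgeExtD A B z (EuclideanSpace.single 0 1) (EuclideanSpace.single 1 1)
      (EuclideanSpace.single 2 1) =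
    -(A z (EuclideanSpace.single 0 1) * pd 2 (fun z => B z (EuclideanSpace.single 1 1)) z -
      A z (EuclideanSpace.single 1 1) * pd 2 (fun z => B z (EuclideanSpace.single 0 1)) z) := by
  have h : ∀ v, fderiv ℝ B z v (EuclideanSpace.single 2 1) = 0 := by
    intro v
    rw [← fderiv_clm_apply_const hB]
    have h' : (fun z => B z (EuclideanSpace.single 2 1)) =ᶠ[𝓝 z] fun _ => (0 : ℝ) := hB2
    rw [h'.fderiv_eq]
    simp
  simp only [wedgeExtD, extD, pd, h, hA2, fderiv_clm_apply_const hB]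
  ring

/-- A balanced, transverse pair of contact forms with constant generating invariant near `p`. -/
structure IsBalancedPair (ε c : ℝ) (A A' : E3 → E3 →L[ℝ] ℝ) (p : E3) : Prop where
  smooth : SmoothNear A p
  smooth' : SmoothNear A' p
  nondeg : ∀ᶠ z in 𝓝 p, wedgeExtD A A z (EuclideanSpace.single 0 1) (EuclideanSpace.single 1 1)
    (EuclideanSpace.single 2 1) ≠ 0
  balanced : ∀ᶠ z in 𝓝 p, wedgeExtD A' A' z (EuclideanSpace.single 0 1)
    (EuclideanSpace.single 1 1) (EuclideanSpace.single 2 1) =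
    ε * wedgeExtD A A z (EuclideanSpace.single 0 1) (EuclideanSpace.single 1 1)
    (EuclideanSpace.single 2 1)
  invariant : ∀ᶠ z in 𝓝 p, wedgeExtD A A' z (EuclideanSpace.single 0 1)
    (EuclideanSpace.single 1 1) (EuclideanSpace.single 2 1) + wedgeExtD A' A z
    (EuclideanSpace.single 0 1) (EuclideanSpace.single 1 1) (EuclideanSpace.single 2 1) =
    c * wedgeExtD A A z (EuclideanSpace.single 0 1) (EuclideanSpace.single 1 1)
    (EuclideanSpace.single 2 1)
  indep : ∃ u v, A p u * A' p v - A p v * A' p u ≠ 0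

variable {ε c : ℝ} {A A' : E3 → E3 →L[ℝ] ℝ} {p : E3}

theorem det₃_ne_zero (g : E3 ≃L[ℝ] E3) : det₃ (g (EuclideanSpace.single 0 1))
    (g (EuclideanSpace.single 1 1)) (g (EuclideanSpace.single 2 1)) ≠ 0 := by
  have key : ∀ u v w : E3, det₃ (g u) (g v) (g w) = det₃ u v w *
      det₃ (g (EuclideanSpace.single 0 1)) (g (EuclideanSpace.single 1 1))
        (g (EuclideanSpace.single 2 1)) := by
    intro u v w
    have h : ∀ i (u : E3), g u i = u 0 * g (EuclideanSpace.single 0 1) i +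
        u 1 * g (EuclideanSpace.single 1 1) i + u 2 * g (EuclideanSpace.single 2 1) i := fun i u =>
      clm_apply_eq_sum ((EuclideanSpace.proj i : E3 →L[ℝ] ℝ).comp (g : E3 →L[ℝ] E3)) u
    simp only [det₃]
    rw [h 0 u, h 1 u, h 2 u, h 0 v, h 1 v, h 2 v, h 0 w, h 1 w, h 2 w]
    ring
  intro h
  have h1 := key (g.symm (EuclideanSpace.single 0 1)) (g.symm (EuclideanSpace.single 1 1))
    (g.symm (EuclideanSpace.single 2 1))
  rw [h, mul_zero] at h1
  simp [det₃] at h1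

/-- All the 3-forms involved are multiplied by the same nonzero Jacobian determinant, so their
ratios are unchanged. -/
theorem IsBalancedPair.pullback (H : IsBalancedPair ε c A A' p) {φ : E3 → E3} {x : E3}
    (hφ : SmoothNear φ x) (hx : φ x = p)
    (hinv : ∀ᶠ z in 𝓝 x, ∃ g : E3 ≃L[ℝ] E3, HasFDerivAt φ (g : E3 →L[ℝ] E3) z) :
    IsBalancedPair ε c (pullbackForm φ A) (pullbackForm φ A') x := by
  have ht : Filter.Tendsto φ (𝓝 x) (𝓝 p) := hx ▸ hφ.continuousAt.tendsto
  have key : ∀ {B C : E3 → E3 →L[ℝ] ℝ}, SmoothNear C p → ∀ᶠ z in 𝓝 x,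
      wedgeExtD (pullbackForm φ B) (pullbackForm φ C) z (EuclideanSpace.single 0 1)
        (EuclideanSpace.single 1 1) (EuclideanSpace.single 2 1) =
      det₃ (fderiv ℝ φ z (EuclideanSpace.single 0 1)) (fderiv ℝ φ z (EuclideanSpace.single 1 1))
        (fderiv ℝ φ z (EuclideanSpace.single 2 1)) *
      wedgeExtD B C (φ z) (EuclideanSpace.single 0 1) (EuclideanSpace.single 1 1)
        (EuclideanSpace.single 2 1) := by
    intro B C hC
    filter_upwards [hφ, ht.eventually hC.differentiableAt] with z h1 h2
    rw [wedgeExtD_pullbackForm h1 h2, wedgeExtD_eq_det]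
  refine ⟨hφ.pullbackForm H.smooth hx, hφ.pullbackForm H.smooth' hx, ?_, ?_, ?_, ?_⟩
  · filter_upwards [key H.smooth, ht.eventually H.nondeg, hinv] with z h1 h2 ⟨g, hg⟩
    rw [h1, hg.fderiv]
    exact mul_ne_zero (det₃_ne_zero g) h2
  · filter_upwards [key (B := A) H.smooth, key (B := A') H.smooth', ht.eventually H.balanced]
      with z h1 h2 h3
    rw [h1, h2, h3]; ring
  · filter_upwards [key (B := A) H.smooth, key (B := A) H.smooth', key (B := A') H.smooth,
      ht.eventually H.invariant] with z h1 h2 h3 h4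
    rw [h1, h2, h3, ← mul_add, h4]; ring
  · obtain ⟨u, v, h⟩ := H.indep
    obtain ⟨g, hg⟩ := hinv.self_of_nhds
    refine ⟨g.symm u, g.symm v, ?_⟩
    simp only [_root_.pullbackForm, hg.fderiv, hx, ContinuousLinearMap.comp_apply]
    simpa using h

/-- The axis of a pair of one-forms: the cross product of their coefficient vectors. -/
noncomputable def axisField (A A' : E3 → E3 →L[ℝ] ℝ) (z : E3) : E3 :=
  !₂[A z (EuclideanSpace.single 1 1) * A' z (EuclideanSpace.single 2 1) -
      A z (EuclideanSpace.single 2 1) * A' z (EuclideanSpace.single 1 1),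
    A z (EuclideanSpace.single 2 1) * A' z (EuclideanSpace.single 0 1) -
      A z (EuclideanSpace.single 0 1) * A' z (EuclideanSpace.single 2 1),
    A z (EuclideanSpace.single 0 1) * A' z (EuclideanSpace.single 1 1) -
      A z (EuclideanSpace.single 1 1) * A' z (EuclideanSpace.single 0 1)]

theorem apply_axisField (z : E3) : A z (axisField A A' z) = 0 ∧ A' z (axisField A A' z) = 0 := by
  rw [clm_apply_eq_sum, clm_apply_eq_sum (A' z)]
  constructor <;> simp [axisField] <;> ring

theorem SmoothNear.axisField (h : SmoothNear A p) (h' : SmoothNear A' p) :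
    SmoothNear (axisField A A') p := by
  filter_upwards [h, h'] with z h1 h2
  have e1 : ∀ v, ContDiffAt ℝ ∞ (fun z => A z v) z := fun v => h1.clm_apply contDiffAt_const
  have e2 : ∀ v, ContDiffAt ℝ ∞ (fun z => A' z v) z := fun v => h2.clm_apply contDiffAt_const
  rw [contDiffAt_euclidean]
  intro i
  fin_cases i
  · exact ((e1 _).mul (e2 _)).sub ((e1 _).mul (e2 _))
  · exact ((e1 _).mul (e2 _)).sub ((e1 _).mul (e2 _))
  · exact ((e1 _).mul (e2 _)).sub ((e1 _).mul (e2 _))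

theorem axisField_ne_zero (h : ∃ u v, A p u * A' p v - A p v * A' p u ≠ 0) :
    axisField A A' p ≠ 0 := by
  obtain ⟨u, v, h⟩ := h
  intro h0
  apply h
  have h1 := congrArg (fun w : E3 => w 0) h0
  have h2 := congrArg (fun w : E3 => w 1) h0
  have h3 := congrArg (fun w : E3 => w 2) h0
  simp [axisField] at h1 h2 h3
  rw [clm_apply_eq_sum (A p) u, clm_apply_eq_sum (A p) v, clm_apply_eq_sum (A' p) v,
    clm_apply_eq_sum (A' p) u]
  linear_combination (u 1 * v 2 - u 2 * v 1) * h1 + (u 2 * v 0 - u 0 * v 2) * h2 +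
    (u 0 * v 1 - u 1 * v 0) * h3

/-- Every 3-form becomes minus a Wronskian, and the common sign drops out of the relations. -/
theorem IsBalancedPair.isBalancedPlanar (H : IsBalancedPair ε c A A' 0)
    (hA : ∀ᶠ z in 𝓝 0, A z (EuclideanSpace.single 2 1) = 0)
    (hA' : ∀ᶠ z in 𝓝 0, A' z (EuclideanSpace.single 2 1) = 0) :
    IsBalancedPlanar ε c (fun z => A z (EuclideanSpace.single 0 1))
      (fun z => A z (EuclideanSpace.single 1 1)) (fun z => A' z (EuclideanSpace.single 0 1))
      (fun z => A' z (EuclideanSpace.single 1 1)) := by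
  have hs : ∀ {B : E3 → E3 →L[ℝ] ℝ} (v : E3), SmoothNear B 0 → SmoothNear (fun z => B z v) 0 := by
    intro B v hB
    filter_upwards [hB] with z hz using hz.clm_apply contDiffAt_const
  have key : ∀ {B C : E3 → E3 →L[ℝ] ℝ}, SmoothNear C 0 →
      (∀ᶠ z in 𝓝 0, B z (EuclideanSpace.single 2 1) = 0) →
      (∀ᶠ z in 𝓝 0, C z (EuclideanSpace.single 2 1) = 0) →
      ∀ᶠ z in 𝓝 0, wedgeExtD B C z (EuclideanSpace.single 0 1) (EuclideanSpace.single 1 1)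
        (EuclideanSpace.single 2 1) =
      -(B z (EuclideanSpace.single 0 1) * pd 2 (fun z => C z (EuclideanSpace.single 1 1)) z -
      B z (EuclideanSpace.single 1 1) * pd 2 (fun z => C z (EuclideanSpace.single 0 1)) z) := by
    intro B C hC hB2 hC2
    filter_upwards [hC.differentiableAt, hB2, hC2.eventually_nhds] with z h1 h2 h3
    exact wedgeExtD_eq_wronskian h1 h2 h3
  refine ⟨hs _ H.smooth, hs _ H.smooth, hs _ H.smooth', hs _ H.smooth', ?_, ?_, ?_, ?_⟩
  · filter_upwards [H.nondeg, key H.smooth hA hA] with z h1 h2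
    rw [h2] at h1
    exact neg_ne_zero.1 h1
  · filter_upwards [H.balanced, key H.smooth hA hA, key H.smooth' hA' hA'] with z h1 h2 h3
    linear_combination h3 - ε * h2 - h1
  · filter_upwards [H.invariant, key H.smooth hA hA, key H.smooth hA' hA, key H.smooth' hA hA']
      with z h1 h2 h3 h4
    linear_combination h3 + h4 - c * h2 - h1
  · obtain ⟨u, v, h⟩ := H.indep
    intro h0
    apply h
    rw [clm_apply_eq_sum (A 0) u, clm_apply_eq_sum (A 0) v, clm_apply_eq_sum (A' 0) v,
      clm_apply_eq_sum (A' 0) u, hA.self_of_nhds, hA'.self_of_nhds]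
    linear_combination (u 0 * v 1 - u 1 * v 0) * h0

/-- The local normal form of a balanced pair with constant generating invariant. -/
theorem IsBalancedPair.exists_normalForm (H : IsBalancedPair ε c A A' p) (hε : ε = 1 ∨ ε = -1) :
    ∃ Ψ : OpenPartialHomeomorph E3 E3, p ∈ Ψ.source ∧
      (∀ z ∈ Ψ.source, ContDiffAt ℝ ∞ Ψ z) ∧ (∀ z ∈ Ψ.target, ContDiffAt ℝ ∞ Ψ.symm z) ∧
      ∀ z ∈ Ψ.source, ∃ m : ℝ, m ≠ 0 ∧ Ψ z 2 + c ≠ 0 ∧ ∀ v : E3,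
        A z v = m * (fderiv ℝ Ψ z v 1 - Ψ z 2 * fderiv ℝ Ψ z v 0) ∧
        A' z v = m * ((Ψ z 2 + c) * fderiv ℝ Ψ z v 1 + ε * fderiv ℝ Ψ z v 0) := by
  -- Straightening the axis to the third coordinate direction makes both pulled-back forms
  -- annihilate that direction.
  obtain ⟨e, he0, hep, hes, hes', hed, hev⟩ := exists_flowBox (H.smooth.axisField H.smooth')
    (axisField_ne_zero H.indep) (w := (EuclideanSpace.single 2 1 : E3)) (by simp)
  have hsrc := e.open_source.mem_nhds he0
  have hs0 : SmoothNear e 0 := by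
    filter_upwards [hsrc] with z hz using hes z hz
  have H' := H.pullback hs0 hep (by filter_upwards [hsrc] with z hz using hed z hz)
  have hB : ∀ᶠ z in 𝓝 0, pullbackForm e A z (EuclideanSpace.single 2 1) = 0 := by
    filter_upwards [hev] with z hz
    rw [pullbackForm, ContinuousLinearMap.comp_apply, hz]
    exact (apply_axisField _).1
  have hB' : ∀ᶠ z in 𝓝 0, pullbackForm e A' z (EuclideanSpace.single 2 1) = 0 := by
    filter_upwards [hev] with z hz
    rw [pullbackForm, ContinuousLinearMap.comp_apply, hz]
    exact (apply_axisField _).2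
  obtain ⟨Θ, hΘ0, hΘs, hΘs', hΘ⟩ := (H'.isBalancedPlanar hB hB').exists_normalForm hε
  have hpt : p ∈ e.target := hep ▸ e.map_source he0
  have hsymm0 : e.symm p = 0 := by
    have h := e.left_inv he0
    rwa [hep] at h
  have hst : Filter.Tendsto e.symm (𝓝 p) (𝓝 0) := by
    have := (hes' p hpt).continuousAt.tendsto
    rwa [hsymm0] at this
  have hfin : ∀ᶠ z in 𝓝 p, ∃ m : ℝ, m ≠ 0 ∧ (e.symm.trans Θ) z 2 + c ≠ 0 ∧ ∀ v : E3,
        A z v = m * (fderiv ℝ (e.symm.trans Θ) z v 1 -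
          (e.symm.trans Θ) z 2 * fderiv ℝ (e.symm.trans Θ) z v 0) ∧
        A' z v = m * (((e.symm.trans Θ) z 2 + c) * fderiv ℝ (e.symm.trans Θ) z v 1 +
          ε * fderiv ℝ (e.symm.trans Θ) z v 0) := by
    filter_upwards [e.open_target.mem_nhds hpt, hst.eventually hΘ, hst.eventually hB,
      hst.eventually hB', hst.eventually (Θ.open_source.mem_nhds hΘ0)]
      with z hz ⟨m, hm, hmc, h⟩ hb hb' hzΘ
    refine ⟨m, hm, hmc, fun v => ?_⟩
    obtain ⟨g, hg⟩ := hed _ (e.map_target hz)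
    have hd := e.hasFDerivAt_symm hz hg
    have hΨ : fderiv ℝ (e.symm.trans Θ) z v = fderiv ℝ Θ (e.symm z) (g.symm v) := by
      rw [OpenPartialHomeomorph.coe_trans,
        (((hΘs _ hzΘ).differentiableAt (by simp)).hasFDerivAt.comp z hd).fderiv]
      rfl
    have hpb : ∀ B : E3 → E3 →L[ℝ] ℝ, B z v = pullbackForm e B (e.symm z) (g.symm v) := by
      intro B
      rw [pullbackForm, ContinuousLinearMap.comp_apply, hg.fderiv, e.right_inv hz]
      simp
    rw [hΨ, hpb A, hpb A', clm_apply_eq_sum, clm_apply_eq_sum (pullbackForm e A' _), hb, hb']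
    obtain ⟨h1, h2⟩ := h (g.symm v)
    constructor
    · refine Eq.trans ?_ h1
      ring
    · refine Eq.trans ?_ h2
      ring
  obtain ⟨S, hS, hSo, hpS⟩ := eventually_nhds_iff.1 hfin
  have hpΘ : p ∈ (e.symm.trans Θ).source := by
    rw [OpenPartialHomeomorph.trans_source]
    exact ⟨hpt, by rw [Set.mem_preimage, hsymm0]; exact hΘ0⟩
  refine ⟨(e.symm.trans Θ).restrOpen S hSo, ⟨hpΘ, hpS⟩, ?_, ?_, fun z hz => hS z hz.2⟩
  · rintro z ⟨hz, -⟩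
    rw [OpenPartialHomeomorph.trans_source] at hz
    exact (hΘs _ hz.2).comp z (hes' z hz.1)
  · intro z hz
    have h3 : z ∈ (e.symm.trans Θ).target := hz.1
    rw [OpenPartialHomeomorph.trans_target] at h3
    exact (hes _ h3.2).comp z (hΘs' z h3.1)

end Forms

/-! ### Coordinate expressions of forms on a manifold -/

section Charts

theorem extDeriv_ofSubsingleton {B : E3 → E3 →L[ℝ] ℝ} {z : E3} (hB : DifferentiableAt ℝ B z)
    (v w : E3) :
    extDeriv (fun z => ContinuousAlternatingMap.ofSubsingleton ℝ E3 ℝ (0 : Fin 1) (B z)) z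
      ![v, w] = extD B z v w := by
  have h : DifferentiableAt ℝ
      (fun z => ContinuousAlternatingMap.ofSubsingleton ℝ E3 ℝ (0 : Fin 1) (B z)) z :=
    (ContinuousAlternatingMap.ofSubsingletonLIE (𝕜 := ℝ) (E := E3) (F := ℝ)
      (0 : Fin 1)).toContinuousLinearEquiv.differentiableAt.comp z hB
  rw [extDeriv_apply h, Fin.sum_univ_two]
  simp [Fin.removeNth, extD, fderiv_clm_apply_const hB]
  ring

theorem wedgeExtD_congr {A A' B B' : E3 → E3 →L[ℝ] ℝ} {z : E3} (hA : A z = A' z)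
    (hB : B =ᶠ[𝓝 z] B') (u v w : E3) : wedgeExtD A B z u v w = wedgeExtD A' B' z u v w := by
  simp only [wedgeExtD, extD, hA, hB.fderiv_eq]

theorem ContDiffAt.wedgeExtD {A B : E3 → E3 →L[ℝ] ℝ} {z : E3} (hA : ContDiffAt ℝ ∞ A z)
    (hB : ContDiffAt ℝ ∞ B z) (u v w : E3) :
    ContDiffAt ℝ ∞ (fun z => wedgeExtD A B z u v w) z := by
  have h1 : ∀ v, ContDiffAt ℝ ∞ (fun z => A z v) z := fun v => hA.clm_apply contDiffAt_const
  have h2 : ∀ v w, ContDiffAt ℝ ∞ (fun z => extD B z v w) z := fun v w =>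
    (((hB.fderiv_right (m := ∞) (by simp)).clm_apply contDiffAt_const).clm_apply
      contDiffAt_const).sub
    (((hB.fderiv_right (m := ∞) (by simp)).clm_apply contDiffAt_const).clm_apply contDiffAt_const)
  exact (((h1 u).mul (h2 v w)).add ((h1 v).mul (h2 w u))).add ((h1 w).mul (h2 u v))

/-- The term in dk contributes k B ∧ dk ∧ B = 0. Hence rescaling by a square root adjusts the volume
form at will. -/
theorem wedgeExtD_smul_self {B : E3 → E3 →L[ℝ] ℝ} {k : E3 → ℝ} {z : E3}
    (hk : DifferentiableAt ℝ k z) (hB : DifferentiableAt ℝ B z) (u v w : E3) :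
    wedgeExtD (fun z => k z • B z) (fun z => k z • B z) z u v w =
      k z ^ 2 * wedgeExtD B B z u v w := by
  have h : ∀ v w, fderiv ℝ (fun z => k z • B z) z v w =
      k z * fderiv ℝ B z v w + fderiv ℝ k z v * B z w := by
    intro v w
    rw [fderiv_fun_smul hk hB]
    simp
  simp only [wedgeExtD, extD, h, smul_apply, smul_eq_mul]
  ring

theorem det₃_smul (r : ℝ) (u v w : E3) : det₃ (r • u) v w = r * det₃ u v w := by
  simp [det₃]
  ring

/-- Contracting the standard volume form with the cross product gives A ∧ A'; so the field defined
by i_Z (α ∧ dα) = α ∧ α' is a multiple of the axis field. -/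
theorem det₃_axisField (A A' : E3 → E3 →L[ℝ] ℝ) (z u v : E3) :
    det₃ (axisField A A' z) u v = A z u * A' z v - A z v * A' z u := by
  rw [clm_apply_eq_sum (A z) u, clm_apply_eq_sum (A z) v, clm_apply_eq_sum (A' z) v,
    clm_apply_eq_sum (A' z) u]
  simp [axisField, det₃]
  ring

variable {M : Type*} [TopologicalSpace M] [ChartedSpace E3 M]

/-- The differential at `m` of the preferred chart at `a`. -/
noncomputable def chartD (a m : M) : TangentSpace 𝓘(ℝ, E3) m →L[ℝ] E3 :=
  mfderiv 𝓘(ℝ, E3) 𝓘(ℝ, E3) (extChartAt 𝓘(ℝ, E3) a) m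

theorem dForm_eq_extD {γ : ∀ m : M, TangentSpace 𝓘(ℝ, E3) m →L[ℝ] ℝ} {m : M}
    (h : DifferentiableAt ℝ (formInChart γ m) (extChartAt 𝓘(ℝ, E3) m m))
    (v w : TangentSpace 𝓘(ℝ, E3) m) :
    dForm γ m v w = extD (formInChart γ m) (extChartAt 𝓘(ℝ, E3) m m) (chartD m m v)
      (chartD m m w) := by
  rw [dForm]
  exact extDeriv_ofSubsingleton h _ _

/-- The change of coordinates from the preferred chart at `a` to the preferred chart at `b`. -/
noncomputable def transition (a b : M) : E3 → E3 :=
  extChartAt 𝓘(ℝ, E3) b ∘ (extChartAt 𝓘(ℝ, E3) a).symm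

theorem transition_apply {a b m : M} (ha : m ∈ (chartAt E3 a).source) :
    transition a b (extChartAt 𝓘(ℝ, E3) a m) = extChartAt 𝓘(ℝ, E3) b m := by
  rw [transition, Function.comp_apply, (extChartAt 𝓘(ℝ, E3) a).left_inv (by simpa using ha)]

theorem extChartAt_target_mem_nhds_model {a m : M} (ha : m ∈ (chartAt E3 a).source) :
    (extChartAt 𝓘(ℝ, E3) a).target ∈ 𝓝 (extChartAt 𝓘(ℝ, E3) a m) :=
  (isOpen_extChartAt_target a).mem_nhds
    ((extChartAt 𝓘(ℝ, E3) a).map_source (by simpa using ha))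

theorem tendsto_extChartAt_symm {a m : M} (ha : m ∈ (chartAt E3 a).source) :
    Filter.Tendsto (extChartAt 𝓘(ℝ, E3) a).symm (𝓝 (extChartAt 𝓘(ℝ, E3) a m)) (𝓝 m) := by
  have h := continuousAt_extChartAt_symm' (I := 𝓘(ℝ, E3)) (x := a) (x' := m) (by simpa using ha)
  have h' := h.tendsto
  rwa [(extChartAt 𝓘(ℝ, E3) a).left_inv (by simpa using ha)] at h'

theorem continuousAt_extChartAt_model {a m : M} (ha : m ∈ (chartAt E3 a).source) :
    ContinuousAt (extChartAt 𝓘(ℝ, E3) a) m :=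
  continuousAt_extChartAt' (by simpa using ha)

variable [IsManifold 𝓘(ℝ, E3) ∞ M]

theorem contDiffAt_transition {a b m : M} (ha : m ∈ (chartAt E3 a).source)
    (hb : m ∈ (chartAt E3 b).source) :
    ContDiffAt ℝ ∞ (transition a b) (extChartAt 𝓘(ℝ, E3) a m) := by
  have h := contDiffWithinAt_ext_coord_change (I := 𝓘(ℝ, E3)) (n := ∞) b a
    (y := extChartAt 𝓘(ℝ, E3) a m) (by
      rw [PartialEquiv.trans_source]
      refine ⟨(extChartAt 𝓘(ℝ, E3) a).map_source (by simpa using ha), ?_⟩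
      rw [Set.mem_preimage, (extChartAt 𝓘(ℝ, E3) a).left_inv (by simpa using ha)]
      simpa using hb)
  simpa [transition, contDiffWithinAt_univ] using h

theorem mfderiv_extChartAt_symm_chartD {a m : M} (ha : m ∈ (chartAt E3 a).source)
    (v : TangentSpace 𝓘(ℝ, E3) m) :
    (mfderiv 𝓘(ℝ, E3) 𝓘(ℝ, E3) (extChartAt 𝓘(ℝ, E3) a).symm (extChartAt 𝓘(ℝ, E3) a m)
      (chartD a m v) : E3) = v := by
  have h := mfderivWithin_extChartAt_symm_comp_mfderiv_extChartAt' (I := 𝓘(ℝ, E3)) (x := a)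
    (y := m) (by simpa using ha)
  have h' := DFunLike.congr_fun h v
  simp only [modelWithCornersSelf_coe, Set.range_id, mfderivWithin_univ] at h'
  exact h'

theorem chartD_mfderiv_extChartAt_symm {a m : M} (ha : m ∈ (chartAt E3 a).source) (v : E3) :
    chartD a m (mfderiv 𝓘(ℝ, E3) 𝓘(ℝ, E3) (extChartAt 𝓘(ℝ, E3) a).symm (extChartAt 𝓘(ℝ, E3) a m)
      v : E3) = v := by
  have h := mfderiv_extChartAt_comp_mfderivWithin_extChartAt_symm' (I := 𝓘(ℝ, E3)) (x := a)
    (y := m) (by simpa using ha)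
  have h' := DFunLike.congr_fun h v
  simp only [modelWithCornersSelf_coe, Set.range_id, mfderivWithin_univ] at h'
  exact h'

theorem chartD_surjective {a m : M} (ha : m ∈ (chartAt E3 a).source) :
    Function.Surjective (chartD a m) := fun v => ⟨_, chartD_mfderiv_extChartAt_symm ha v⟩

theorem fderiv_transition_chartD {a b m : M} (ha : m ∈ (chartAt E3 a).source)
    (hb : m ∈ (chartAt E3 b).source) (v : TangentSpace 𝓘(ℝ, E3) m) :
    fderiv ℝ (transition a b) (extChartAt 𝓘(ℝ, E3) a m) (chartD a m v) = chartD b m v := by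
  have h1 : chartD b m = mfderiv 𝓘(ℝ, E3) 𝓘(ℝ, E3)
      (transition a b ∘ extChartAt 𝓘(ℝ, E3) a) m := by
    refine Filter.EventuallyEq.mfderiv_eq ?_
    filter_upwards [(chartAt E3 a).open_source.mem_nhds ha] with x hx
    exact (transition_apply hx).symm
  have h2 : MDifferentiableAt 𝓘(ℝ, E3) 𝓘(ℝ, E3) (transition a b) (extChartAt 𝓘(ℝ, E3) a m) :=
    ((contDiffAt_transition ha hb).differentiableAt (by simp)).mdifferentiableAt
  rw [h1, mfderiv_comp m h2 (mdifferentiableAt_extChartAt ha), mfderiv_eq_fderiv]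
  rfl

variable (α γ : ∀ m : M, TangentSpace 𝓘(ℝ, E3) m →L[ℝ] ℝ)

theorem formInChart_chartD {a m : M} (ha : m ∈ (chartAt E3 a).source)
    (v : TangentSpace 𝓘(ℝ, E3) m) :
    formInChart α a (extChartAt 𝓘(ℝ, E3) a m) (chartD a m v) = α m v := by
  have h : ∀ (x : M), x = m → ∀ w : E3, w = v → (α x : E3 →L[ℝ] ℝ) w = α m v := by
    rintro x rfl w rfl; rfl
  exact h _ ((extChartAt 𝓘(ℝ, E3) a).left_inv (by simpa using ha)) _
    (mfderiv_extChartAt_symm_chartD ha v)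

theorem formInChart_eq_pullbackForm {a b m : M} (ha : m ∈ (chartAt E3 a).source)
    (hb : m ∈ (chartAt E3 b).source) :
    formInChart α a (extChartAt 𝓘(ℝ, E3) a m) =
      pullbackForm (transition a b) (formInChart α b) (extChartAt 𝓘(ℝ, E3) a m) := by
  ext v
  obtain ⟨u, rfl⟩ := chartD_surjective ha v
  rw [pullbackForm, ContinuousLinearMap.comp_apply, fderiv_transition_chartD ha hb,
    transition_apply ha, formInChart_chartD α ha, formInChart_chartD α hb]

theorem formInChart_eventuallyEq {a b m : M} (ha : m ∈ (chartAt E3 a).source)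
    (hb : m ∈ (chartAt E3 b).source) :
    formInChart α a =ᶠ[𝓝 (extChartAt 𝓘(ℝ, E3) a m)]
      pullbackForm (transition a b) (formInChart α b) := by
  filter_upwards [extChartAt_target_mem_nhds_model ha,
    (tendsto_extChartAt_symm ha).eventually ((chartAt E3 b).open_source.mem_nhds hb)] with z hz hzb
  have h := formInChart_eq_pullbackForm α (a := a) (m := (extChartAt 𝓘(ℝ, E3) a).symm z)
    (by simpa using (extChartAt 𝓘(ℝ, E3) a).map_target hz) hzb
  rwa [(extChartAt 𝓘(ℝ, E3) a).right_inv hz] at h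

variable {α γ}

/-- Smoothness of a form is tested at each point in that point's own chart; this transfers it to one
fixed chart. -/
theorem contDiffAt_formInChart {a b m : M} (ha : m ∈ (chartAt E3 a).source)
    (hb : m ∈ (chartAt E3 b).source)
    (h : ContDiffAt ℝ ∞ (formInChart α b) (extChartAt 𝓘(ℝ, E3) b m)) :
    ContDiffAt ℝ ∞ (formInChart α a) (extChartAt 𝓘(ℝ, E3) a m) := by
  refine ContDiffAt.congr_of_eventuallyEq ?_ (formInChart_eventuallyEq α ha hb)
  have h1 := contDiffAt_transition ha hb
  rw [← transition_apply ha] at h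
  exact (h.comp _ h1).clm_comp (h1.fderiv_right (m := ∞) (by simp))

theorem wedgeD_eq_wedgeExtD_self {m : M}
    (h : DifferentiableAt ℝ (formInChart γ m) (extChartAt 𝓘(ℝ, E3) m m))
    (u v w : TangentSpace 𝓘(ℝ, E3) m) :
    wedgeD α γ m u v w = wedgeExtD (formInChart α m) (formInChart γ m)
      (extChartAt 𝓘(ℝ, E3) m m) (chartD m m u) (chartD m m v) (chartD m m w) := by
  simp only [wedgeD, wedgeExtD, dForm_eq_extD h, formInChart_chartD α (mem_chart_source E3 m)]

/-- The value of `α ∧ dγ` in terms of coordinate expressions in an arbitrary preferred chart. -/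
theorem wedgeD_eq_wedgeExtD {a m : M} (ha : m ∈ (chartAt E3 a).source)
    (h : ContDiffAt ℝ ∞ (formInChart γ a) (extChartAt 𝓘(ℝ, E3) a m))
    (u v w : TangentSpace 𝓘(ℝ, E3) m) :
    wedgeD α γ m u v w = wedgeExtD (formInChart α a) (formInChart γ a)
      (extChartAt 𝓘(ℝ, E3) a m) (chartD a m u) (chartD a m v) (chartD a m w) := by
  have hm := mem_chart_source E3 m
  have h' := (contDiffAt_formInChart hm ha h).differentiableAt (by simp)
  rw [wedgeD_eq_wedgeExtD_self h', wedgeExtD_congr (formInChart_eq_pullbackForm α hm ha)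
    (formInChart_eventuallyEq γ hm ha), wedgeExtD_pullbackForm (contDiffAt_transition hm ha)
    (by rw [transition_apply hm]; exact h.differentiableAt (by simp)), transition_apply hm,
    fderiv_transition_chartD hm ha, fderiv_transition_chartD hm ha, fderiv_transition_chartD hm ha]

end Charts

/-! ### Balanced forms -/

section Balanced

variable {M : Type*} [TopologicalSpace M] [ChartedSpace E3 M]
  {ε : ℝ} {ξ ξ' : ∀ m : M, Submodule ℝ (TangentSpace 𝓘(ℝ, E3) m)}
  {α α' : ∀ m : M, TangentSpace 𝓘(ℝ, E3) m →L[ℝ] ℝ} {U V : Set M}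

theorem IsContactForm.mono (h : IsContactForm ξ α U) (hV : V ⊆ U) : IsContactForm ξ α V :=
  ⟨fun m hm => h.smooth m (hV hm), fun m hm => h.ker_eq m (hV hm), fun m hm => h.nondeg m (hV hm)⟩

theorem IsContactForm.apply_ne_zero (h : IsContactForm ξ α U) {m : M} (hm : m ∈ U) :
    ∃ v, α m v ≠ 0 := by
  by_contra! h0
  refine h.nondeg m hm ?_
  funext u v w
  simp [wedgeD, h0]

/-- By transversality, a vector off ker α may be taken in ker α' and vice versa; on this pair α ∧ α'
is a product of nonzero values. -/
theorem IsContactForm.exists_indep (h : IsContactForm ξ α U) (h' : IsContactForm ξ' α' U) {m : M}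
    (hm : m ∈ U) (ht : ξ m ⊔ ξ' m = ⊤) : ∃ u v, α m u * α' m v - α m v * α' m u ≠ 0 := by
  obtain ⟨w, hw⟩ := h.apply_ne_zero hm
  obtain ⟨w', hw'⟩ := h'.apply_ne_zero hm
  obtain ⟨a, ha, b, hb, rfl⟩ := Submodule.mem_sup.1 (ht ▸ Submodule.mem_top : w ∈ ξ m ⊔ ξ' m)
  obtain ⟨a', ha', b', hb', rfl⟩ := Submodule.mem_sup.1 (ht ▸ Submodule.mem_top : w' ∈ ξ m ⊔ ξ' m)
  rw [h.ker_eq m hm] at ha ha'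
  rw [h'.ker_eq m hm] at hb hb'
  rw [map_add, ha, zero_add] at hw
  rw [map_add, hb', add_zero] at hw'
  exact ⟨b, a', by rw [ha', hb, zero_mul, sub_zero]; exact mul_ne_zero hw hw'⟩

/-- Points near a given point in a chart come from points of a given neighbourhood. -/
theorem eventually_exists_extChartAt_eq {a : M} (hU : U ∈ 𝓝 a) :
    ∀ᶠ z in 𝓝 (extChartAt 𝓘(ℝ, E3) a a), ∃ m ∈ U, m ∈ (chartAt E3 a).source ∧
      extChartAt 𝓘(ℝ, E3) a m = z := by
  filter_upwards [extChartAt_target_mem_nhds_model (mem_chart_source E3 a),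
    (tendsto_extChartAt_symm (mem_chart_source E3 a)).eventually hU] with z hz hzU
  exact ⟨_, hzU, by simpa using (extChartAt 𝓘(ℝ, E3) a).map_target hz,
    (extChartAt 𝓘(ℝ, E3) a).right_inv hz⟩

variable [IsManifold 𝓘(ℝ, E3) ∞ M]

theorem IsContactForm.contDiffAt (h : IsContactForm ξ α U) {a m : M} (hm : m ∈ U)
    (ha : m ∈ (chartAt E3 a).source) :
    ContDiffAt ℝ ∞ (formInChart α a) (extChartAt 𝓘(ℝ, E3) a m) :=
  contDiffAt_formInChart ha (mem_chart_source E3 m) (h.smooth m hm)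

theorem IsContactForm.wedgeExtD_ne_zero (h : IsContactForm ξ α U) {a m : M} (hm : m ∈ U)
    (ha : m ∈ (chartAt E3 a).source) :
    wedgeExtD (formInChart α a) (formInChart α a) (extChartAt 𝓘(ℝ, E3) a m)
      (EuclideanSpace.single 0 1) (EuclideanSpace.single 1 1) (EuclideanSpace.single 2 1) ≠ 0 := by
  intro h0
  refine h.nondeg m hm ?_
  funext u v w
  rw [wedgeD_eq_wedgeExtD ha (h.contDiffAt hm ha), wedgeExtD_eq_det, h0, mul_zero]
  rfl

theorem IsContactForm.exists_indep_formInChart (h : IsContactForm ξ α U)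
    (h' : IsContactForm ξ' α' U) {a m : M} (hm : m ∈ U) (ha : m ∈ (chartAt E3 a).source)
    (ht : ξ m ⊔ ξ' m = ⊤) :
    ∃ u v, formInChart α a (extChartAt 𝓘(ℝ, E3) a m) u *
      formInChart α' a (extChartAt 𝓘(ℝ, E3) a m) v -
      formInChart α a (extChartAt 𝓘(ℝ, E3) a m) v *
      formInChart α' a (extChartAt 𝓘(ℝ, E3) a m) u ≠ 0 := by
  obtain ⟨u, v, huv⟩ := h.exists_indep h' hm ht
  refine ⟨chartD a m u, chartD a m v, ?_⟩
  rwa [formInChart_chartD α ha, formInChart_chartD α ha, formInChart_chartD α' ha,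
    formInChart_chartD α' ha]

/-- The coordinate expressions of balanced forms with constant generating invariant. -/
theorem IsBalanced.isBalancedPair {X : ∀ m : M, TangentSpace 𝓘(ℝ, E3) m} {c : ℝ}
    (h : IsBalanced ε ξ ξ' X α α' U) (hε : ε = 1 ∨ ε = -1) {a : M} (hU : U ∈ 𝓝 a)
    (ht : ξ a ⊔ ξ' a = ⊤)
    (hc : ∀ m ∈ U, wedgeD α α' m + wedgeD α' α m = c • wedgeD α α m) :
    IsBalancedPair ε c (formInChart α a) (formInChart α' a) (extChartAt 𝓘(ℝ, E3) a a) := by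
  have hev := eventually_exists_extChartAt_eq hU
  have hε2 : ε * ε = 1 := by rcases hε with h | h <;> rw [h] <;> norm_num
  have key : ∀ {β γ : ∀ m : M, TangentSpace 𝓘(ℝ, E3) m →L[ℝ] ℝ} {m : M},
      m ∈ (chartAt E3 a).source →
      ContDiffAt ℝ ∞ (formInChart γ a) (extChartAt 𝓘(ℝ, E3) a m) → ∀ u v w : E3,
      ∀ u' v' w', chartD a m u' = u → chartD a m v' = v → chartD a m w' = w →
      wedgeExtD (formInChart β a) (formInChart γ a) (extChartAt 𝓘(ℝ, E3) a m) u v w =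
        wedgeD β γ m u' v' w' := by
    rintro β γ m ha hγ _ _ _ u' v' w' rfl rfl rfl
    exact (wedgeD_eq_wedgeExtD ha hγ u' v' w').symm
  refine ⟨?_, ?_, ?_, ?_, ?_, ?_⟩
  · filter_upwards [hev] with z ⟨m, hm, hma, hz⟩
    exact hz ▸ h.contact.contDiffAt hm hma
  · filter_upwards [hev] with z ⟨m, hm, hma, hz⟩
    exact hz ▸ h.contact'.contDiffAt hm hma
  · filter_upwards [hev] with z ⟨m, hm, hma, hz⟩
    exact hz ▸ h.contact.wedgeExtD_ne_zero hm hma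
  · filter_upwards [hev] with z ⟨m, hm, hma, hz⟩
    obtain ⟨u, hu⟩ := chartD_surjective hma (EuclideanSpace.single 0 1)
    obtain ⟨v, hv⟩ := chartD_surjective hma (EuclideanSpace.single 1 1)
    obtain ⟨w, hw⟩ := chartD_surjective hma (EuclideanSpace.single 2 1)
    rw [← hz, key hma (h.contact'.contDiffAt hm hma) _ _ _ _ _ _ hu hv hw,
      key hma (h.contact.contDiffAt hm hma) _ _ _ _ _ _ hu hv hw, h.balanced m hm]
    simp only [Pi.smul_apply, smul_eq_mul]
    rw [← mul_assoc, hε2, one_mul]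
  · filter_upwards [hev] with z ⟨m, hm, hma, hz⟩
    obtain ⟨u, hu⟩ := chartD_surjective hma (EuclideanSpace.single 0 1)
    obtain ⟨v, hv⟩ := chartD_surjective hma (EuclideanSpace.single 1 1)
    obtain ⟨w, hw⟩ := chartD_surjective hma (EuclideanSpace.single 2 1)
    rw [← hz, key hma (h.contact'.contDiffAt hm hma) _ _ _ _ _ _ hu hv hw,
      key hma (h.contact.contDiffAt hm hma) _ _ _ _ _ _ hu hv hw,
      key hma (h.contact.contDiffAt hm hma) _ _ _ _ _ _ hu hv hw]
    have := congrFun (congrFun (congrFun (hc m hm) u) v) w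
    simpa using this
  · exact h.contact.exists_indep_formInChart h.contact' (mem_of_mem_nhds hU)
      (mem_chart_source E3 a) ht

/-- Near a, the differential of the fixed chart is the fibre part of the trivialization of the
tangent bundle at a, in which a continuous section has continuous components. -/
theorem continuousAt_chartD {X : ∀ m : M, TangentSpace 𝓘(ℝ, E3) m} (a : M)
    (hX : Continuous (fun m : M => (⟨m, X m⟩ : TangentBundle 𝓘(ℝ, E3) M))) :
    ContinuousAt (fun m => chartD a m (X m)) a := by
  have h1 := (FiberBundle.continuousAt_totalSpace E3 (E := TangentSpace 𝓘(ℝ, E3))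
    (f := fun m : M => (⟨m, X m⟩ : TangentBundle 𝓘(ℝ, E3) M)) (x₀ := a)).1 hX.continuousAt
  refine h1.2.congr ?_
  filter_upwards [(chartAt E3 a).open_source.mem_nhds (mem_chart_source E3 a)] with m hm
  have h2 := TangentBundle.continuousLinearMapAt_trivializationAt (I := 𝓘(ℝ, E3)) hm
  have h3 := DFunLike.congr_fun h2 (X m)
  refine Eq.trans ?_ h3
  exact (Bundle.Trivialization.continuousLinearMapAt_apply_of_mem ℝ _ (by simpa using hm) _).symm

/-- Balanced contact forms exist around every point. -/
theorem IsTransverseContactPair.exists_isBalanced (hpair : IsTransverseContactPair ε ξ ξ')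
    (hε : ε = 1 ∨ ε = -1) {X : ∀ m : M, TangentSpace 𝓘(ℝ, E3) m} (hX : OrientsAxis ξ ξ' X)
    (a : M) : ∃ (U : Set M) (α α' : ∀ m : M, TangentSpace 𝓘(ℝ, E3) m →L[ℝ] ℝ), IsOpen U ∧
      a ∈ U ∧ IsBalanced ε ξ ξ' X α α' U := by
  have hε2 : ε * ε = 1 := by rcases hε with h | h <;> rw [h] <;> norm_num
  obtain ⟨U₁, hU₁, haU₁, α, hα⟩ := hpair.contact a
  obtain ⟨U₂, hU₂, haU₂, β, hβ⟩ := hpair.contact' a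
  set φ := extChartAt 𝓘(ℝ, E3) a with hφ
  set U := (U₁ ∩ U₂) ∩ (chartAt E3 a).source
  have hU : IsOpen U := (hU₁.inter hU₂).inter (chartAt E3 a).open_source
  have haU : a ∈ U := ⟨⟨haU₁, haU₂⟩, mem_chart_source E3 a⟩
  have hsrc : ∀ m ∈ U, m ∈ (chartAt E3 a).source := fun m hm => hm.2
  replace hα := hα.mono (V := U) fun m hm => hm.1.1
  replace hβ := hβ.mono (V := U) fun m hm => hm.1.2
  let A := formInChart α a
  let B := formInChart β a
  let wA : E3 → ℝ := fun z => wedgeExtD A A z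
    (EuclideanSpace.single 0 1) (EuclideanSpace.single 1 1) (EuclideanSpace.single 2 1)
  let wB : E3 → ℝ := fun z => wedgeExtD B B z
    (EuclideanSpace.single 0 1) (EuclideanSpace.single 1 1) (EuclideanSpace.single 2 1)
  have hA : ∀ m ∈ U, ContDiffAt ℝ ∞ A (φ m) := fun m hm => hα.contDiffAt hm (hsrc m hm)
  have hB : ∀ m ∈ U, ContDiffAt ℝ ∞ B (φ m) := fun m hm => hβ.contDiffAt hm (hsrc m hm)
  have hwA0 : ∀ m ∈ U, wA (φ m) ≠ 0 := fun m hm => hα.wedgeExtD_ne_zero hm (hsrc m hm)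
  have hwB0 : ∀ m ∈ U, wB (φ m) ≠ 0 := fun m hm => hβ.wedgeExtD_ne_zero hm (hsrc m hm)
  have hwα : ∀ m ∈ U, ∀ u v w, wedgeD α α m u v w =
      det₃ (chartD a m u) (chartD a m v) (chartD a m w) * wA (φ m) := fun m hm u v w => by
    rw [wedgeD_eq_wedgeExtD (hsrc m hm) (hA m hm), wedgeExtD_eq_det]
  have hwβ : ∀ m ∈ U, ∀ u v w, wedgeD β β m u v w =
      det₃ (chartD a m u) (chartD a m v) (chartD a m w) * wB (φ m) := fun m hm u v w => by
    rw [wedgeD_eq_wedgeExtD (hsrc m hm) (hB m hm), wedgeExtD_eq_det]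
  -- The positive ratio by which β ∧ dβ must be multiplied for balance; β is therefore rescaled by
  -- ±√ρ, which leaves only a sign to choose.
  let ρ : E3 → ℝ := fun z => ε * wA z / wB z
  have hρ : ∀ m ∈ U, 0 < ρ (φ m) ∧ wedgeD α α m = (ε * ρ (φ m)) • wedgeD β β m := by
    intro m hm
    obtain ⟨r, hr, hw⟩ := hpair.orientation U α β hU hα hβ m hm
    have hρr : ρ (φ m) = r := by
      obtain ⟨u, hu⟩ := chartD_surjective (hsrc m hm) (EuclideanSpace.single 0 1)
      obtain ⟨v, hv⟩ := chartD_surjective (hsrc m hm) (EuclideanSpace.single 1 1)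
      obtain ⟨w, hw'⟩ := chartD_surjective (hsrc m hm) (EuclideanSpace.single 2 1)
      have h1 := congrFun (congrFun (congrFun hw u) v) w
      simp only [Pi.smul_apply, smul_eq_mul] at h1
      rw [hwα m hm, hwβ m hm, hu, hv, hw'] at h1
      have h2 : det₃ (EuclideanSpace.single 0 1) (EuclideanSpace.single 1 1)
          (EuclideanSpace.single 2 1) = 1 := by simp [det₃]
      rw [h2, one_mul, one_mul] at h1
      simp only [ρ]
      rw [div_eq_iff (hwB0 m hm), h1]
      linear_combination r * wB (φ m) * hε2
    rw [hρr]
    exact ⟨hr, hw⟩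
  have hρs : ∀ m ∈ U, ContDiffAt ℝ ∞ ρ (φ m) := fun m hm => by
    have h1 := (hA m hm).wedgeExtD (hA m hm) (EuclideanSpace.single 0 1)
      (EuclideanSpace.single 1 1) (EuclideanSpace.single 2 1)
    have h2 := (hB m hm).wedgeExtD (hB m hm) (EuclideanSpace.single 0 1)
      (EuclideanSpace.single 1 1) (EuclideanSpace.single 2 1)
    exact (contDiffAt_const.mul h1).div h2 (hwB0 m hm)
  -- The field Z of (α, β) is the axis field divided by wA, so q has the sign of Z relative to X. By
  -- continuity this sign persists near a, and the constant σ corrects it.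
  let q : M → ℝ := fun m => wA (φ m) * inner ℝ (axisField A B (φ m)) (chartD a m (X m))
  have haxis : ∀ m ∈ U, ∃ t : ℝ, axisField A B (φ m) = t • chartD a m (X m) := by
    intro m hm
    obtain ⟨x, hx⟩ := chartD_surjective (hsrc m hm) (axisField A B (φ m))
    have h1 : x ∈ ξ m ⊓ ξ' m := by
      refine ⟨(hα.ker_eq m hm x).2 ?_, (hβ.ker_eq m hm x).2 ?_⟩
      · rw [← formInChart_chartD α (hsrc m hm), hx]
        exact (apply_axisField _).1
      · rw [← formInChart_chartD β (hsrc m hm), hx]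
        exact (apply_axisField _).2
    rw [← hX.span_eq m] at h1
    obtain ⟨t, ht⟩ := Submodule.mem_span_singleton.1 h1
    exact ⟨t, by rw [← hx, ← ht, map_smul]⟩
  have hq0 : q a ≠ 0 := by
    obtain ⟨t, ht⟩ := haxis a haU
    have h0 : axisField A B (φ a) ≠ 0 := axisField_ne_zero
      (hα.exists_indep_formInChart hβ haU (hsrc a haU) (hpair.transverse a))
    refine mul_ne_zero (hwA0 a haU) ?_
    have hx : chartD a a (X a) ≠ 0 := by
      intro hx
      rw [hx, smul_zero] at ht
      exact h0 ht
    have ht0 : t ≠ 0 := by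
      rintro rfl
      rw [zero_smul] at ht
      exact h0 ht
    rw [ht, real_inner_smul_left]
    exact mul_ne_zero ht0 (inner_self_ne_zero.2 hx)
  have hqc : ContinuousAt q a := by
    have hφc : ContinuousAt φ a := continuousAt_extChartAt_model (mem_chart_source E3 a)
    have hev := eventually_exists_extChartAt_eq (hU.mem_nhds haU)
    have hAs : SmoothNear A (φ a) := by
      filter_upwards [hev] with z ⟨m, hm, hma, hz⟩ using hz ▸ hA m hm
    have hBs : SmoothNear B (φ a) := by
      filter_upwards [hev] with z ⟨m, hm, hma, hz⟩ using hz ▸ hB m hm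
    have h1 : ContinuousAt (fun m => wA (φ m)) a :=
      ContinuousAt.comp (g := wA) ((hA a haU).wedgeExtD (hA a haU) _ _ _).continuousAt hφc
    have h2 : ContinuousAt (fun m => axisField A B (φ m)) a :=
      ContinuousAt.comp (g := axisField A B) (hAs.axisField hBs).continuousAt hφc
    exact h1.mul (ContinuousAt.inner (𝕜 := ℝ) h2 (continuousAt_chartD a hX.continuous))
  obtain ⟨σ, hσ2, hσq⟩ : ∃ σ : ℝ, σ * σ = 1 ∧ 0 < σ * q a := by
    rcases lt_or_gt_of_ne hq0 with h | h
    · exact ⟨-1, by norm_num, by linarith⟩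
    · exact ⟨1, by norm_num, by linarith⟩
  have hpos : ∀ᶠ m in 𝓝 a, m ∈ U ∧ 0 < σ * q m :=
    Filter.Eventually.and (hU.mem_nhds haU)
      ((continuousAt_const.mul hqc).eventually (lt_mem_nhds hσq))
  obtain ⟨V, hV, hVo, haV⟩ := eventually_nhds_iff.1 hpos
  let k : E3 → ℝ := fun z => σ * √(ρ z)
  have hσ0 : σ ≠ 0 := by rintro rfl; norm_num at hσ2
  have hk0 : ∀ m ∈ U, k (φ m) ≠ 0 := fun m hm =>
    mul_ne_zero hσ0 (Real.sqrt_pos.2 (hρ m hm).1).ne'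
  have hk2 : ∀ m ∈ U, k (φ m) ^ 2 = ρ (φ m) := fun m hm => by
    simp only [k]
    rw [mul_pow, Real.sq_sqrt (hρ m hm).1.le, pow_two, hσ2, one_mul]
  have hks : ∀ m ∈ U, ContDiffAt ℝ ∞ k (φ m) := fun m hm =>
    contDiffAt_const.mul ((hρs m hm).sqrt (hρ m hm).1.ne')
  let α' : ∀ m : M, TangentSpace 𝓘(ℝ, E3) m →L[ℝ] ℝ := fun m => k (φ m) • β m
  have hα'A : ∀ m ∈ U, formInChart α' a =ᶠ[𝓝 (φ m)] fun z => k z • B z := by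
    intro m hm
    filter_upwards [extChartAt_target_mem_nhds_model (hsrc m hm)] with z hz
    ext v
    have h : formInChart α' a z v = k (φ (φ.symm z)) * B z v := rfl
    rw [h, φ.right_inv hz]
    rfl
  have hα's : ∀ m ∈ U, ContDiffAt ℝ ∞ (formInChart α' a) (φ m) := fun m hm =>
    ((hks m hm).smul (hB m hm)).congr_of_eventuallyEq (hα'A m hm)
  have hwα' : ∀ m ∈ U, wedgeD α' α' m = ρ (φ m) • wedgeD β β m := by
    intro m hm
    funext u v w
    rw [wedgeD_eq_wedgeExtD (hsrc m hm) (hα's m hm),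
      wedgeExtD_congr (A' := fun z => k z • B z) (hα'A m hm).self_of_nhds (hα'A m hm),
      wedgeExtD_smul_self ((hks m hm).differentiableAt (by simp))
        ((hB m hm).differentiableAt (by simp)), hk2 m hm]
    simp only [Pi.smul_apply, smul_eq_mul]
    rw [wedgeD_eq_wedgeExtD (hsrc m hm) (hB m hm)]
  have hα' : IsContactForm ξ' α' U := by
    refine ⟨fun m hm => ?_, fun m hm v => ?_, fun m hm => ?_⟩
    · exact contDiffAt_formInChart (mem_chart_source E3 m) (hsrc m hm) (hα's m hm)
    · rw [hβ.ker_eq m hm]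
      change _ ↔ k (φ m) * β m v = 0
      rw [mul_eq_zero, or_iff_right (hk0 m hm)]
    · rw [hwα' m hm]
      exact smul_ne_zero (hρ m hm).1.ne' (hβ.nondeg m hm)
  have hVU : V ⊆ U := fun m hm => (hV m hm).1
  refine ⟨V, α, α', hVo, haV, hα.mono hVU, hα'.mono hVU, fun m hm => ?_, fun m hm => ?_⟩
  · rw [hwα' m (hVU hm), (hρ m (hVU hm)).2, smul_smul]
  · obtain ⟨hmU, hqm⟩ := hV m hm
    obtain ⟨t, ht⟩ := haxis m hmU
    have hst := Real.sqrt_pos.2 (hρ m hmU).1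
    have hpos' : 0 < σ * t * wA (φ m) := by
      have h1 : σ * q m = (σ * t * wA (φ m)) * inner ℝ (chartD a m (X m)) (chartD a m (X m)) := by
        simp only [q]
        rw [ht, real_inner_smul_left]; ring
      rw [h1] at hqm
      by_contra! h2
      exact hqm.not_ge (mul_nonpos_of_nonpos_of_nonneg h2 real_inner_self_nonneg)
    have hw0 := hwA0 m hmU
    -- This is k t / wA, the ratio of Z to X when the axis field is t X, written so that its
    -- positivity is visible.
    refine ⟨√(ρ (φ m)) * (σ * t * wA (φ m)) / wA (φ m) ^ 2,
      div_pos (mul_pos hst hpos') (by positivity), ?_⟩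
    funext u v
    have h1 : wedge₁₁ α α' m u v = k (φ m) * (A (φ m) (chartD a m u) * B (φ m) (chartD a m v) -
        A (φ m) (chartD a m v) * B (φ m) (chartD a m u)) := by
      simp only [A, B, hφ, formInChart_chartD _ (hsrc m hmU)]
      change α m u * (k (φ m) * β m v) - α m v * (k (φ m) * β m u) = _
      ring
    rw [h1, ← det₃_axisField, ht, hwα m hmU, map_smul, det₃_smul, det₃_smul]
    simp only [k]
    field_simp

end Balanced

/-! ### The normal form on the manifold -/

theorem mainTheorem4 {M : Type*} [TopologicalSpace M] [ChartedSpace E3 M]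
    [IsManifold 𝓘(ℝ, E3) ∞ M] (ε : ℝ) (hε : ε = 1 ∨ ε = -1)
    (ξ ξ' : ∀ m : M, Submodule ℝ (TangentSpace 𝓘(ℝ, E3) m))
    (hpair : IsTransverseContactPair ε ξ ξ')
    (X : ∀ m : M, TangentSpace 𝓘(ℝ, E3) m) (hX : OrientsAxis ξ ξ' X)
    (I : M → ℝ) (hI : IsGeneratingInvariant ε ξ ξ' X I)
    (c : ℝ) (hc : ∀ m : M, I m = c) :
    ∀ m₀ : M, ∃ e ∈ IsManifold.maximalAtlas 𝓘(ℝ, E3) ∞ M, m₀ ∈ e.source ∧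
      ∀ m ∈ e.source, e m 2 + c ≠ 0 ∧
        (∀ v : TangentSpace 𝓘(ℝ, E3) m,
          v ∈ ξ m ↔ coordDiff e 1 m v = e m 2 * coordDiff e 0 m v) ∧
        (∀ v : TangentSpace 𝓘(ℝ, E3) m,
          v ∈ ξ' m ↔ coordDiff e 1 m v + ε * (coordDiff e 0 m v / (e m 2 + c)) = 0) := by
  intro a
  obtain ⟨U, α, α', hU, haU, hbal⟩ := hpair.exists_isBalanced hε hX a
  have H := hbal.isBalancedPair hε (c := c) (hU.mem_nhds haU) (hpair.transverse a)
    fun m hm => by rw [hI U α α' hU hbal m hm, hc]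
  obtain ⟨Ψ, hΨa, hΨ, hΨs, hnf⟩ := H.exists_normalForm hε
  have hφ : ∀ m : M, extChartAt 𝓘(ℝ, E3) a m = chartAt E3 a m := fun m => by simp [mfld_simps]
  rw [hφ] at hΨa
  -- The normal-form coordinates are composed with the preferred chart, then restricted to the set
  -- where the balanced forms define the two distributions.
  let e := ((chartAt E3 a).trans Ψ).restrOpen U hU
  have hsrc : ∀ m ∈ e.source, m ∈ (chartAt E3 a).source ∧ chartAt E3 a m ∈ Ψ.source ∧ m ∈ U := by
    rintro m ⟨hm, hmU⟩
    rw [OpenPartialHomeomorph.trans_source] at hm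
    exact ⟨hm.1, hm.2, hmU⟩
  have hchart : ∀ m ∈ (chartAt E3 a).source,
      ContMDiffAt 𝓘(ℝ, E3) 𝓘(ℝ, E3) ∞ (chartAt E3 a) m := fun m hm =>
    contMDiffAt_of_mem_maximalAtlas (IsManifold.chart_mem_maximalAtlas a) hm
  have hchart' : ∀ z ∈ (chartAt E3 a).target,
      ContMDiffAt 𝓘(ℝ, E3) 𝓘(ℝ, E3) ∞ (chartAt E3 a).symm z := fun z hz =>
    contMDiffAt_symm_of_mem_maximalAtlas (IsManifold.chart_mem_maximalAtlas a) hz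
  refine ⟨e, ?_, ⟨⟨mem_chart_source E3 a, hΨa⟩, haU⟩, fun m hm => ?_⟩
  · refine e.mem_maximalAtlas_of_contMDiffOn (fun m hm => ?_) fun z hz => ?_
    · obtain ⟨h1, h2, -⟩ := hsrc m hm
      exact ((hΨ _ h2).contMDiffAt.comp m (hchart m h1)).contMDiffWithinAt
    · have h1 : z ∈ ((chartAt E3 a).trans Ψ).target := hz.1
      rw [OpenPartialHomeomorph.trans_target] at h1
      exact ((hchart' _ h1.2).comp z (hΨs z h1.1).contMDiffAt).contMDiffWithinAt
  · obtain ⟨h1, h2, hmU⟩ := hsrc m hm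
    have h2' := h2
    rw [← hφ] at h2'
    obtain ⟨k, hk, hne, hform⟩ := hnf _ h2'
    have hcoord : ∀ i (v : TangentSpace 𝓘(ℝ, E3) m),
        coordDiff e i m v = fderiv ℝ Ψ (extChartAt 𝓘(ℝ, E3) a m) (chartD a m v) i := by
      intro i v
      have hcomp : (e : M → E3) = Ψ ∘ extChartAt 𝓘(ℝ, E3) a := by
        funext x
        rw [Function.comp_apply, hφ]
        rfl
      have hd : MDifferentiableAt 𝓘(ℝ, E3) 𝓘(ℝ, E3) Ψ (extChartAt 𝓘(ℝ, E3) a m) :=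
        ((hΨ _ h2').differentiableAt (by simp)).mdifferentiableAt
      rw [coordDiff, hcomp, mfderiv_comp m hd (mdifferentiableAt_extChartAt h1), mfderiv_eq_fderiv]
      rfl
    have he : e m = Ψ (extChartAt 𝓘(ℝ, E3) a m) := by rw [hφ]; rfl
    rw [he]
    refine ⟨hne, fun v => ?_, fun v => ?_⟩
    · rw [hbal.contact.ker_eq m hmU, ← formInChart_chartD α h1, (hform _).1, hcoord, hcoord,
        mul_eq_zero, or_iff_right hk, sub_eq_zero]
    · rw [hbal.contact'.ker_eq m hmU, ← formInChart_chartD α' h1, (hform _).2, hcoord, hcoord,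
        mul_eq_zero, or_iff_right hk]
      have key : ∀ d x y : ℝ, d ≠ 0 → (d * y + ε * x = 0 ↔ y + ε * (x / d) = 0) := by
        intro d x y hd
        rw [show y + ε * (x / d) = (d * y + ε * x) / d by field_simp, div_eq_zero_iff,
          or_iff_left hd]
      exact key _ _ _ hne
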